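/- Let $\mathcal M$ be a von Neumann algebra with a normal faithful finite trace $\tau$. For $x\in\mathcal M$ write $\|x\|_p=\tau(|x|^p)^{1/p}$ $(0<p<\infty)$ and $\|x\|_\infty$ for the operator norm, and let $L_p(\mathcal M)$ be the completion of $(\mathcal M,\|\cdot\|_p)$ for $1\le p<\infty$ and $L_\infty(\mathcal M)=\mathcal M$. Let $|||T|||_{1\to\infty}\in[0,\infty]$ denote the norm of $T$ as an operator from $L_1(\mathcal M)$ to $L_\infty(\mathcal M)$. Let $(T_t)_{t>0}$ be a symmetric positive contraction semigroup on $(\mathcal M,\tau)$: linear maps $T_t:\mathcal M\to\mathcal M$ with $T_{s+t}=T_sT_t$ such that, for every $t>0$, (i) $\|T_tx\|_\infty\le\|x\|_\infty$ for all $x\in\mathcal M$; (ii) $\tau(T_tx)\le\tau(x)$ for all $x\ge0$; (iii) $x\ge 0$ implies $T_tx\ge0$; (iv) $\tau(T_t(y)^*x)=\tau(y^*T_t(x))$ for all $x,y\in\mathcal M$; and such that $T_tx\to x$ in the w*-topology of $\mathcal M$ as $t\to0^+$, for every $x\in\mathcal M$. Let $L$ be its (negative) generator on $L_2(\mathcal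 M)$, $Lx=\lim_{t\to0^+}(x-T_tx)/t$, so that $T_t=e^{-tL}$. Let $M:(0,\infty)\to\mathbb R$ be decreasing (not necessarily strictly). For a constant $C>0$ consider the logarithmic Sobolev inequality $$\tau(x^2\log x)\le\varepsilon\,\tau(x\,Lx)+C\,M(\varepsilon)\,\|x\|_2^2+\|x\|_2^2\log\|x\|_2 ,\qquad(\mathrm{LS}_C)$$ with the convention $0\log 0=0$. (a) If $|||T_t|||_{1\to\infty}\le e^{M(t)}$ for all $t>0$, then there is a constant $C>0$ such that $(\mathrm{LS}_C)$ holds for all positive $x\in\mathrm{Dom}(L)\cap L_1(\mathcal M)\cap L_\infty(\mathcal M)$ and all $\varepsilon>0$. (b) Conversely, let $C>0$ and suppose that $(\mathrm{LS}_C)$ holds for all positive $x\in\mathrm{Dom}(L)\cap L_1(\mathcal M)\cap L_\infty(\mathcal M)$ and all $\varepsilon>0$. Put $\overline M(t)=\frac{2C}{t}\int_0^tM(s)\,ds$. Then $|||T_{2t}|||_{1\to\infty}\le e^{\overline M(t)}$ for every $t>0$ for which the integral is finite (that is, for which $M$ is integrable on $(0,t)$). -/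

import Mathlib

open Set Filter Topology MeasureTheory
open scoped ComplexOrder InnerProductSpace ENNReal

noncomputable section

namespace UltraLogSobolev

section Trace

variable {𝓜 : Type*} [CStarAlgebra 𝓜] [PartialOrder 𝓜]

/-- A positive functional on a von Neumann algebra is normal if it preserves suprema of bounded
increasing families of positive elements. -/
def IsNormal (f : 𝓜 →ₚ[ℂ] ℂ) : Prop :=
  ∀ S : Set 𝓜, S.Nonempty → (∀ y ∈ S, 0 ≤ y) → DirectedOn (· ≤ ·) S →
    ∀ x : 𝓜, IsLUB S x → IsLUB ((fun y => (f y).re) '' S) (f x).re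

/-- Normal faithful finite traces. Finiteness is built in: `τ` is defined on all of `𝓜`. -/
structure IsNormalFaithfulFiniteTrace (τ : 𝓜 →ₚ[ℂ] ℂ) : Prop where
  tracial : ∀ x y : 𝓜, τ (x * y) = τ (y * x)
  faithful : ∀ x : 𝓜, 0 ≤ x → τ x = 0 → x = 0
  normal : IsNormal τ

variable [StarOrderedRing 𝓜]

/-- `‖x‖_p = τ(|x|^p)^{1/p}` for `x ∈ 𝓜` and `0 < p < ∞`, where `|x| = (x^* x)^{1/2}`. -/
def lpNorm (τ : 𝓜 →ₚ[ℂ] ℂ) (p : ℝ) (x : 𝓜) : ℝ :=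
  (τ (CFC.abs x ^ p)).re ^ (1 / p)

/-- `|||S|||_{1 → ∞} ∈ [0, ∞]`. Since the trace is finite, `𝓜` is dense in `L_1(𝓜)`, and the
supremum over the unit ball may be taken over elements of `𝓜`. -/
def opNormOneTop (τ : 𝓜 →ₚ[ℂ] ℂ) (S : 𝓜 →ₗ[ℂ] 𝓜) : ℝ≥0∞ :=
  ⨆ (x : 𝓜) (_ : lpNorm τ 1 x ≤ 1), ENNReal.ofReal ‖S x‖

/-- `L_2(𝓜)`: the Hilbert space completion of `𝓜` for the inner product
`⟨x, y⟩ = τ(x^* y)`. -/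
abbrev L2 (τ : 𝓜 →ₚ[ℂ] ℂ) : Type _ := τ.GNS

/-- The canonical map `𝓜 → L_2(𝓜)`. -/
def toL2 (τ : 𝓜 →ₚ[ℂ] ℂ) (x : 𝓜) : L2 τ := (τ.toPreGNS x : τ.GNS)

end Trace

section Semigroup

variable {𝓜 : Type*} [CStarAlgebra 𝓜] [PartialOrder 𝓜]

/-- `(T_t)_{t > 0}` is a symmetric positive contraction semigroup on `(𝓜, τ)`; the values of `T`
at `t ≤ 0` play no role. The w*-topology of a von Neumann algebra is the one induced by its
normal positive functionals. -/
structure IsSymmetricPositiveContractionSemigroup (τ : 𝓜 →ₚ[ℂ] ℂ) (T : ℝ → 𝓜 →ₗ[ℂ] 𝓜) :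
    Prop where
  semigroup : ∀ s t : ℝ, 0 < s → 0 < t → ∀ x : 𝓜, T (s + t) x = T s (T t x)
  contraction : ∀ t : ℝ, 0 < t → ∀ x : 𝓜, ‖T t x‖ ≤ ‖x‖
  trace_le : ∀ t : ℝ, 0 < t → ∀ x : 𝓜, 0 ≤ x → (τ (T t x)).re ≤ (τ x).re
  positive : ∀ t : ℝ, 0 < t → ∀ x : 𝓜, 0 ≤ x → 0 ≤ T t x
  symmetric : ∀ t : ℝ, 0 < t → ∀ x y : 𝓜, τ (star (T t y) * x) = τ (star y * T t x)
  wstar_continuous : ∀ x : 𝓜, ∀ f : 𝓜 →ₚ[ℂ] ℂ, IsNormal f →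
    Tendsto (fun t => f (T t x)) (𝓝[>] 0) (𝓝 (f x))

variable [StarOrderedRing 𝓜]

/-- For `x ∈ 𝓜` and `y ∈ L_2(𝓜)`: `x` belongs to the domain of the (negative) generator `L` of
the semigroup on `L_2(𝓜)`, and `L x = y`, i.e. `(x - T_t x) / t → y` in `L_2(𝓜)` as
`t → 0+`. -/
def IsGeneratorAt (τ : 𝓜 →ₚ[ℂ] ℂ) (T : ℝ → 𝓜 →ₗ[ℂ] 𝓜) (x : 𝓜) (y : L2 τ) : Prop :=
  Tendsto (fun t : ℝ => ((t⁻¹ : ℝ) : ℂ) • (toL2 τ x - toL2 τ (T t x))) (𝓝[>] 0) (𝓝 y)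

/-- `|||T_t|||_{1 → ∞} ≤ e^{M(t)}` for all `t > 0`. -/
def IsUltracontractive (τ : 𝓜 →ₚ[ℂ] ℂ) (T : ℝ → 𝓜 →ₗ[ℂ] 𝓜) (M : ℝ → ℝ) : Prop :=
  ∀ t : ℝ, 0 < t → opNormOneTop τ (T t) ≤ ENNReal.ofReal (Real.exp (M t))

/-- The logarithmic Sobolev inequality
`τ(x² log x) ≤ ε τ(x L x) + C M(ε) ‖x‖_2² + ‖x‖_2² log ‖x‖_2` for all `ε > 0` and all
positive `x ∈ Dom(L) ∩ L_1(𝓜) ∩ L_∞(𝓜) = Dom(L) ∩ 𝓜`. Here `x² log x` is given by the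
functional calculus of `x` for the continuous function `u ↦ u² log u` on `[0, ∞)`
(with value `0` at `0`), and `τ(x L x) = ⟨x, L x⟩` in `L_2(𝓜)`. -/
def LogSobolev (τ : 𝓜 →ₚ[ℂ] ℂ) (T : ℝ → 𝓜 →ₗ[ℂ] 𝓜) (M : ℝ → ℝ) (C : ℝ) : Prop :=
  ∀ x : 𝓜, 0 ≤ x → ∀ Lx : L2 τ, IsGeneratorAt τ T x Lx → ∀ ε : ℝ, 0 < ε →
    (τ (cfc (fun u : ℝ => u ^ 2 * Real.log u) x)).re ≤
      ε * (⟪toL2 τ x, Lx⟫_ℂ).re + C * M ε * lpNorm τ 2 x ^ 2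
        + lpNorm τ 2 x ^ 2 * Real.log (lpNorm τ 2 x)

/-- `M̄(t) = (2C/t) ∫_0^t M(s) ds`. -/
def averaged (C : ℝ) (M : ℝ → ℝ) (t : ℝ) : ℝ :=
  2 * C / t * ∫ s in (0 : ℝ)..t, M s

end Semigroup

end UltraLogSobolev

end

/-!
Both directions compare `T_t` on `L_2` with powers of a positive element `x`.

*From ultracontractivity to the logarithmic Sobolev inequality.* The bound `e^{M(2ε)}` of `T_{2ε}`
from `L_1` to `L_∞` is, by duality, a bound `e^{M(2ε)/2}` of `T_ε` from `L_1` to `L_2`. Since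
`‖x y‖_1 ≤ ‖x‖_2 ‖y‖_2` (`trace_abs_mul_le`), the operator `T_ε π(x)` on `L_2`, with `π(x)` the left
multiplication by `x`, has norm at most `b = e^{M(2ε)/2} ‖x‖_2`. Hence `T_ε² ≤ b² π(x)⁻²`, up to a
regularization of `x`, and the Löwner–Heinz inequality yields `T_{εh} ≤ b^h π(x)^{-h}` for
`0 < h ≤ 2` (`semigroupL2_mul_le`). Evaluated at the vector `x` both sides equal `‖x‖_2²` at
`h = 0`, and comparing the derivatives at `h = 0` gives
`τ(x² log x) ≤ ε τ(x L x) + ‖x‖_2² log b`, which is the claim with `C = 1/2` because `M` decreases.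

*From the logarithmic Sobolev inequality to ultracontractivity.* This is Gross' argument. For
`x ≥ 0` let `x_s = T_s x` and `p(s) = 2t / (t - s)`, so that `p` increases from `2` to `∞` on
`[0, t)`. The derivative of `log ‖x_s‖_{p(s)}` combines the entropy `τ(x_s^p log x_s)` and the
energy `τ(x_s^{p-1} L x_s)`. The logarithmic Sobolev inequality for `x_s^{p/2}` with `ε = t - s` bounds it
by `(C/t) M(t - s)` (`LogSobolev.rpow`, `log_powerTrace_le`), the energy of `x_s^{p/2}` being
controlled by the Stroock–Varopoulos inequality. Integration and `s → t` give the bound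
`K = exp((C/t) ∫_0^t M)` of `T_t` from `L_2` to `L_∞` on positive elements.

Noncommutativity enters in three places. Scalar inequalities `∑ f_m(a) g_m(b) ≥ 0` become trace
inequalities `∑ τ(f_m(x) S(g_m(y))) ≥ 0` for positive maps `S` (`sum_trace_cfc_mul_nonneg`), which
covers Klein's inequality, the Stroock–Varopoulos inequality and the continuity of the functional
calculus in `L_2`. Elements such as `x_s^{p/2}` need not lie in the domain of `L`, so the inequality
is applied to `T_r x_s^{p/2}` and `r → 0` (`LogSobolev.of_energy_le`); this uses the spectral
representation `T_t = T_1^t` on `L_2` (`semigroupL2_eq_cfc`). Finally, the passage from positive to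
arbitrary elements must not lose a constant: for `x = y + i z` with `y`, `z` self-adjoint one has
`‖y‖_1² + τ(z)² ≤ ‖x‖_1²` and `‖z‖_1² + τ(y)² ≤ ‖x‖_1²` (`sq_trace_abs_add_sq_trace_le`), and these
give the bound `K` from `L_1` to `L_2` and so `K²` for `T_{2t}` from `L_1` to `L_∞`
(`opNormOneTop_le`).
-/

noncomputable section

namespace UltraLogSobolev

set_option linter.unusedSectionVars false

/-! ### The trace and the Hilbert space `L_2` -/

section Basics

variable {𝓜 : Type*} [CStarAlgebra 𝓜] [PartialOrder 𝓜] [StarOrderedRing 𝓜] {τ : 𝓜 →ₚ[ℂ] ℂ}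

lemma toL2_add (x y : 𝓜) : toL2 τ (x + y) = toL2 τ x + toL2 τ y := by
  simp only [toL2, map_add, UniformSpace.Completion.coe_add]

lemma toL2_smul (c : ℂ) (x : 𝓜) : toL2 τ (c • x) = c • toL2 τ x := by
  simp only [toL2, map_smul, UniformSpace.Completion.coe_smul]

variable (τ) in
/-- The canonical map `𝓜 → L_2(𝓜)` as a linear map. -/
def toL2Lin : 𝓜 →ₗ[ℂ] L2 τ where
  toFun := toL2 τ
  map_add' := toL2_add
  map_smul' := toL2_smul

lemma toL2_sub (x y : 𝓜) : toL2 τ (x - y) = toL2 τ x - toL2 τ y := map_sub (toL2Lin τ) x y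

lemma toL2_zero : toL2 τ (0 : 𝓜) = 0 := map_zero (toL2Lin τ)

lemma toL2_real_smul (c : ℝ) (x : 𝓜) : toL2 τ (c • x) = c • toL2 τ x := by
  rw [← Complex.coe_smul, toL2_smul, Complex.coe_smul]

lemma inner_toL2 (x y : 𝓜) : ⟪toL2 τ x, toL2 τ y⟫_ℂ = τ (star x * y) := by
  simp only [toL2, UniformSpace.Completion.inner_coe]
  rfl

lemma norm_toL2_sq (x : 𝓜) : ‖toL2 τ x‖ ^ 2 = (τ (star x * x)).re := by
  rw [← inner_toL2, inner_self_eq_norm_sq_to_K]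
  norm_cast

lemma denseRange_toL2 : DenseRange (toL2 τ) :=
  UniformSpace.Completion.denseRange_coe (α := τ.PreGNS)

lemma trace_star (x : 𝓜) : τ (star x) = star (τ x) := map_star τ x

lemma trace_real_smul (c : ℝ) (x : 𝓜) : (τ (c • x)).re = c * (τ x).re := by
  rw [← Complex.coe_smul, map_smul]; simp

lemma trace_re_mono {x y : 𝓜} (h : x ≤ y) : (τ x).re ≤ (τ y).re :=
  (Complex.le_def.1 (OrderHomClass.mono τ h)).1

lemma trace_re_nonneg {x : 𝓜} (h : 0 ≤ x) : 0 ≤ (τ x).re := by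
  simpa using trace_re_mono (τ := τ) h

lemma trace_ofReal_re {x : 𝓜} (h : IsSelfAdjoint x) : ((τ x).re : ℂ) = τ x := by
  have := trace_star (τ := τ) x
  rw [h.star_eq] at this
  exact (Complex.conj_eq_iff_re.1 this.symm)

lemma trace_star_mul_self_le (a x : 𝓜) :
    (τ (star (a * x) * (a * x))).re ≤ ‖a‖ ^ 2 * (τ (star x * x)).re := by
  have : star (a * x) * (a * x) ≤ ‖a‖ ^ 2 • (star x * x) := by
    have := CStarAlgebra.star_left_conjugate_le_norm_smul (a := x) (b := star a * a)
    rw [CStarRing.norm_star_mul_self, ← sq] at this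
    simpa [mul_assoc, smul_mul_assoc] using this
  calc _ ≤ _ := trace_re_mono this
    _ = _ := trace_real_smul _ _

lemma norm_toL2_mul_le (a x : 𝓜) : ‖toL2 τ (a * x)‖ ≤ ‖a‖ * ‖toL2 τ x‖ := by
  rw [← sq_le_sq₀ (by positivity) (by positivity), mul_pow, norm_toL2_sq, norm_toL2_sq]
  exact trace_star_mul_self_le a x

lemma norm_toL2_le (x : 𝓜) : ‖toL2 τ x‖ ≤ ‖toL2 τ (1 : 𝓜)‖ * ‖x‖ := by
  simpa [mul_comm] using norm_toL2_mul_le (τ := τ) x 1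

lemma norm_toL2_star (hτ : IsNormalFaithfulFiniteTrace τ) (x : 𝓜) :
    ‖toL2 τ (star x)‖ = ‖toL2 τ x‖ := by
  rw [← sq_eq_sq₀ (by positivity) (by positivity), norm_toL2_sq, norm_toL2_sq, star_star,
    hτ.tracial]

lemma toL2_eq_zero (hτ : IsNormalFaithfulFiniteTrace τ) {x : 𝓜} (h : toL2 τ x = 0) : x = 0 := by
  have h1 : (τ (star x * x)).re = 0 := by rw [← norm_toL2_sq, h]; simp
  have h2 := hτ.faithful _ (star_mul_self_nonneg x) (by
    rw [← trace_ofReal_re (IsSelfAdjoint.star_mul_self x), h1]; simp)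
  exact CStarRing.star_mul_self_eq_zero_iff x |>.1 h2

lemma eq_zero_of_trace_re_eq_zero (hτ : IsNormalFaithfulFiniteTrace τ) {x : 𝓜} (hx : 0 ≤ x)
    (h : (τ x).re ≤ 0) : x = 0 :=
  hτ.faithful _ hx (by
    rw [← trace_ofReal_re (IsSelfAdjoint.of_nonneg hx), le_antisymm h (trace_re_nonneg hx)]; simp)

/-- The trace of a product of two positive elements is nonnegative. -/
lemma trace_mul_nonneg (hτ : IsNormalFaithfulFiniteTrace τ) {a b : 𝓜} (ha : 0 ≤ a) (hb : 0 ≤ b) :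
    0 ≤ (τ (a * b)).re := by
  obtain ⟨c, hc, rfl⟩ := CStarAlgebra.nonneg_iff_exists_isSelfAdjoint_and_eq_mul_self.1 ha
  rw [mul_assoc, hτ.tracial]
  refine trace_re_nonneg ?_
  have := star_left_conjugate_nonneg hb c
  rwa [hc.star_eq] at this

lemma trace_mul_le_mul (hτ : IsNormalFaithfulFiniteTrace τ) {a b c : 𝓜} (ha : 0 ≤ a) (hbc : b ≤ c) :
    (τ (a * b)).re ≤ (τ (a * c)).re := by
  have := trace_mul_nonneg hτ ha (sub_nonneg.2 hbc)
  rw [mul_sub, map_sub, Complex.sub_re] at this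
  linarith

lemma norm_trace_mul_le (a b : 𝓜) : ‖τ (a * b)‖ ≤ ‖toL2 τ (star a)‖ * ‖toL2 τ b‖ := by
  have := norm_inner_le_norm (𝕜 := ℂ) (toL2 τ (star a)) (toL2 τ b)
  rwa [inner_toL2, star_star] at this

lemma norm_trace_le (a : 𝓜) : ‖τ a‖ ≤ ‖toL2 τ (1 : 𝓜)‖ ^ 2 * ‖a‖ := by
  have := norm_trace_mul_le (τ := τ) 1 a
  rw [one_mul, star_one] at this
  refine this.trans ?_
  have := norm_toL2_le (τ := τ) a
  nlinarith [norm_nonneg (toL2 τ (1 : 𝓜))]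

/-- Hölder's inequality for a positive element and a bounded one. -/
lemma norm_trace_mul_le_of_nonneg (hτ : IsNormalFaithfulFiniteTrace τ) {h : 𝓜} (hh : 0 ≤ h)
    (w : 𝓜) : ‖τ (h * w)‖ ≤ (τ h).re * ‖w‖ := by
  obtain ⟨c, hc, rfl⟩ := CStarAlgebra.nonneg_iff_exists_isSelfAdjoint_and_eq_mul_self.1 hh
  have h1 : (τ (c * c)).re = ‖toL2 τ c‖ ^ 2 := by rw [norm_toL2_sq, hc.star_eq]
  have h2 : ‖toL2 τ (c * w)‖ ≤ ‖toL2 τ c‖ * ‖w‖ := by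
    rw [← norm_toL2_star hτ, star_mul, hc.star_eq, mul_comm, ← norm_star w]
    exact norm_toL2_mul_le _ _
  calc _ = ‖τ (c * (c * w))‖ := by rw [mul_assoc]
    _ ≤ _ := norm_trace_mul_le _ _
    _ ≤ ‖toL2 τ c‖ * (‖toL2 τ c‖ * ‖w‖) := by rw [hc.star_eq]; gcongr
    _ = _ := by rw [h1]; ring

lemma lpNorm_one (x : 𝓜) : lpNorm τ 1 x = (τ (CFC.abs x)).re := by
  simp only [lpNorm, div_one, Real.rpow_one]
  rw [CFC.rpow_one _ (CFC.abs_nonneg x)]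

lemma lpNorm_two (x : 𝓜) : lpNorm τ 2 x = ‖toL2 τ x‖ := by
  have : CFC.abs x ^ (2 : ℝ) = star x * x := by
    rw [← CFC.abs_sq, ← CFC.rpow_natCast _ _ (CFC.abs_nonneg x)]; norm_num
  rw [lpNorm, this, ← norm_toL2_sq, ← Real.sqrt_eq_rpow, Real.sqrt_sq (norm_nonneg _)]

end Basics

/-! ### Positivity of traces of products of functions -/

section Pairing

variable {𝓜 : Type*} [CStarAlgebra 𝓜] [PartialOrder 𝓜] [StarOrderedRing 𝓜] {τ : 𝓜 →ₚ[ℂ] ℂ}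

lemma spectrum_subset_Icc {x : 𝓜} (hx : 0 ≤ x) (hx1 : ‖x‖ ≤ 1) : spectrum ℝ x ⊆ Icc 0 1 := by
  intro u hu
  refine ⟨spectrum_nonneg_of_nonneg hx hu, ?_⟩
  have h := (le_algebraMap_iff_spectrum_le (R := ℝ) (r := 1) (a := x)).1 (by
    have := (CStarAlgebra.norm_le_one_iff_of_nonneg x).1 hx1
    simpa using this)
  exact h u hu

lemma continuous_trace : Continuous (fun x : 𝓜 => (τ x).re) :=
  Complex.continuous_re.comp (map_continuous τ)

/-- The Bernstein polynomials of `f` converge to `f` in the functional calculus. -/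
lemma tendsto_sum_bernstein {x : 𝓜} (hx : 0 ≤ x) (hx1 : ‖x‖ ≤ 1) {f : ℝ → ℝ}
    (hf : ContinuousOn f (Icc 0 1)) :
    Tendsto (fun n : ℕ => ∑ k : Fin (n + 1),
      f (k / n) • cfc (fun u : ℝ => (bernsteinPolynomial ℝ n k).eval u) x) atTop
      (𝓝 (cfc f x)) := by
  have hsp := spectrum_subset_Icc hx hx1
  let F : C(unitInterval, ℝ) := ⟨fun u => f u, hf.domRestrict⟩
  have hF := Metric.tendsto_nhds.1 (bernsteinApproximation_uniform F)
  rw [Metric.tendsto_nhds]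
  intro ε hε
  filter_upwards [hF (ε / 2) (by positivity)] with n hn
  have hsum : (∑ k : Fin (n + 1),
      f (k / n) • cfc (fun u : ℝ => (bernsteinPolynomial ℝ n k).eval u) x) =
      cfc (∑ k : Fin (n + 1), fun u : ℝ => f (k / n) * (bernsteinPolynomial ℝ n k).eval u) x := by
    rw [cfc_sum_univ _ _ (fun i => by fun_prop)]
    refine Finset.sum_congr rfl fun k _ => ?_
    rw [cfc_const_mul _ _ _ (by fun_prop)]
  rw [hsum, dist_eq_norm, ← cfc_sub _ _ x (by
    rw [Finset.sum_fn]
    fun_prop) (hf.mono hsp)]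
  refine lt_of_le_of_lt (norm_cfc_le (c := ε / 2) (by positivity) fun u hu => ?_) (by linarith)
  have h := (ContinuousMap.dist_lt_iff (by positivity)).1 hn ⟨u, hsp hu⟩
  rw [Real.dist_eq, bernsteinApproximation.apply] at h
  rw [Real.norm_eq_abs, Finset.sum_apply]
  refine le_of_eq_of_le ?_ h.le
  congr 2
  refine Finset.sum_congr rfl fun k _ => ?_
  rw [smul_eq_mul, mul_comm]
  rfl

/-- Positivity transfers from functions of two real variables to the trace: if
`∑ f_m(a) g_m(b) ≥ 0` on the unit square, then `∑ τ(f_m(x) S(g_m(y))) ≥ 0` for a positive map `S`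
and arbitrary, possibly noncommuting, `x` and `y` between `0` and `1`. By Bernstein approximation
the sum is a limit of combinations with coefficients `∑ f_m(j/n) g_m(k/n) ≥ 0` of the numbers
`τ(b_j(x) S(b_k(y))) ≥ 0`. -/
theorem sum_trace_cfc_mul_nonneg (hτ : IsNormalFaithfulFiniteTrace τ) {S : 𝓜 →ₗ[ℂ] 𝓜}
    (hS : ∀ x, 0 ≤ x → 0 ≤ S x) (hSc : Continuous S) {x y : 𝓜} (hx : 0 ≤ x) (hx1 : ‖x‖ ≤ 1)
    (hy : 0 ≤ y) (hy1 : ‖y‖ ≤ 1) {ι : Type*} (s : Finset ι) {f g : ι → ℝ → ℝ}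
    (hf : ∀ m ∈ s, ContinuousOn (f m) (Icc 0 1)) (hg : ∀ m ∈ s, ContinuousOn (g m) (Icc 0 1))
    (h : ∀ a ∈ Icc (0 : ℝ) 1, ∀ b ∈ Icc (0 : ℝ) 1, 0 ≤ ∑ m ∈ s, f m a * g m b) :
    0 ≤ ∑ m ∈ s, (τ (cfc (f m) x * S (cfc (g m) y))).re := by
  let b (n : ℕ) (k : Fin (n + 1)) (u : ℝ) : ℝ := (bernsteinPolynomial ℝ n k).eval u
  have hb : ∀ (n : ℕ) (k : Fin (n + 1)) (z : 𝓜), 0 ≤ z → ‖z‖ ≤ 1 → 0 ≤ cfc (b n k) z := by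
    intro n k z hz hz1
    refine cfc_nonneg fun u hu => ?_
    exact bernstein_nonneg (n := n) (ν := k) (x := ⟨u, spectrum_subset_Icc hz hz1 hu⟩)
  have key : Tendsto (fun n : ℕ => ∑ m ∈ s,
      (τ ((∑ k : Fin (n + 1), f m (k / n) • cfc (b n k) x) *
        S (∑ k : Fin (n + 1), g m (k / n) • cfc (b n k) y))).re) atTop
      (𝓝 (∑ m ∈ s, (τ (cfc (f m) x * S (cfc (g m) y))).re)) := by
    refine tendsto_finsetSum _ fun m hm => ?_
    refine (continuous_trace.tendsto _).comp ?_
    exact (tendsto_sum_bernstein hx hx1 (hf m hm)).mul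
      ((hSc.tendsto _).comp (tendsto_sum_bernstein hy hy1 (hg m hm)))
  refine ge_of_tendsto' key fun n => ?_
  have hexp : ∀ m ∈ s, (τ ((∑ k : Fin (n + 1), f m (k / n) • cfc (b n k) x) *
        S (∑ k : Fin (n + 1), g m (k / n) • cfc (b n k) y))).re =
      ∑ j : Fin (n + 1), ∑ k : Fin (n + 1),
        (f m (j / n) * g m (k / n)) * (τ (cfc (b n j) x * S (cfc (b n k) y))).re := by
    intro m _
    rw [map_sum, Finset.sum_mul_sum, map_sum, Complex.re_sum]
    refine Finset.sum_congr rfl fun j _ => ?_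
    rw [map_sum, Complex.re_sum]
    refine Finset.sum_congr rfl fun k _ => ?_
    rw [← Complex.coe_smul (g m _), map_smul, Complex.coe_smul, smul_mul_smul_comm,
      trace_real_smul]
  rw [Finset.sum_congr rfl hexp, Finset.sum_comm]
  refine Finset.sum_nonneg fun j _ => ?_
  rw [Finset.sum_comm]
  refine Finset.sum_nonneg fun k _ => ?_
  rw [← Finset.sum_mul]
  have hmem : ∀ i : Fin (n + 1), ((i : ℝ) / n) ∈ Icc (0 : ℝ) 1 := fun i =>
    ⟨by positivity, div_le_one_of_le₀ (by exact_mod_cast i.is_le) (by positivity)⟩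
  exact mul_nonneg (h _ (hmem j) _ (hmem k))
    (trace_mul_nonneg hτ (hb n j x hx hx1) (hS _ (hb n k y hy hy1)))

end Pairing

/-! ### Trace inequalities -/

section TraceInequalities

variable {𝓜 : Type*} [CStarAlgebra 𝓜] [PartialOrder 𝓜] [StarOrderedRing 𝓜] {τ : 𝓜 →ₚ[ℂ] ℂ}

lemma continuous_rpow {p : ℝ} (hp : 0 ≤ p) : Continuous fun u : ℝ => u ^ p :=
  Real.continuous_rpow_const hp

/-- `sum_trace_cfc_mul_nonneg` for five summands, with the sum written out. -/
lemma sum_five_trace_nonneg (hτ : IsNormalFaithfulFiniteTrace τ) {S : 𝓜 →ₗ[ℂ] 𝓜}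
    (hS : ∀ x, 0 ≤ x → 0 ≤ S x) (hSc : Continuous S) {x y : 𝓜} (hx : 0 ≤ x) (hx1 : ‖x‖ ≤ 1)
    (hy : 0 ≤ y) (hy1 : ‖y‖ ≤ 1) {f₁ f₂ f₃ f₄ f₅ g₁ g₂ g₃ g₄ g₅ : ℝ → ℝ}
    (hf₁ : ContinuousOn f₁ (Icc 0 1)) (hf₂ : ContinuousOn f₂ (Icc 0 1))
    (hf₃ : ContinuousOn f₃ (Icc 0 1)) (hf₄ : ContinuousOn f₄ (Icc 0 1))
    (hf₅ : ContinuousOn f₅ (Icc 0 1)) (hg₁ : ContinuousOn g₁ (Icc 0 1))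
    (hg₂ : ContinuousOn g₂ (Icc 0 1)) (hg₃ : ContinuousOn g₃ (Icc 0 1))
    (hg₄ : ContinuousOn g₄ (Icc 0 1)) (hg₅ : ContinuousOn g₅ (Icc 0 1))
    (h : ∀ a ∈ Icc (0 : ℝ) 1, ∀ b ∈ Icc (0 : ℝ) 1,
      0 ≤ f₁ a * g₁ b + f₂ a * g₂ b + f₃ a * g₃ b + f₄ a * g₄ b + f₅ a * g₅ b) :
    0 ≤ (τ (cfc f₁ x * S (cfc g₁ y))).re + (τ (cfc f₂ x * S (cfc g₂ y))).re +
      (τ (cfc f₃ x * S (cfc g₃ y))).re + (τ (cfc f₄ x * S (cfc g₄ y))).re +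
      (τ (cfc f₅ x * S (cfc g₅ y))).re := by
  have := sum_trace_cfc_mul_nonneg hτ hS hSc hx hx1 hy hy1 (Finset.univ : Finset (Fin 5))
    (f := ![f₁, f₂, f₃, f₄, f₅]) (g := ![g₁, g₂, g₃, g₄, g₅])
    (by intro m _; fin_cases m <;> assumption) (by intro m _; fin_cases m <;> assumption)
    (by intro a ha b hb; simpa [Fin.sum_univ_five] using h a ha b hb)
  simpa [Fin.sum_univ_five] using this

lemma cfc_rpow_mul_self {x : 𝓜} (hx : 0 ≤ x) {p : ℝ} (hp : 1 ≤ p) :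
    cfc (fun u : ℝ => u ^ (p - 1)) x * x = cfc (fun u : ℝ => u ^ p) x := by
  nth_rewrite 2 [← cfc_id' ℝ x]
  rw [← cfc_mul _ _ x ((continuous_rpow (by linarith)).continuousOn)]
  refine cfc_congr fun u hu => ?_
  have hu0 := spectrum_nonneg_of_nonneg hx hu
  rcases hu0.eq_or_lt with rfl | h
  · simp [Real.zero_rpow (by linarith : p ≠ 0)]
  · simp only [Real.rpow_sub_one h.ne']; field_simp

/-- Young's inequality with exponents `p / (p - 1)` and `p`. -/
lemma rpow_add_sub_nonneg {a b p : ℝ} (ha : 0 ≤ a) (hb : 0 ≤ b) (hp : 1 ≤ p) :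
    0 ≤ (p - 1) * a ^ p + b ^ p - p * (a ^ (p - 1) * b) := by
  have hp0 : 0 < p := by linarith
  have h := Real.geom_mean_le_arith_mean2_weighted (w₁ := (p - 1) / p) (w₂ := 1 / p)
    (p₁ := a ^ p) (p₂ := b ^ p) (by apply div_nonneg <;> linarith) (by positivity) (by positivity)
    (by positivity) (by field_simp; ring)
  rw [← Real.rpow_mul ha, ← Real.rpow_mul hb, mul_div_cancel₀ _ hp0.ne',
    mul_div_cancel₀ _ hp0.ne', Real.rpow_one] at h
  have h2 : p * (a ^ (p - 1) * b) ≤ p * ((p - 1) / p * a ^ p + 1 / p * b ^ p) := by gcongr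
  have h3 : p * ((p - 1) / p * a ^ p + 1 / p * b ^ p) = (p - 1) * a ^ p + b ^ p := by
    field_simp
  linarith

/-- Klein's inequality for the convex function `u ↦ u ^ p`: the scalar inequality transfers to the
trace with `S = id`. -/
lemma klein_inequality (hτ : IsNormalFaithfulFiniteTrace τ) {x y : 𝓜} (hx : 0 ≤ x)
    (hx1 : ‖x‖ ≤ 1) (hy : 0 ≤ y) (hy1 : ‖y‖ ≤ 1) {p : ℝ} (hp : 1 ≤ p) :
    p * (τ (cfc (fun u : ℝ => u ^ (p - 1)) x * (y - x))).re ≤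
      (τ (cfc (fun u : ℝ => u ^ p) y)).re - (τ (cfc (fun u : ℝ => u ^ p) x)).re := by
  have h1 := (continuous_rpow (show 0 ≤ p by linarith)).continuousOn (s := Icc 0 1)
  have h2 := (continuous_rpow (show 0 ≤ p - 1 by linarith)).continuousOn (s := Icc 0 1)
  have hc : ∀ c : ℝ, ContinuousOn (fun _ : ℝ => c) (Icc (0 : ℝ) 1) := fun c => continuousOn_const
  have hsx := spectrum_subset_Icc hx hx1
  have hsy := spectrum_subset_Icc hy hy1
  have := sum_five_trace_nonneg hτ (S := LinearMap.id) (fun _ h => h) continuous_id hx hx1 hy hy1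
    (f₁ := fun a => (p - 1) * a ^ p) (g₁ := fun _ => 1) (f₂ := fun _ => 1) (g₂ := fun b => b ^ p)
    (f₃ := fun a => (-p) * a ^ (p - 1)) (g₃ := fun b => b) (f₄ := fun _ => 0) (g₄ := fun _ => 0)
    (f₅ := fun _ => 0) (g₅ := fun _ => 0) (h1.const_mul _) (hc _) (h2.const_mul _) (hc _) (hc _)
    (hc _) h1 continuousOn_id (hc _) (hc _) (fun a ha b hb => by
      have := rpow_add_sub_nonneg ha.1 hb.1 hp
      linarith)
  rw [cfc_const_mul _ _ x (h1.mono hsx), cfc_const_mul _ _ x (h2.mono hsx), cfc_const_one ℝ x,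
    cfc_const_one ℝ y, cfc_id' ℝ y, cfc_const_zero] at this
  simp only [LinearMap.id_coe, id_eq, mul_one, one_mul, zero_mul, map_zero, Complex.zero_re,
    add_zero, trace_real_smul, smul_mul_assoc] at this
  rw [mul_sub, cfc_rpow_mul_self hx hp, map_sub, Complex.sub_re]
  linarith

/-- The scalar form of the Stroock–Varopoulos inequality. -/
lemma sq_rpow_sub_le {a b p : ℝ} (ha : 0 ≤ a) (hb : 0 ≤ b) (hp : 2 ≤ p) :
    (a ^ (p / 2) - b ^ (p / 2)) ^ 2 ≤ p / 2 * ((a ^ (p - 1) - b ^ (p - 1)) * (a - b)) := by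
  wlog hab : b ≤ a generalizing a b with H
  · have := H hb ha (le_of_not_ge hab)
    nlinarith
  have hq : 1 ≤ p / 2 := by linarith
  -- the two bounds `a ^ q - b ^ q ≤ q a ^ (q-1) (a - b)` and
  -- `a ^ (q-1) (a ^ q - b ^ q) ≤ a ^ (2q-1) - b ^ (2q-1)` are multiplied
  have h1 : a ^ (p / 2) - b ^ (p / 2) ≤ p / 2 * (a ^ (p / 2 - 1) * (a - b)) := by
    have := rpow_add_sub_nonneg ha hb hq
    rcases ha.eq_or_lt with rfl | ha0
    · obtain rfl : b = 0 := le_antisymm hab hb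
      simp
    · have e : a ^ (p / 2 - 1) * a = a ^ (p / 2) := by
        rw [Real.rpow_sub_one ha0.ne']; field_simp
      linear_combination this - p / 2 * e
  have h2 : a ^ (p / 2 - 1) * (a ^ (p / 2) - b ^ (p / 2)) ≤ a ^ (p - 1) - b ^ (p - 1) := by
    have ea : a ^ (p / 2 - 1) * a ^ (p / 2) = a ^ (p - 1) := by
      rw [← Real.rpow_add_of_nonneg ha (by linarith) (by linarith)]; congr 1; ring
    have eb : b ^ (p / 2 - 1) * b ^ (p / 2) = b ^ (p - 1) := by
      rw [← Real.rpow_add_of_nonneg hb (by linarith) (by linarith)]; congr 1; ring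
    have : b ^ (p / 2 - 1) * b ^ (p / 2) ≤ a ^ (p / 2 - 1) * b ^ (p / 2) := by
      gcongr
    linarith
  have h0 : 0 ≤ a ^ (p / 2) - b ^ (p / 2) := by
    have : b ^ (p / 2) ≤ a ^ (p / 2) := by gcongr
    linarith
  calc _ = (a ^ (p / 2) - b ^ (p / 2)) * (a ^ (p / 2) - b ^ (p / 2)) := sq _
    _ ≤ (p / 2 * (a ^ (p / 2 - 1) * (a - b))) * (a ^ (p / 2) - b ^ (p / 2)) := by gcongr
    _ = p / 2 * ((a ^ (p / 2 - 1) * (a ^ (p / 2) - b ^ (p / 2))) * (a - b)) := by ring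
    _ ≤ _ := by
      have : 0 ≤ a - b := by linarith
      gcongr

/-- The Stroock–Varopoulos inequality with constant `p / 2` for a symmetric positive
map `S` with `S 1 ≤ 1`. The scalar inequality transfers to the trace by
`sum_trace_cfc_mul_nonneg`. -/
lemma stroock_varopoulos (hτ : IsNormalFaithfulFiniteTrace τ) {S : 𝓜 →ₗ[ℂ] 𝓜}
    (hS : ∀ x, 0 ≤ x → 0 ≤ S x) (hSc : Continuous S) (hS1 : S 1 ≤ 1)
    (hSs : ∀ a b, IsSelfAdjoint a → IsSelfAdjoint b → τ (a * S b) = τ (b * S a))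
    {x : 𝓜} (hx : 0 ≤ x) (hx1 : ‖x‖ ≤ 1) {p : ℝ} (hp : 2 ≤ p) :
    (τ (cfc (fun u : ℝ => u ^ p) x)).re -
        (τ (cfc (fun u : ℝ => u ^ (p / 2)) x * S (cfc (fun u : ℝ => u ^ (p / 2)) x))).re ≤
      p / 2 * ((τ (cfc (fun u : ℝ => u ^ p) x)).re -
        (τ (cfc (fun u : ℝ => u ^ (p - 1)) x * S x)).re) := by
  have h1 := (continuous_rpow (show 0 ≤ p by linarith)).continuousOn (s := Icc 0 1)
  have h2 := (continuous_rpow (show 0 ≤ p - 1 by linarith)).continuousOn (s := Icc 0 1)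
  have h3 := (continuous_rpow (show 0 ≤ p / 2 by linarith)).continuousOn (s := Icc 0 1)
  have hc : ∀ c : ℝ, ContinuousOn (fun _ : ℝ => c) (Icc (0 : ℝ) 1) := fun c => continuousOn_const
  have hsx := spectrum_subset_Icc hx hx1
  -- The first two summands are the terms in `a ^ p` and `b ^ p` of `sq_rpow_sub_le`. Paired with a
  -- constant, both give a multiple of `τ(x ^ p S(1))`, by symmetry.
  have := sum_five_trace_nonneg hτ hS hSc hx hx1 hx hx1
    (f₁ := fun a => (p / 2 - 1) * a ^ p) (g₁ := fun _ => 1)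
    (f₂ := fun _ => p / 2 - 1) (g₂ := fun b => b ^ p)
    (f₃ := fun a => (-(p / 2)) * a ^ (p - 1)) (g₃ := fun b => b)
    (f₄ := fun a => (-(p / 2)) * a) (g₄ := fun b => b ^ (p - 1))
    (f₅ := fun a => 2 * a ^ (p / 2)) (g₅ := fun b => b ^ (p / 2))
    (h1.const_mul _) (hc _) (h2.const_mul _) (continuousOn_id.const_mul _) (h3.const_mul _)
    (hc _) h1 continuousOn_id h2 h3 (fun a ha b hb => by
      have := sq_rpow_sub_le ha.1 hb.1 hp
      have e1 : ∀ u : ℝ, 0 ≤ u → u ^ (p / 2) * u ^ (p / 2) = u ^ p := fun u hu => by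
        rw [← Real.rpow_add_of_nonneg hu (by linarith) (by linarith)]; congr 1; ring
      have e2 : ∀ u : ℝ, 0 ≤ u → u ^ (p - 1) * u = u ^ p := fun u hu => by
        nth_rewrite 2 [← Real.rpow_one u]
        rw [← Real.rpow_add_of_nonneg hu (by linarith) (by linarith)]; congr 1; ring
      linear_combination this - e1 a ha.1 - e1 b hb.1 + p / 2 * e2 a ha.1 +
        p / 2 * e2 b hb.1)
  rw [cfc_const_mul _ _ x (h1.mono hsx), cfc_const_mul _ _ x (h2.mono hsx),
    cfc_const_mul _ (fun a : ℝ => a) x continuousOn_id,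
    cfc_const_mul _ _ x (h3.mono hsx), cfc_const_one ℝ x, cfc_id' ℝ x, cfc_const _ x,
    Algebra.algebraMap_eq_smul_one] at this
  simp only [trace_real_smul, smul_mul_assoc] at this
  rw [hSs 1 _ (IsSelfAdjoint.one _) (cfc_predicate _ _),
    hSs x _ (IsSelfAdjoint.of_nonneg hx) (cfc_predicate _ _)] at this
  have h4 : (τ (cfc (fun u : ℝ => u ^ p) x * S 1)).re ≤ (τ (cfc (fun u : ℝ => u ^ p) x)).re := by
    have := trace_mul_le_mul hτ (a := cfc (fun u : ℝ => u ^ p) x)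
      (cfc_nonneg fun u hu => Real.rpow_nonneg (hsx hu).1 _) hS1
    rwa [mul_one] at this
  have h5 : 0 ≤ p / 2 - 1 := by linarith
  have h6 := mul_le_mul_of_nonneg_left h4 h5
  linarith

lemma norm_toL2_sub_sq (hτ : IsNormalFaithfulFiniteTrace τ) {a b : 𝓜} (ha : IsSelfAdjoint a)
    (hb : IsSelfAdjoint b) :
    ‖toL2 τ a - toL2 τ b‖ ^ 2 = (τ (a * a)).re - 2 * (τ (a * b)).re + (τ (b * b)).re := by
  rw [← toL2_sub, norm_toL2_sq, (ha.sub hb).star_eq]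
  simp only [sub_mul, mul_sub, map_sub, Complex.sub_re]
  rw [hτ.tracial b a]; ring

/-- A scalar modulus of continuity with an additive error transfers to the norm of `L_2`. -/
lemma norm_toL2_cfc_sub_sq_le (hτ : IsNormalFaithfulFiniteTrace τ) {x y : 𝓜} (hx : 0 ≤ x)
    (hx1 : ‖x‖ ≤ 1) (hy : 0 ≤ y) (hy1 : ‖y‖ ≤ 1) {g : ℝ → ℝ} (hg : ContinuousOn g (Icc 0 1))
    {η c : ℝ} (h : ∀ a ∈ Icc (0 : ℝ) 1, ∀ b ∈ Icc (0 : ℝ) 1,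
      (g a - g b) ^ 2 ≤ η + c * (a - b) ^ 2) :
    ‖toL2 τ (cfc g x) - toL2 τ (cfc g y)‖ ^ 2 ≤
      η * (τ (1 : 𝓜)).re + c * ‖toL2 τ x - toL2 τ y‖ ^ 2 := by
  have hc : ∀ c : ℝ, ContinuousOn (fun _ : ℝ => c) (Icc (0 : ℝ) 1) := fun c => continuousOn_const
  have hsx := spectrum_subset_Icc hx hx1
  have hsy := spectrum_subset_Icc hy hy1
  have hxs := IsSelfAdjoint.of_nonneg hx
  have hys := IsSelfAdjoint.of_nonneg hy
  have hcc : ContinuousOn (fun a : ℝ => c * (a * a) - g a * g a) (Icc 0 1) := by fun_prop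
  have := sum_five_trace_nonneg hτ (S := LinearMap.id) (fun _ h => h) continuous_id hx hx1 hy hy1
    (f₁ := fun _ => η) (g₁ := fun _ => 1)
    (f₂ := fun a => c * (a * a) - g a * g a) (g₂ := fun _ => 1)
    (f₃ := fun _ => 1) (g₃ := fun a => c * (a * a) - g a * g a)
    (f₄ := fun a => (-2 * c) * a) (g₄ := fun b => b)
    (f₅ := fun a => 2 * g a) (g₅ := g) (hc _) hcc (hc _)
    (continuousOn_id.const_mul _) (hg.const_mul _) (hc _) (hc _) hcc continuousOn_id hg
    (fun a ha b hb => by linear_combination h a ha b hb)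
  have e : ∀ z : 𝓜, 0 ≤ z → ‖z‖ ≤ 1 → cfc (fun a : ℝ => c * (a * a) - g a * g a) z =
      c • (z * z) - cfc g z * cfc g z := by
    intro z hz hz1
    have hsz := spectrum_subset_Icc hz hz1
    have hgz := hg.mono hsz
    rw [cfc_sub (fun a : ℝ => c * (a * a)) (fun a => g a * g a) z (by fun_prop) (hgz.mul hgz),
      cfc_const_mul _ _ z (by fun_prop), cfc_mul _ _ z hgz hgz,
      cfc_mul _ _ z (by fun_prop) (by fun_prop), cfc_id' ℝ z]
  rw [e x hx hx1, e y hy hy1, cfc_const_mul _ _ x (hg.mono hsx),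
    cfc_const_mul _ (fun a : ℝ => a) x continuousOn_id, cfc_const_one ℝ x, cfc_const_one ℝ y,
    cfc_id' ℝ x, cfc_id' ℝ y, cfc_const _ x, Algebra.algebraMap_eq_smul_one] at this
  simp only [LinearMap.id_coe, id_eq, mul_one, one_mul, map_sub, Complex.sub_re,
    trace_real_smul, smul_mul_assoc] at this
  rw [norm_toL2_sub_sq hτ hxs hys, norm_toL2_sub_sq hτ (cfc_predicate _ _) (cfc_predicate _ _)]
  linarith

lemma exists_sq_sub_le {g : ℝ → ℝ} (hg : ContinuousOn g (Icc 0 1)) {η : ℝ} (hη : 0 < η) :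
    ∃ c : ℝ, 0 ≤ c ∧ ∀ a ∈ Icc (0 : ℝ) 1, ∀ b ∈ Icc (0 : ℝ) 1,
      (g a - g b) ^ 2 ≤ η + c * (a - b) ^ 2 := by
  obtain ⟨G, hG⟩ := isCompact_Icc.exists_bound_of_continuousOn hg
  have hu := Metric.uniformContinuousOn_iff.1 (isCompact_Icc.uniformContinuousOn_of_continuous hg)
    (√η) (by positivity)
  obtain ⟨δ, hδ, hu⟩ := hu
  have hG0 : 0 ≤ G := (norm_nonneg _).trans (hG 0 (by simp))
  refine ⟨(2 * G) ^ 2 / δ ^ 2, by positivity, fun a ha b hb => ?_⟩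
  by_cases hd : dist a b < δ
  · have h1 := hu a ha b hb hd
    rw [Real.dist_eq] at h1
    have : (g a - g b) ^ 2 ≤ η := by
      rw [← sq_abs, ← Real.sq_sqrt hη.le]
      gcongr
    have : 0 ≤ (2 * G) ^ 2 / δ ^ 2 * (a - b) ^ 2 := by positivity
    linarith
  · rw [not_lt, Real.dist_eq] at hd
    have h1 : (g a - g b) ^ 2 ≤ (2 * G) ^ 2 := by
      rw [← sq_abs]
      gcongr
      calc |g a - g b| ≤ |g a| + |g b| := abs_sub _ _
        _ ≤ 2 * G := by linarith [hG a ha, hG b hb, Real.norm_eq_abs (g a), Real.norm_eq_abs (g b)]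
    have h2 : δ ^ 2 ≤ (a - b) ^ 2 := by
      rw [← sq_abs (a - b)]; gcongr
    have h3 : (2 * G) ^ 2 ≤ (2 * G) ^ 2 / δ ^ 2 * (a - b) ^ 2 := by
      rw [div_mul_eq_mul_div, le_div_iff₀ (by positivity)]
      gcongr
    linarith

/-- On the order interval `[0, 1]` the continuous functional calculus is continuous for the
norm of `L_2`. -/
lemma tendsto_toL2_cfc (hτ : IsNormalFaithfulFiniteTrace τ) {α : Type*} {l : Filter α}
    {z : α → 𝓜} {y : 𝓜} (hz : ∀ᶠ i in l, 0 ≤ z i ∧ ‖z i‖ ≤ 1) (hy : 0 ≤ y) (hy1 : ‖y‖ ≤ 1)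
    {g : ℝ → ℝ} (hg : ContinuousOn g (Icc 0 1))
    (h : Tendsto (fun i => toL2 τ (z i)) l (𝓝 (toL2 τ y))) :
    Tendsto (fun i => toL2 τ (cfc g (z i))) l (𝓝 (toL2 τ (cfc g y))) := by
  rw [Metric.tendsto_nhds]
  intro ε hε
  have hτ1 : 0 ≤ (τ (1 : 𝓜)).re := trace_re_nonneg zero_le_one
  obtain ⟨c, hc, hcg⟩ := exists_sq_sub_le hg (η := ε ^ 2 / (2 * ((τ (1 : 𝓜)).re + 1)))
    (by positivity)
  have hη : ε ^ 2 / (2 * ((τ (1 : 𝓜)).re + 1)) * (τ (1 : 𝓜)).re ≤ ε ^ 2 / 2 := by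
    rw [div_mul_eq_mul_div, div_le_div_iff₀ (by positivity) (by positivity)]
    nlinarith [sq_nonneg ε]
  have h2 : Tendsto (fun i => c * ‖toL2 τ (z i) - toL2 τ y‖ ^ 2) l (𝓝 0) := by
    have := (((h.sub_const (toL2 τ y)).norm.pow 2).const_mul c)
    simpa using this
  filter_upwards [hz, h2.eventually (gt_mem_nhds (show 0 < ε ^ 2 / 2 by positivity))] with i hi hi2
  have := norm_toL2_cfc_sub_sq_le hτ hi.1 hi.2 hy hy1 hg hcg
  rw [dist_eq_norm]
  exact lt_of_pow_lt_pow_left₀ 2 hε.le (by linarith)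

end TraceInequalities

/-! ### The semigroup on `L_2` -/

section SemigroupOnL2

variable {𝓜 : Type*} [CStarAlgebra 𝓜] [PartialOrder 𝓜] [StarOrderedRing 𝓜] {τ : 𝓜 →ₚ[ℂ] ℂ}

/-- The positive functional `x ↦ τ(c x c)` for a self-adjoint `c`. -/
def traceConj (τ : 𝓜 →ₚ[ℂ] ℂ) (c : 𝓜) (hc : IsSelfAdjoint c) : 𝓜 →ₚ[ℂ] ℂ :=
  PositiveLinearMap.mk₀ (τ.toLinearMap ∘ₗ LinearMap.mulLeft ℂ c ∘ₗ LinearMap.mulRight ℂ c)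
    fun x hx => by
      have := star_left_conjugate_nonneg hx c
      rw [hc.star_eq, mul_assoc] at this
      exact τ.map_nonneg this

lemma traceConj_apply (c : 𝓜) (hc : IsSelfAdjoint c) (x : 𝓜) :
    traceConj τ c hc x = τ (c * (x * c)) := rfl

/-- `traceConj` is normal because it is dominated by a multiple of the normal functional `τ`. -/
lemma isNormal_traceConj (hτ : IsNormalFaithfulFiniteTrace τ) (c : 𝓜) (hc : IsSelfAdjoint c) :
    IsNormal (traceConj τ c hc) := by
  intro S hne hS hd x hx
  refine ⟨?_, fun b hb => ?_⟩
  · rintro _ ⟨s, hs, rfl⟩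
    exact trace_re_mono (hx.1 hs)
  · refine le_of_forall_pos_le_add fun ε hε => ?_
    have hlub := hτ.normal S hne hS hd x hx
    obtain ⟨_, ⟨s, hs, rfl⟩, hlt, -⟩ := hlub.exists_between
      (show (τ x).re - ε / (‖c * c‖ + 1) < (τ x).re by
        have : 0 < ε / (‖c * c‖ + 1) := by positivity
        linarith)
    have h1 : (traceConj τ c hc s).re ≤ b := hb ⟨s, hs, rfl⟩
    have h2 : (traceConj τ c hc x).re - (traceConj τ c hc s).re ≤
        (τ (x - s)).re * ‖c * c‖ := by
      rw [← Complex.sub_re, ← map_sub, traceConj_apply, hτ.tracial, mul_assoc]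
      exact (Complex.re_le_norm _).trans
        (norm_trace_mul_le_of_nonneg hτ (sub_nonneg.2 (hx.1 hs)) _)
    have h3 : (τ (x - s)).re * ‖c * c‖ ≤ ε := by
      rw [map_sub, Complex.sub_re]
      have h4 : (τ x).re - (τ s).re ≤ ε / (‖c * c‖ + 1) := by linarith
      have h5 := mul_le_mul_of_nonneg_right h4 (norm_nonneg (c * c))
      refine h5.trans ?_
      rw [div_mul_eq_mul_div, div_le_iff₀ (by positivity)]
      nlinarith [norm_nonneg (c * c)]
    linarith

/-- The extension to `L_2` of a map of `𝓜` that is a contraction for the `L_2` norm. -/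
def extendL2 (τ : 𝓜 →ₚ[ℂ] ℂ) (S : 𝓜 →ₗ[ℂ] 𝓜) (hS : ∀ x, ‖toL2 τ (S x)‖ ≤ ‖toL2 τ x‖) :
    L2 τ →L[ℂ] L2 τ :=
  ((τ.toPreGNS.toLinearMap ∘ₗ S ∘ₗ τ.ofPreGNS.toLinearMap).mkContinuous 1 fun x => by
    have := hS (τ.ofPreGNS x)
    simp only [toL2, UniformSpace.Completion.norm_coe] at this
    rw [one_mul]; exact this).completion

lemma extendL2_toL2 (S : 𝓜 →ₗ[ℂ] 𝓜) (hS : ∀ x, ‖toL2 τ (S x)‖ ≤ ‖toL2 τ x‖) (x : 𝓜) :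
    extendL2 τ S hS (toL2 τ x) = toL2 τ (S x) := by
  rw [extendL2, toL2, ContinuousLinearMap.completion_apply_coe]
  rfl

variable {T : ℝ → 𝓜 →ₗ[ℂ] 𝓜}

namespace IsSymmetricPositiveContractionSemigroup

lemma isSelfAdjoint (hT : IsSymmetricPositiveContractionSemigroup τ T) {t : ℝ} (ht : 0 < t)
    {x : 𝓜} (hx : IsSelfAdjoint x) : IsSelfAdjoint (T t x) := by
  have := map_star (PositiveLinearMap.mk₀ (T t) (hT.positive t ht)) x
  rw [hx.star_eq] at this
  exact this.symm

lemma inner_comm (hT : IsSymmetricPositiveContractionSemigroup τ T) {t : ℝ} (ht : 0 < t)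
    (x y : 𝓜) : ⟪toL2 τ (T t y), toL2 τ x⟫_ℂ = ⟪toL2 τ y, toL2 τ (T t x)⟫_ℂ := by
  rw [inner_toL2, inner_toL2, hT.symmetric t ht]

lemma continuous (hT : IsSymmetricPositiveContractionSemigroup τ T) {t : ℝ} (ht : 0 < t) :
    Continuous (T t) :=
  ((T t).mkContinuous 1 fun x => by simpa using hT.contraction t ht x).continuous

lemma norm_toL2_sq_eq (hT : IsSymmetricPositiveContractionSemigroup τ T) {t : ℝ} (ht : 0 < t)
    (x : 𝓜) : ‖toL2 τ (T t x)‖ ^ 2 = (⟪toL2 τ x, toL2 τ (T (t + t) x)⟫_ℂ).re := by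
  rw [hT.semigroup t t ht ht, ← hT.inner_comm ht, inner_self_eq_norm_sq_to_K]
  norm_cast

/-- Contractivity in `L_2`. Symmetry gives `‖T_t x‖² ≤ ‖x‖ ‖T_{2t} x‖`, so a ratio
`‖T_t x‖ / ‖x‖ > 1` would make `‖T_{2^k t} x‖` grow beyond every bound, although
`‖T_s x‖_2 ≤ ‖1‖_2 ‖x‖_∞` for all `s`. -/
lemma norm_toL2_le (hT : IsSymmetricPositiveContractionSemigroup τ T) {t : ℝ} (ht : 0 < t)
    (x : 𝓜) : ‖toL2 τ (T t x)‖ ≤ ‖toL2 τ x‖ := by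
  set a := ‖toL2 τ x‖ with ha
  have hrec : ∀ s : ℝ, 0 < s → ‖toL2 τ (T s x)‖ ^ 2 ≤ a * ‖toL2 τ (T (s + s) x)‖ := by
    intro s hs
    rw [hT.norm_toL2_sq_eq hs]
    exact re_inner_le_norm (𝕜 := ℂ) _ _
  by_contra! hlt
  have ha0 : 0 ≤ a := norm_nonneg _
  have ha1 : 0 < a := by
    rcases ha0.eq_or_lt with h | h
    · have := hrec t ht
      rw [← h, zero_mul] at this
      rw [← h] at hlt
      nlinarith
    · exact h
  set r := ‖toL2 τ (T t x)‖ / a with hr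
  have hr1 : 1 < r := (one_lt_div ha1).2 hlt
  have hgrow : ∀ k : ℕ, a * r ^ 2 ^ k ≤ ‖toL2 τ (T (2 ^ k * t) x)‖ := by
    intro k
    induction k with
    | zero => simp [hr, mul_div_cancel₀ _ ha1.ne']
    | succ k ih =>
      have h1 := hrec (2 ^ k * t) (by positivity)
      have h2 : (a * r ^ 2 ^ k) ^ 2 ≤ ‖toL2 τ (T (2 ^ k * t) x)‖ ^ 2 := by gcongr
      have h3 : (2 : ℝ) ^ (k + 1) * t = 2 ^ k * t + 2 ^ k * t := by ring
      rw [h3]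
      refine le_of_mul_le_mul_left (le_trans (le_of_eq ?_) (h2.trans h1)) ha1
      ring
  obtain ⟨n, hn⟩ := pow_unbounded_of_one_lt (‖toL2 τ (1 : 𝓜)‖ * ‖x‖ / a) hr1
  have h1 : r ^ n ≤ r ^ 2 ^ n := pow_le_pow_right₀ hr1.le Nat.lt_two_pow_self.le
  have h2 : ‖toL2 τ (T (2 ^ n * t) x)‖ ≤ ‖toL2 τ (1 : 𝓜)‖ * ‖x‖ :=
    (UltraLogSobolev.norm_toL2_le _).trans (by
      gcongr; exact hT.contraction _ (by positivity) x)
  rw [div_lt_iff₀ ha1] at hn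
  have h3 := hgrow n
  nlinarith

end IsSymmetricPositiveContractionSemigroup

/-- The semigroup on `L_2`, extended by the identity to `t ≤ 0`. -/
def semigroupL2 (hT : IsSymmetricPositiveContractionSemigroup τ T) (t : ℝ) : L2 τ →L[ℂ] L2 τ :=
  if ht : 0 < t then extendL2 τ (T t) (hT.norm_toL2_le ht) else 1

variable (hT : IsSymmetricPositiveContractionSemigroup τ T)

lemma semigroupL2_toL2 {t : ℝ} (ht : 0 < t) (x : 𝓜) :
    semigroupL2 hT t (toL2 τ x) = toL2 τ (T t x) := by
  rw [semigroupL2, dif_pos ht, extendL2_toL2]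

lemma semigroupL2_zero : semigroupL2 hT 0 = 1 := by
  rw [semigroupL2, dif_neg (lt_irrefl _)]

lemma semigroupL2_add {s t : ℝ} (hs : 0 ≤ s) (ht : 0 ≤ t) :
    semigroupL2 hT (s + t) = semigroupL2 hT s * semigroupL2 hT t := by
  rcases hs.eq_or_lt with rfl | hs
  · rw [zero_add, semigroupL2_zero, one_mul]
  rcases ht.eq_or_lt with rfl | ht
  · rw [add_zero, semigroupL2_zero, mul_one]
  ext ξ
  induction ξ using denseRange_toL2.induction_on with
  | hp => exact isClosed_eq (by fun_prop) (by fun_prop)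
  | ih x =>
    simp only [mul_apply_eq_comp]
    rw [semigroupL2_toL2 hT (by positivity), semigroupL2_toL2 hT ht, semigroupL2_toL2 hT hs,
      hT.semigroup s t hs ht]

lemma norm_semigroupL2_apply_le (t : ℝ) (ξ : L2 τ) : ‖semigroupL2 hT t ξ‖ ≤ ‖ξ‖ := by
  by_cases ht : 0 < t
  · induction ξ using denseRange_toL2.induction_on with
    | hp => exact isClosed_le (by fun_prop) (by fun_prop)
    | ih x => rw [semigroupL2_toL2 hT ht]; exact hT.norm_toL2_le ht x
  · rw [semigroupL2, dif_neg ht]; simp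

lemma norm_semigroupL2_le (t : ℝ) : ‖semigroupL2 hT t‖ ≤ 1 :=
  ContinuousLinearMap.opNorm_le_bound _ zero_le_one fun ξ => by
    simpa using norm_semigroupL2_apply_le hT t ξ

lemma isSelfAdjoint_semigroupL2 (t : ℝ) : IsSelfAdjoint (semigroupL2 hT t) := by
  by_cases ht : 0 < t
  · rw [ContinuousLinearMap.isSelfAdjoint_iff_isSymmetric]
    intro ξ η
    simp only [ContinuousLinearMap.coe_coe]
    induction ξ, η using denseRange_toL2.induction_on₂ with
    | hp => exact isClosed_eq (by fun_prop) (by fun_prop)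
    | h x y =>
      rw [semigroupL2_toL2 hT ht, semigroupL2_toL2 hT ht]
      exact hT.inner_comm ht y x
  · rw [semigroupL2, dif_neg ht]; exact IsSelfAdjoint.one _

lemma semigroupL2_nonneg (t : ℝ) : 0 ≤ semigroupL2 hT t := by
  by_cases ht : 0 < t
  · have h := semigroupL2_add hT (s := t / 2) (t := t / 2) (by positivity) (by positivity)
    rw [add_halves] at h
    rw [h]
    nth_rewrite 1 [← (isSelfAdjoint_semigroupL2 hT (t / 2)).star_eq]
    exact star_mul_self_nonneg _
  · rw [semigroupL2, dif_neg ht]; exact zero_le_one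

/-- For `x = c²` the functional `⟨x, ·⟩` is `z ↦ τ(c z c)`, which is normal, so w*-continuity gives
`⟨x, T_t x⟩ → ‖x‖²`. With `‖T_t x‖ ≤ ‖x‖` this forces `T_t x → x` in `L_2`. -/
lemma tendsto_toL2_of_nonneg (hτ : IsNormalFaithfulFiniteTrace τ)
    (hT : IsSymmetricPositiveContractionSemigroup τ T) {x : 𝓜} (hx : 0 ≤ x) :
    Tendsto (fun t => toL2 τ (T t x)) (𝓝[>] 0) (𝓝 (toL2 τ x)) := by
  obtain ⟨c, hc, hcx⟩ := CStarAlgebra.nonneg_iff_exists_isSelfAdjoint_and_eq_mul_self.1 hx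
  have hconv := hT.wstar_continuous x _ (isNormal_traceConj hτ c hc)
  have e : ∀ z : 𝓜, traceConj τ c hc z = ⟪toL2 τ x, toL2 τ z⟫_ℂ := by
    intro z
    rw [traceConj_apply, inner_toL2, (IsSelfAdjoint.of_nonneg hx).star_eq, hτ.tracial, hcx,
      mul_assoc, ← hτ.tracial]
  simp only [e] at hconv
  have hre : Tendsto (fun t => 2 * ‖toL2 τ x‖ ^ 2 - 2 * (⟪toL2 τ x, toL2 τ (T t x)⟫_ℂ).re)
      (𝓝[>] 0) (𝓝 0) := by
    have := ((Complex.continuous_re.tendsto _).comp hconv).const_mul (-2) |>.const_add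
      (2 * ‖toL2 τ x‖ ^ 2)
    have e2 : (⟪toL2 τ x, toL2 τ x⟫_ℂ).re = ‖toL2 τ x‖ ^ 2 := by
      rw [inner_self_eq_norm_sq_to_K]; norm_cast
    rw [e2] at this
    convert! this using 2
    · simp only [Function.comp]; ring
    · ring
  rw [tendsto_iff_norm_sub_tendsto_zero]
  have hsq : Tendsto (fun t => ‖toL2 τ (T t x) - toL2 τ x‖ ^ 2) (𝓝[>] 0) (𝓝 0) := by
    refine squeeze_zero' (Eventually.of_forall fun t => by positivity) ?_ hre
    filter_upwards [self_mem_nhdsWithin] with t ht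
    rw [norm_sub_sq (𝕜 := ℂ), RCLike.re_eq_complex_re, ← inner_conj_symm, Complex.conj_re]
    have h1 := hT.norm_toL2_le ht x
    have h2 : ‖toL2 τ (T t x)‖ ^ 2 ≤ ‖toL2 τ x‖ ^ 2 := by gcongr
    linarith
  have := hsq.sqrt
  simpa using this

/-- Strong continuity of the semigroup on `L_2` at `0`. -/
lemma tendsto_semigroupL2 (hτ : IsNormalFaithfulFiniteTrace τ) (ξ : L2 τ) :
    Tendsto (fun t => semigroupL2 hT t ξ) (𝓝[>] 0) (𝓝 ξ) := by
  have hM : ∀ x : 𝓜, Tendsto (fun t => semigroupL2 hT t (toL2 τ x)) (𝓝[>] 0) (𝓝 (toL2 τ x)) := by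
    intro x
    obtain ⟨y, hy, -, hyx⟩ := CStarAlgebra.exists_sum_four_nonneg x
    have e : toL2 τ x = ∑ i : Fin 4, Complex.I ^ (i : ℕ) • toL2 τ (y i) := by
      rw [hyx]
      change toL2Lin τ _ = _
      rw [map_sum]
      exact Finset.sum_congr rfl fun i _ => map_smul _ _ _
    rw [e]
    simp only [map_sum, map_smul]
    refine tendsto_finsetSum _ fun i _ => Tendsto.const_smul ?_ _
    refine (tendsto_toL2_of_nonneg hτ hT (hy i)).congr' ?_
    filter_upwards [self_mem_nhdsWithin] with t ht
    rw [semigroupL2_toL2 hT ht]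
  rw [Metric.tendsto_nhds]
  intro ε hε
  obtain ⟨x, hx⟩ := denseRange_toL2.exists_dist_lt ξ (show 0 < ε / 3 by positivity)
  filter_upwards [Metric.tendsto_nhds.1 (hM x) (ε / 3) (by positivity)] with t ht
  have h1 : dist (semigroupL2 hT t ξ) (semigroupL2 hT t (toL2 τ x)) ≤ dist ξ (toL2 τ x) := by
    rw [dist_eq_norm, dist_eq_norm, ← map_sub]
    exact norm_semigroupL2_apply_le hT t _
  have h2 := dist_triangle4 (semigroupL2 hT t ξ) (semigroupL2 hT t (toL2 τ x)) (toL2 τ x) ξ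
  rw [dist_comm (toL2 τ x) ξ] at h2
  linarith

lemma norm_semigroupL2_sub_le {s t : ℝ} (hs : 0 ≤ s) (hst : s ≤ t) (ξ : L2 τ) :
    ‖semigroupL2 hT t ξ - semigroupL2 hT s ξ‖ ≤ ‖semigroupL2 hT (t - s) ξ - ξ‖ := by
  have h := semigroupL2_add hT hs (sub_nonneg.2 hst)
  rw [add_sub_cancel] at h
  rw [h, mul_apply_eq_comp, ← map_sub]
  exact norm_semigroupL2_apply_le hT s _

lemma continuousOn_semigroupL2 (hτ : IsNormalFaithfulFiniteTrace τ) (ξ : L2 τ) :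
    ContinuousOn (fun t => semigroupL2 hT t ξ) (Ici 0) := by
  intro s hs
  have h0 : Tendsto (fun t => ‖semigroupL2 hT |t - s| ξ - ξ‖) (𝓝 s) (𝓝 0) := by
    have h1 : Tendsto (fun r => ‖semigroupL2 hT r ξ - ξ‖) (𝓝[≥] 0) (𝓝 0) := by
      rw [← tendsto_iff_norm_sub_tendsto_zero, ← Ioi_insert, nhdsWithin_insert, tendsto_sup]
      refine ⟨?_, tendsto_semigroupL2 hT hτ ξ⟩
      rw [tendsto_pure_left]
      intro U hU
      rw [semigroupL2_zero]
      exact mem_of_mem_nhds hU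
    refine h1.comp (tendsto_nhdsWithin_iff.2
      ⟨?_, Eventually.of_forall fun t => mem_Ici.2 (abs_nonneg _)⟩)
    have : Continuous fun t : ℝ => |t - s| := by fun_prop
    simpa using this.tendsto s
  rw [ContinuousWithinAt, tendsto_iff_norm_sub_tendsto_zero]
  refine squeeze_zero' (Eventually.of_forall fun t => norm_nonneg _) ?_
    (h0.mono_left nhdsWithin_le_nhds)
  filter_upwards [self_mem_nhdsWithin] with t ht
  rcases le_total s t with h | h
  · rw [abs_of_nonneg (by linarith)]
    exact norm_semigroupL2_sub_le hT hs h ξ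
  · rw [abs_of_nonpos (by linarith), norm_sub_rev, neg_sub]
    exact norm_semigroupL2_sub_le hT ht h ξ

end SemigroupOnL2

/-! ### Powers as functions of the exponent -/

section ScalarEstimates

lemma abs_rpow_mul_log_le {u s : ℝ} (hu : u ∈ Icc (0 : ℝ) 1) (hs : 0 < s) :
    |u ^ s * Real.log u| ≤ 1 / s := by
  rcases hu.1.eq_or_lt with rfl | h
  · simp [hs.le]
  · rw [mul_comm]; exact (Real.abs_log_mul_self_rpow_lt u s h hu.2 hs).le

lemma exp_le_quadratic_of_nonpos {a : ℝ} (ha : a ≤ 0) : Real.exp a ≤ 1 + a + a ^ 2 := by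
  have h := Real.quadratic_le_exp_of_nonneg (x := -a) (by linarith)
  have h1 : Real.exp a * Real.exp (-a) = 1 := by rw [← Real.exp_add]; simp
  have h2 : 0 < Real.exp a := Real.exp_pos a
  have h4 : 1 ≤ (1 + a + a ^ 2) * (1 + -a + (-a) ^ 2 / 2) := by
    nlinarith [sq_nonneg a, mul_nonneg (sq_nonneg a) (neg_nonneg.2 ha), sq_nonneg (a ^ 2)]
  have h5 : Real.exp a * (1 + -a + (-a) ^ 2 / 2) ≤ 1 := by
    exact (mul_le_mul_of_nonneg_left h h2.le).trans_eq h1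
  have h6 : 0 < 1 + -a + (-a) ^ 2 / 2 := by nlinarith [sq_nonneg a]
  by_contra! hlt
  nlinarith

lemma rpow_add_eq_mul_exp {u s h : ℝ} (hu : 0 < u) :
    u ^ (s + h) = u ^ s * Real.exp (h * Real.log u) := by
  rw [Real.rpow_add hu, Real.rpow_def_of_pos hu h, mul_comm h]

/-- First-order expansion of `u ^ s` in the exponent, uniformly for `u ∈ [0, 1]`. -/
lemma abs_rpow_add_sub_le {u s h : ℝ} (hu : u ∈ Icc (0 : ℝ) 1) (hs : 0 < s) (hh : 0 ≤ h) :
    |u ^ (s + h) - u ^ s - h * (u ^ s * Real.log u)| ≤ h ^ 2 * (4 / s ^ 2) := by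
  rcases hu.1.eq_or_lt with rfl | h0
  · rw [Real.zero_rpow hs.ne', Real.zero_rpow (by positivity)]
    simp; positivity
  · have hl := Real.log_nonpos hu.1 hu.2
    have ha : h * Real.log u ≤ 0 := mul_nonpos_of_nonneg_of_nonpos hh hl
    have e1 := exp_le_quadratic_of_nonpos ha
    have e2 := Real.add_one_le_exp (h * Real.log u)
    have hp : 0 < u ^ s := Real.rpow_pos_of_pos h0 s
    have e3 : u ^ s * Real.log u ^ 2 ≤ 4 / s ^ 2 := by
      have h1 := abs_rpow_mul_log_le hu (show 0 < s / 2 by positivity)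
      have h2 : u ^ s = u ^ (s / 2) * u ^ (s / 2) := by
        rw [← Real.rpow_add h0, add_halves]
      calc u ^ s * Real.log u ^ 2 = |u ^ (s / 2) * Real.log u| ^ 2 := by rw [sq_abs, h2]; ring
        _ ≤ (1 / (s / 2)) ^ 2 := by gcongr
        _ = 4 / s ^ 2 := by field_simp; norm_num
    rw [rpow_add_eq_mul_exp h0]
    have e4 : u ^ s * Real.exp (h * Real.log u) - u ^ s - h * (u ^ s * Real.log u) =
      u ^ s * (Real.exp (h * Real.log u) - 1 - h * Real.log u) := by ring
    rw [e4, abs_of_nonneg (by apply mul_nonneg hp.le; linarith)]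
    calc _ ≤ u ^ s * (h * Real.log u) ^ 2 := by gcongr; linarith
      _ = h ^ 2 * (u ^ s * Real.log u ^ 2) := by ring
      _ ≤ _ := by gcongr

lemma abs_rpow_add_sub_rpow_le {u s h : ℝ} (hu : u ∈ Icc (0 : ℝ) 1) (hs : 0 < s) (hh : 0 ≤ h) :
    |u ^ (s + h) - u ^ s| ≤ h * (1 / s) := by
  rcases hu.1.eq_or_lt with rfl | h0
  · rw [Real.zero_rpow hs.ne', Real.zero_rpow (by positivity)]
    simp; positivity
  · have e2 := Real.add_one_le_exp (h * Real.log u)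
    have hp : 0 < u ^ s := Real.rpow_pos_of_pos h0 s
    have e5 := neg_le_of_abs_le (abs_rpow_mul_log_le hu hs)
    have e1 : u ^ (s + h) ≤ u ^ s := Real.rpow_le_rpow_of_exponent_ge h0 hu.2 (by linarith)
    rw [abs_of_nonpos (by linarith), rpow_add_eq_mul_exp h0]
    have e6 := mul_le_mul_of_nonneg_left e2 hp.le
    have e7 := mul_le_mul_of_nonneg_left e5 hh
    linarith

lemma continuousOn_rpow_mul_log {s : ℝ} (hs : 0 < s) :
    ContinuousOn (fun u : ℝ => u ^ s * Real.log u) (Ici 0) := by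
  have h : Continuous fun u : ℝ => s⁻¹ * (u ^ s * Real.log (u ^ s)) :=
    (Real.continuous_mul_log.comp (continuous_rpow hs.le)).const_mul _
  refine h.continuousOn.congr fun u hu => ?_
  rcases (mem_Ici.1 hu).eq_or_lt with rfl | h0
  · simp [Real.zero_rpow hs.ne']
  · simp only [Real.log_rpow h0]; field_simp

end ScalarEstimates

/-! ### The generator on the range of the semigroup -/

section Generator

variable {𝓜 : Type*} [CStarAlgebra 𝓜] [PartialOrder 𝓜] [StarOrderedRing 𝓜] {τ : 𝓜 →ₚ[ℂ] ℂ}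
  {T : ℝ → 𝓜 →ₗ[ℂ] 𝓜} (hT : IsSymmetricPositiveContractionSemigroup τ T)

lemma semigroupL2_nat_mul {t : ℝ} (ht : 0 ≤ t) (n : ℕ) :
    semigroupL2 hT (n * t) = semigroupL2 hT t ^ n := by
  induction n with
  | zero => simp [semigroupL2_zero]
  | succ n ih =>
    rw [pow_succ, ← ih, ← semigroupL2_add hT (by positivity) ht]
    congr 1; push_cast; ring

lemma spectrum_semigroupL2 (t : ℝ) : spectrum ℝ (semigroupL2 hT t) ⊆ Icc 0 1 :=
  spectrum_subset_Icc (semigroupL2_nonneg hT t) (norm_semigroupL2_le hT t)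

lemma cfc_rpow_semigroupL2_one_eq {m n : ℕ} (hn : 0 < n) :
    cfc (fun u : ℝ => u ^ ((m : ℝ) / n)) (semigroupL2 hT 1) = semigroupL2 hT (m / n) := by
  have hn' : (n : ℝ) ≠ 0 := by positivity
  have e1 : semigroupL2 hT 1 = semigroupL2 hT (1 / n) ^ n := by
    rw [← semigroupL2_nat_mul hT (by positivity), mul_one_div_cancel hn']
  have hsa := isSelfAdjoint_semigroupL2 hT (1 / n)
  rw [e1, ← cfc_comp_pow _ _ _ (continuous_rpow (by positivity)).continuousOn hsa]
  have e2 : cfc (fun u : ℝ => (u ^ n) ^ ((m : ℝ) / n)) (semigroupL2 hT (1 / n)) =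
      cfc (fun u : ℝ => u ^ m) (semigroupL2 hT (1 / n)) := by
    refine cfc_congr fun u hu => ?_
    have hu0 := (spectrum_semigroupL2 hT _ hu).1
    rw [← Real.rpow_natCast u n, ← Real.rpow_mul hu0, mul_div_cancel₀ _ hn', Real.rpow_natCast]
  rw [e2, cfc_pow_id _ _ hsa, ← semigroupL2_nat_mul hT (by positivity), mul_one_div]

lemma norm_cfc_rpow_sub_le {s t : ℝ} (hs : 0 < s) (hst : s ≤ t) :
    ‖cfc (fun u : ℝ => u ^ t) (semigroupL2 hT 1) -
      cfc (fun u : ℝ => u ^ s) (semigroupL2 hT 1)‖ ≤ (t - s) * (1 / s) := by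
  rw [← cfc_sub _ _ _ (continuous_rpow (by linarith)).continuousOn
    (continuous_rpow hs.le).continuousOn]
  refine norm_cfc_le (mul_nonneg (by linarith) (by positivity)) fun u hu => ?_
  have := abs_rpow_add_sub_rpow_le (spectrum_semigroupL2 hT _ hu) hs (sub_nonneg.2 hst)
  rwa [add_sub_cancel] at this

/-- `T_t = T_1 ^ t` on `L_2`, in the sense of the functional calculus. Both sides are strongly
continuous in `t > 0` and agree at the rational `t`. -/
theorem semigroupL2_eq_cfc (hτ : IsNormalFaithfulFiniteTrace τ) {t : ℝ} (ht : 0 < t) :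
    semigroupL2 hT t = cfc (fun u : ℝ => u ^ t) (semigroupL2 hT 1) := by
  ext ξ
  have hcont : ContinuousOn (fun t : ℝ => cfc (fun u : ℝ => u ^ t) (semigroupL2 hT 1) ξ)
      (Ioi 0) := by
    have h1 : ContinuousOn (fun t : ℝ => cfc (fun u : ℝ => u ^ t) (semigroupL2 hT 1)) (Ioi 0) := by
      intro s hs
      have hs : 0 < s := hs
      refine ContinuousAt.continuousWithinAt ?_
      rw [ContinuousAt, tendsto_iff_norm_sub_tendsto_zero]
      have hlim : Tendsto (fun r : ℝ => |r - s| * (2 / s)) (𝓝 s) (𝓝 0) := by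
        have : Continuous fun r : ℝ => |r - s| * (2 / s) := by fun_prop
        simpa using this.tendsto s
      refine squeeze_zero' (Eventually.of_forall fun _ => norm_nonneg _) ?_ hlim
      filter_upwards [lt_mem_nhds (show s / 2 < s by linarith)] with r hr
      rcases le_total s r with h | h
      · refine (norm_cfc_rpow_sub_le hT hs h).trans ?_
        rw [abs_of_nonneg (by linarith)]
        gcongr
        linarith
      · rw [norm_sub_rev]
        refine (norm_cfc_rpow_sub_le hT (by linarith) h).trans ?_
        rw [abs_of_nonpos (by linarith), neg_sub]
        gcongr ?_ * ?_
        rw [div_le_div_iff₀ (by linarith) (by linarith)]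
        linarith
    exact h1.clm_apply continuousOn_const
  have heq : EqOn (fun t => semigroupL2 hT t ξ)
      (fun t : ℝ => cfc (fun u : ℝ => u ^ t) (semigroupL2 hT 1) ξ)
      (Ioi 0 ∩ range ((↑) : ℚ → ℝ)) := by
    rintro _ ⟨hq, q, rfl⟩
    have hq0 : 0 < q := by exact_mod_cast mem_Ioi.1 hq
    have e : (q : ℝ) = (q.num.toNat : ℝ) / (q.den : ℝ) := by
      have h1 : ((q.num.toNat : ℤ) : ℝ) = (q.num : ℝ) := by
        rw [Int.toNat_of_nonneg (Rat.num_nonneg.2 hq0.le)]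
      rw [Rat.cast_def, ← h1, Int.cast_natCast]
    simp only
    rw [e, cfc_rpow_semigroupL2_one_eq hT q.den_pos]
  exact heq.of_subset_closure ((continuousOn_semigroupL2 hT hτ ξ).mono Ioi_subset_Ici_self) hcont
    inter_subset_left ((Rat.denseRange_cast (𝕜 := ℝ)).open_subset_closure_inter isOpen_Ioi) ht

/-- The operator `L T_s` on `L_2`, as the function `-u ^ s log u` of `T_1`. -/
def generatorL2 (hT : IsSymmetricPositiveContractionSemigroup τ T) (s : ℝ) : L2 τ →L[ℂ] L2 τ :=
  cfc (fun u : ℝ => -(u ^ s * Real.log u)) (semigroupL2 hT 1)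

/-- For `s > 0` the range of `T_s` lies in the domain of the generator. The difference quotients
converge in operator norm, as `(u ^ s - u ^ (s + t)) / t → -u ^ s log u` uniformly on `[0, 1]`. -/
theorem isGeneratorAt_apply (hτ : IsNormalFaithfulFiniteTrace τ) {s : ℝ} (hs : 0 < s) (y : 𝓜) :
    IsGeneratorAt τ T (T s y) (generatorL2 hT s (toL2 τ y)) := by
  rw [IsGeneratorAt, tendsto_iff_norm_sub_tendsto_zero]
  have hsp := spectrum_semigroupL2 hT 1
  have hlogc : ContinuousOn (fun u : ℝ => u ^ s * Real.log u)
      (spectrum ℝ (semigroupL2 hT 1)) :=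
    (continuousOn_rpow_mul_log hs).mono fun u hu => (hsp hu).1
  have hlim : Tendsto (fun t : ℝ => t * (4 / s ^ 2) * ‖toL2 τ y‖) (𝓝[>] 0) (𝓝 0) := by
    have : Continuous fun t : ℝ => t * (4 / s ^ 2) * ‖toL2 τ y‖ := by fun_prop
    have := this.tendsto 0
    simp only [zero_mul] at this
    exact this.mono_left nhdsWithin_le_nhds
  refine squeeze_zero' (Eventually.of_forall fun _ => norm_nonneg _) ?_ hlim
  filter_upwards [self_mem_nhdsWithin] with t ht
  have ht : 0 < t := ht
  have e1 : toL2 τ (T s y) = cfc (fun u : ℝ => u ^ s) (semigroupL2 hT 1) (toL2 τ y) := by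
    rw [← semigroupL2_eq_cfc hT hτ hs, semigroupL2_toL2 hT hs]
  have e2 : toL2 τ (T t (T s y)) =
      cfc (fun u : ℝ => u ^ (s + t)) (semigroupL2 hT 1) (toL2 τ y) := by
    rw [← hT.semigroup t s ht hs, add_comm t s, ← semigroupL2_eq_cfc hT hτ (by linarith),
      semigroupL2_toL2 hT (by linarith)]
  have c1 := (continuous_rpow hs.le).continuousOn (s := spectrum ℝ (semigroupL2 hT 1))
  have c2 := (continuous_rpow (show 0 ≤ s + t by linarith)).continuousOn
    (s := spectrum ℝ (semigroupL2 hT 1))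
  have e3 : ((t⁻¹ : ℝ) : ℂ) • (toL2 τ (T s y) - toL2 τ (T t (T s y))) -
      generatorL2 hT s (toL2 τ y) =
      (-t⁻¹) • cfc (fun u : ℝ => u ^ (s + t) - u ^ s - t * (u ^ s * Real.log u))
        (semigroupL2 hT 1) (toL2 τ y) := by
    rw [cfc_sub (fun u : ℝ => u ^ (s + t) - u ^ s) (fun u => t * (u ^ s * Real.log u)) _
      (c2.sub c1) (hlogc.const_mul t), cfc_sub _ _ _ c2 c1, cfc_const_mul _ _ _ hlogc,
      generatorL2, cfc_neg, e1, e2, Complex.coe_smul]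
    simp only [sub_apply, neg_apply, smul_apply]
    rw [smul_sub (-t⁻¹), smul_smul, neg_mul, inv_mul_cancel₀ ht.ne', smul_sub, smul_sub, neg_smul,
      neg_smul, neg_smul, one_smul]
    abel
  rw [e3, norm_smul, norm_neg, norm_inv, Real.norm_of_nonneg ht.le]
  have h4 : ‖cfc (fun u : ℝ => u ^ (s + t) - u ^ s - t * (u ^ s * Real.log u))
      (semigroupL2 hT 1)‖ ≤ t ^ 2 * (4 / s ^ 2) :=
    norm_cfc_le (by positivity) fun u hu => abs_rpow_add_sub_le (hsp hu) hs ht.le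
  calc _ ≤ t⁻¹ * (t ^ 2 * (4 / s ^ 2) * ‖toL2 τ y‖) := by
        gcongr
        exact ContinuousLinearMap.le_of_opNorm_le _ h4 _
    _ = _ := by field_simp

/-- The approximate energy `h⁻¹ ⟨x, x - T_h x⟩` does not increase along the semigroup. -/
lemma inner_sub_apply_le (hT : IsSymmetricPositiveContractionSemigroup τ T) {s h : ℝ}
    (hs : 0 < s) (hh : 0 < h) (y : 𝓜) :
    (⟪toL2 τ (T s y), toL2 τ (T s y) - toL2 τ (T h (T s y))⟫_ℂ).re ≤
      (⟪toL2 τ y, toL2 τ y - toL2 τ (T h y)⟫_ℂ).re := by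
  have hP : ∀ t, 0 ≤ 1 - semigroupL2 hT t := fun t =>
    sub_nonneg.2 ((CStarAlgebra.norm_le_one_iff_of_nonneg _ (semigroupL2_nonneg hT t)).1
      (norm_semigroupL2_le hT t))
  -- the difference of the two sides is `⟨y, (1 - T_h)(1 - T_{2s}) y⟩`
  have hcomm : Commute (semigroupL2 hT h) (semigroupL2 hT (s + s)) := by
    rw [Commute, SemiconjBy, ← semigroupL2_add hT hh.le (by positivity),
      ← semigroupL2_add hT (by positivity) hh.le, add_comm]
  have hPQ : 0 ≤ (1 - semigroupL2 hT h) * (1 - semigroupL2 hT (s + s)) :=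
    Commute.mul_nonneg (hP _) (hP _)
      ((Commute.one_left _).sub_left ((Commute.one_right _).sub_right hcomm))
  have hpos := ((ContinuousLinearMap.nonneg_iff_isPositive _).1 hPQ).re_inner_nonneg_right
    (toL2 τ y)
  have e1 : ((1 - semigroupL2 hT h) * (1 - semigroupL2 hT (s + s))) (toL2 τ y) =
      (toL2 τ y - toL2 τ (T h y)) - (toL2 τ (T s (T s y)) - toL2 τ (T s (T h (T s y)))) := by
    have e2 : T h (T s (T s y)) = T s (T h (T s y)) := by
      rw [← hT.semigroup h s hh hs, ← hT.semigroup s h hs hh, add_comm]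
    simp only [mul_apply_eq_comp, sub_apply, map_sub, one_apply_eq_self]
    rw [semigroupL2_toL2 hT hh, semigroupL2_toL2 hT (t := s + s) (by positivity),
      semigroupL2_toL2 hT hh, hT.semigroup s s hs hs, e2]
  rw [e1, inner_sub_right, map_sub] at hpos
  rw [inner_sub_right (toL2 τ (T s y)), hT.inner_comm hs, hT.inner_comm hs, ← inner_sub_right]
  simp only [RCLike.re_eq_complex_re] at hpos
  linarith

end Generator

/-! ### The logarithmic Sobolev inequality for powers -/

section LogSobolevPowers

variable {𝓜 : Type*} [CStarAlgebra 𝓜] [PartialOrder 𝓜] [StarOrderedRing 𝓜] {τ : 𝓜 →ₚ[ℂ] ℂ}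
  {T : ℝ → 𝓜 →ₗ[ℂ] 𝓜} {M : ℝ → ℝ} {C : ℝ}

lemma trace_re_eq_inner (x : 𝓜) : (τ x).re = (⟪toL2 τ (1 : 𝓜), toL2 τ x⟫_ℂ).re := by
  rw [inner_toL2, star_one, one_mul]

lemma tendsto_trace_re {α : Type*} {l : Filter α} {z : α → 𝓜} {y : 𝓜}
    (h : Tendsto (fun i => toL2 τ (z i)) l (𝓝 (toL2 τ y))) :
    Tendsto (fun i => (τ (z i)).re) l (𝓝 (τ y).re) := by
  simp only [trace_re_eq_inner]
  exact (Complex.continuous_re.tendsto _).comp (tendsto_const_nhds.inner h)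

lemma IsSymmetricPositiveContractionSemigroup.tendsto_toL2 (hτ : IsNormalFaithfulFiniteTrace τ)
    (hT : IsSymmetricPositiveContractionSemigroup τ T) (y : 𝓜) :
    Tendsto (fun s => toL2 τ (T s y)) (𝓝[>] 0) (𝓝 (toL2 τ y)) := by
  refine (tendsto_semigroupL2 hT hτ (toL2 τ y)).congr' ?_
  filter_upwards [self_mem_nhdsWithin] with s hs
  exact semigroupL2_toL2 hT hs y

lemma IsSymmetricPositiveContractionSemigroup.apply_one_le
    (hT : IsSymmetricPositiveContractionSemigroup τ T) {t : ℝ} (ht : 0 < t) : T t 1 ≤ 1 := by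
  rw [← CStarAlgebra.norm_le_one_iff_of_nonneg _ (hT.positive t ht 1 zero_le_one)]
  exact (hT.contraction t ht 1).trans
    ((CStarAlgebra.norm_le_one_iff_of_nonneg _ zero_le_one).2 le_rfl)

/-- The logarithmic Sobolev inequality extends from the domain of the generator to elements of
finite energy, here with the energy bounded by the limit of an upper bound `e h` for
`h⁻¹ ⟨y, y - T_h y⟩`: it is applied to `T_s y`, whose energy is no larger, and `s` tends to `0`. -/
lemma LogSobolev.of_energy_le (hτ : IsNormalFaithfulFiniteTrace τ)
    (hT : IsSymmetricPositiveContractionSemigroup τ T) (hLS : LogSobolev τ T M C)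
    {y : 𝓜} (hy : 0 ≤ y) (hy1 : ‖y‖ ≤ 1) {e : ℝ → ℝ} {E : ℝ} (he : Tendsto e (𝓝[>] 0) (𝓝 E))
    (hE : ∀ h, 0 < h → h⁻¹ * (⟪toL2 τ y, toL2 τ y - toL2 τ (T h y)⟫_ℂ).re ≤ e h)
    {ε : ℝ} (hε : 0 < ε) :
    (τ (cfc (fun u : ℝ => u ^ 2 * Real.log u) y)).re ≤
      ε * E + C * M ε * ‖toL2 τ y‖ ^ 2 + ‖toL2 τ y‖ ^ 2 * Real.log ‖toL2 τ y‖ := by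
  have hcont : Continuous fun u : ℝ => u ^ 2 * Real.log u := by
    have : (fun u : ℝ => u ^ 2 * Real.log u) = fun u => u * (u * Real.log u) := by
      ext u; ring
    rw [this]
    exact continuous_id.mul Real.continuous_mul_log
  have hlim := hT.tendsto_toL2 hτ y
  have hz : ∀ᶠ s in 𝓝[>] (0 : ℝ), 0 ≤ T s y ∧ ‖T s y‖ ≤ 1 := by
    filter_upwards [self_mem_nhdsWithin] with s hs
    exact ⟨hT.positive s hs y hy, (hT.contraction s hs y).trans hy1⟩
  have h1 := tendsto_trace_re (tendsto_toL2_cfc hτ hz hy hy1 hcont.continuousOn hlim)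
  have h2 : Tendsto (fun s => ε * E + C * M ε * ‖toL2 τ (T s y)‖ ^ 2 +
      ‖toL2 τ (T s y)‖ ^ 2 * Real.log ‖toL2 τ (T s y)‖) (𝓝[>] 0)
      (𝓝 (ε * E + C * M ε * ‖toL2 τ y‖ ^ 2 + ‖toL2 τ y‖ ^ 2 * Real.log ‖toL2 τ y‖)) :=
    (((hlim.norm.pow 2).const_mul _).const_add _).add ((hcont.tendsto _).comp hlim.norm)
  refine le_of_tendsto_of_tendsto h1 h2 ?_
  filter_upwards [self_mem_nhdsWithin] with s hs
  have hs : 0 < s := hs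
  have hgen := isGeneratorAt_apply hT hτ hs y
  have h3 := hLS (T s y) (hT.positive s hs y hy) _ hgen ε hε
  rw [lpNorm_two] at h3
  have h4 : (⟪toL2 τ (T s y), generatorL2 hT s (toL2 τ y)⟫_ℂ).re ≤ E := by
    refine le_of_tendsto_of_tendsto
      ((Complex.continuous_re.tendsto _).comp (tendsto_const_nhds.inner hgen)) he ?_
    filter_upwards [self_mem_nhdsWithin] with h hh
    have hh : 0 < h := hh
    refine le_trans ?_ (hE h hh)
    simp only [Function.comp, inner_smul_right, Complex.re_ofReal_mul]
    exact mul_le_mul_of_nonneg_left (inner_sub_apply_le hT hs hh y) (by positivity)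
  have h5 := mul_le_mul_of_nonneg_left h4 hε.le
  linarith

lemma norm_cfc_rpow_le_one {z : 𝓜} (hz : 0 ≤ z) (hz1 : ‖z‖ ≤ 1) {q : ℝ} (hq : 0 ≤ q) :
    ‖cfc (fun u : ℝ => u ^ q) z‖ ≤ 1 :=
  norm_cfc_le zero_le_one fun u hu => by
    have := spectrum_subset_Icc hz hz1 hu
    rw [Real.norm_of_nonneg (Real.rpow_nonneg this.1 _)]
    exact Real.rpow_le_one this.1 this.2 hq

lemma cfc_rpow_half_mul_self {z : 𝓜} (hz : 0 ≤ z) {p : ℝ} (hp : 0 ≤ p) :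
    cfc (fun u : ℝ => u ^ (p / 2)) z * cfc (fun u : ℝ => u ^ (p / 2)) z =
      cfc (fun u : ℝ => u ^ p) z := by
  have hc := (continuous_rpow (show 0 ≤ p / 2 by linarith)).continuousOn (s := spectrum ℝ z)
  rw [← cfc_mul _ _ z hc hc]
  refine cfc_congr fun u hu => ?_
  have := spectrum_nonneg_of_nonneg hz hu
  rw [← Real.rpow_add_of_nonneg this (by linarith) (by linarith), add_halves]

/-- The logarithmic Sobolev inequality for the power `z ^ (p / 2)`, with the energy of the power
estimated by the Stroock–Varopoulos inequality. -/
lemma LogSobolev.rpow (hτ : IsNormalFaithfulFiniteTrace τ)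
    (hT : IsSymmetricPositiveContractionSemigroup τ T) (hLS : LogSobolev τ T M C)
    {z : 𝓜} (hz : 0 ≤ z) (hz1 : ‖z‖ ≤ 1) {Lz : L2 τ} (hLz : IsGeneratorAt τ T z Lz)
    {p : ℝ} (hp : 2 ≤ p) {ε : ℝ} (hε : 0 < ε) :
    p / 2 * (τ (cfc (fun u : ℝ => u ^ p * Real.log u) z)).re ≤
      ε * (p / 2 * (⟪toL2 τ (cfc (fun u : ℝ => u ^ (p - 1)) z), Lz⟫_ℂ).re) +
        C * M ε * (τ (cfc (fun u : ℝ => u ^ p) z)).re +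
        (τ (cfc (fun u : ℝ => u ^ p) z)).re *
          (Real.log (τ (cfc (fun u : ℝ => u ^ p) z)).re / 2) := by
  set y := cfc (fun u : ℝ => u ^ (p / 2)) z with hydef
  have hsp := spectrum_subset_Icc hz hz1
  have hc := (continuous_rpow (show 0 ≤ p / 2 by linarith)).continuousOn (s := spectrum ℝ z)
  have hy : 0 ≤ y := cfc_nonneg fun u hu => Real.rpow_nonneg (hsp hu).1 _
  have hys := IsSelfAdjoint.of_nonneg hy
  have hy1 : ‖y‖ ≤ 1 := norm_cfc_rpow_le_one hz hz1 (by linarith)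
  have hyy := cfc_rpow_half_mul_self hz (show 0 ≤ p by linarith)
  rw [← hydef] at hyy
  have hnorm : ‖toL2 τ y‖ ^ 2 = (τ (cfc (fun u : ℝ => u ^ p) z)).re := by
    rw [norm_toL2_sq, hys.star_eq, hyy]
  have hlog : Real.log ‖toL2 τ y‖ = Real.log (τ (cfc (fun u : ℝ => u ^ p) z)).re / 2 := by
    rw [← hnorm, Real.log_pow]; push_cast; ring
  have hcfc : cfc (fun u : ℝ => u ^ 2 * Real.log u) y =
      (p / 2) • cfc (fun u : ℝ => u ^ p * Real.log u) z := by
    rw [hydef, ← cfc_comp' (fun u : ℝ => u ^ 2 * Real.log u) (fun u : ℝ => u ^ (p / 2)) z ?_ hc,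
      ← cfc_smul _ _ _ ((continuousOn_rpow_mul_log (by linarith)).mono fun u hu => (hsp hu).1)]
    · refine cfc_congr fun u hu => ?_
      rcases (hsp hu).1.eq_or_lt with h0 | h0
      · simp [← h0, Real.zero_rpow (show p / 2 ≠ 0 by linarith)]
      · simp only [Real.log_rpow h0, smul_eq_mul]
        rw [← Real.rpow_natCast, ← Real.rpow_mul h0.le]
        push_cast
        rw [div_mul_cancel₀ _ two_ne_zero]; ring
    · have : (fun u : ℝ => u ^ 2 * Real.log u) = fun u => u * (u * Real.log u) := by
        ext u; ring
      rw [this]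
      exact (continuous_id.mul Real.continuous_mul_log).continuousOn
  have key := hLS.of_energy_le hτ hT hy hy1
    (e := fun h => p / 2 * (⟪toL2 τ (cfc (fun u : ℝ => u ^ (p - 1)) z),
      ((h⁻¹ : ℝ) : ℂ) • (toL2 τ z - toL2 τ (T h z))⟫_ℂ).re)
    (((Complex.continuous_re.tendsto _).comp (tendsto_const_nhds.inner hLz)).const_mul (p / 2))
    (fun h hh => by
      have hSV := stroock_varopoulos hτ (hT.positive h hh) (hT.continuous hh) (hT.apply_one_le hh)
        (fun a b _ hb => by
          have := hT.symmetric h hh a b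
          rw [(hT.isSelfAdjoint hh hb).star_eq, hb.star_eq, hτ.tracial] at this
          exact this) hz hz1 hp
      have e1 : (⟪toL2 τ y, toL2 τ y - toL2 τ (T h y)⟫_ℂ).re =
          (τ (cfc (fun u : ℝ => u ^ p) z)).re - (τ (y * T h y)).re := by
        rw [inner_sub_right, inner_toL2, inner_toL2, hys.star_eq, hyy, Complex.sub_re]
      have e2 : (⟪toL2 τ (cfc (fun u : ℝ => u ^ (p - 1)) z), toL2 τ z - toL2 τ (T h z)⟫_ℂ).re =
          (τ (cfc (fun u : ℝ => u ^ p) z)).re -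
            (τ (cfc (fun u : ℝ => u ^ (p - 1)) z * T h z)).re := by
        have hsa : IsSelfAdjoint (cfc (fun u : ℝ => u ^ (p - 1)) z) := cfc_predicate _ _
        rw [inner_sub_right, inner_toL2, inner_toL2, hsa.star_eq,
          cfc_rpow_mul_self hz (by linarith), Complex.sub_re]
      simp only [inner_smul_right, Complex.re_ofReal_mul]
      rw [e1, e2, mul_left_comm]
      exact mul_le_mul_of_nonneg_left hSV (by positivity)) hε
  rw [hcfc, trace_real_smul, hlog, hnorm] at key
  exact key

end LogSobolevPowers

/-! ### The evolution of `τ(x_s ^ p(s))` -/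

section Evolution

variable {𝓜 : Type*} [CStarAlgebra 𝓜] [PartialOrder 𝓜] [StarOrderedRing 𝓜] {τ : 𝓜 →ₚ[ℂ] ℂ}
  {T : ℝ → 𝓜 →ₗ[ℂ] 𝓜} {M : ℝ → ℝ} {C : ℝ}

/-- The orbit `s ↦ T_s x`, with value `x` at `s ≤ 0`. -/
def orbit (T : ℝ → 𝓜 →ₗ[ℂ] 𝓜) (x : 𝓜) (s : ℝ) : 𝓜 := if 0 < s then T s x else x

/-- `τ(x_s ^ p(s))` along the orbit of `x`, with `p(s) = 2t / (t - s)` increasing from `2` at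
`s = 0` to `∞` at `s = t`. -/
def powerTrace (τ : 𝓜 →ₚ[ℂ] ℂ) (T : ℝ → 𝓜 →ₗ[ℂ] 𝓜) (x : 𝓜) (t s : ℝ) : ℝ :=
  (τ (cfc (fun u : ℝ => u ^ (2 * t / (t - s))) (orbit T x s))).re

lemma orbit_of_pos {s : ℝ} (hs : 0 < s) (x : 𝓜) : orbit T x s = T s x := if_pos hs

lemma orbit_zero (x : 𝓜) : orbit T x 0 = x := if_neg (lt_irrefl _)

lemma orbit_nonneg (hT : IsSymmetricPositiveContractionSemigroup τ T) {x : 𝓜} (hx : 0 ≤ x)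
    (s : ℝ) : 0 ≤ orbit T x s := by
  rw [orbit]; split_ifs with hs
  · exact hT.positive s hs x hx
  · exact hx

lemma norm_orbit_le (hT : IsSymmetricPositiveContractionSemigroup τ T) {x : 𝓜} (hx : ‖x‖ ≤ 1)
    (s : ℝ) : ‖orbit T x s‖ ≤ 1 := by
  rw [orbit]; split_ifs with hs
  · exact (hT.contraction s hs x).trans hx
  · exact hx

lemma toL2_orbit (hT : IsSymmetricPositiveContractionSemigroup τ T) (x : 𝓜) (s : ℝ) :
    toL2 τ (orbit T x s) = semigroupL2 hT s (toL2 τ x) := by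
  rw [orbit]; split_ifs with hs
  · rw [semigroupL2_toL2 hT hs]
  · rw [semigroupL2, dif_neg hs]; rfl

lemma apply_orbit (hT : IsSymmetricPositiveContractionSemigroup τ T) (x : 𝓜) {s h : ℝ}
    (hs : 0 < s) (hh : 0 < h) : T h (orbit T x s) = orbit T x (s + h) := by
  rw [orbit_of_pos hs, orbit_of_pos (by linarith), add_comm, hT.semigroup h s hh hs]

lemma continuousOn_toL2_orbit (hτ : IsNormalFaithfulFiniteTrace τ)
    (hT : IsSymmetricPositiveContractionSemigroup τ T) (x : 𝓜) :
    ContinuousOn (fun s => toL2 τ (orbit T x s)) (Ici 0) := by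
  simp only [toL2_orbit hT]
  exact continuousOn_semigroupL2 hT hτ _

lemma continuousOn_trace_cfc_orbit (hτ : IsNormalFaithfulFiniteTrace τ)
    (hT : IsSymmetricPositiveContractionSemigroup τ T) {x : 𝓜} (hx : 0 ≤ x) (hx1 : ‖x‖ ≤ 1)
    {g : ℝ → ℝ} (hg : ContinuousOn g (Icc 0 1)) :
    ContinuousOn (fun s => (τ (cfc g (orbit T x s))).re) (Ici 0) := fun s hs =>
  tendsto_trace_re (tendsto_toL2_cfc hτ
    (Eventually.of_forall fun r => ⟨orbit_nonneg hT hx r, norm_orbit_le hT hx1 r⟩)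
    (orbit_nonneg hT hx s) (norm_orbit_le hT hx1 s) hg (continuousOn_toL2_orbit hτ hT x s hs))

lemma abs_trace_cfc_le {z : 𝓜} (hz : 0 ≤ z) (hz1 : ‖z‖ ≤ 1) {f : ℝ → ℝ} {c : ℝ}
    (hc : 0 ≤ c) (hf : ∀ u ∈ Icc (0 : ℝ) 1, |f u| ≤ c) :
    |(τ (cfc f z)).re| ≤ ‖toL2 τ (1 : 𝓜)‖ ^ 2 * c :=
  (Complex.abs_re_le_norm _).trans <| (norm_trace_le _).trans <| by
    gcongr
    exact norm_cfc_le hc fun u hu => hf u (spectrum_subset_Icc hz hz1 hu)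

lemma abs_trace_rpow_sub_le {z : 𝓜} (hz : 0 ≤ z) (hz1 : ‖z‖ ≤ 1) {p q : ℝ} (hp : 1 ≤ p)
    (hq : 1 ≤ q) :
    |(τ (cfc (fun u : ℝ => u ^ q) z)).re - (τ (cfc (fun u : ℝ => u ^ p) z)).re| ≤
      ‖toL2 τ (1 : 𝓜)‖ ^ 2 * |q - p| := by
  wlog hpq : p ≤ q generalizing p q with H
  · rw [abs_sub_comm, abs_sub_comm q]; exact H hq hp (le_of_not_ge hpq)
  rw [← Complex.sub_re, ← map_sub, ← cfc_sub _ _ z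
    (continuous_rpow (by linarith)).continuousOn (continuous_rpow (by linarith)).continuousOn]
  refine abs_trace_cfc_le hz hz1 (abs_nonneg _) fun u hu => ?_
  have h := abs_rpow_add_sub_rpow_le hu (show 0 < p by linarith) (sub_nonneg.2 hpq)
  rw [add_sub_cancel] at h
  refine h.trans ?_
  rw [abs_of_nonneg (sub_nonneg.2 hpq)]
  exact mul_le_of_le_one_right (sub_nonneg.2 hpq) (by
    rw [div_le_one (by linarith)]; exact hp)

lemma abs_trace_rpow_sub_sub_le {z : 𝓜} (hz : 0 ≤ z) (hz1 : ‖z‖ ≤ 1) {p q : ℝ} (hp : 2 ≤ p)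
    (hpq : p ≤ q) :
    |(τ (cfc (fun u : ℝ => u ^ q) z)).re - (τ (cfc (fun u : ℝ => u ^ p) z)).re -
      (q - p) * (τ (cfc (fun u : ℝ => u ^ p * Real.log u) z)).re| ≤
      ‖toL2 τ (1 : 𝓜)‖ ^ 2 * (q - p) ^ 2 := by
  have hsp := spectrum_subset_Icc hz hz1
  have c1 := (continuous_rpow (show 0 ≤ p by linarith)).continuousOn (s := spectrum ℝ z)
  have c2 := (continuous_rpow (show 0 ≤ q by linarith)).continuousOn (s := spectrum ℝ z)
  have c3 : ContinuousOn (fun u : ℝ => u ^ p * Real.log u) (spectrum ℝ z) :=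
    (continuousOn_rpow_mul_log (by linarith)).mono fun u hu => (hsp hu).1
  rw [← trace_real_smul, ← cfc_const_mul _ _ z c3, ← Complex.sub_re, ← map_sub,
    ← cfc_sub _ _ z c2 c1, ← Complex.sub_re, ← map_sub,
    ← cfc_sub (fun u : ℝ => u ^ q - u ^ p) _ z (c2.sub c1) (c3.const_mul _)]
  refine abs_trace_cfc_le hz hz1 (sq_nonneg _) fun u hu => ?_
  have h := abs_rpow_add_sub_le hu (show 0 < p by linarith) (sub_nonneg.2 hpq)
  rw [add_sub_cancel] at h
  refine h.trans (mul_le_of_le_one_right (sq_nonneg _) ?_)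
  rw [div_le_one (by positivity)]
  nlinarith

lemma two_le_exponent {t s : ℝ} (hs : 0 ≤ s) (hst : s < t) : 2 ≤ 2 * t / (t - s) := by
  rw [le_div_iff₀ (by linarith)]; linarith

lemma hasDerivAt_exponent {t s : ℝ} (hst : s < t) :
    HasDerivAt (fun r => 2 * t / (t - r)) (2 * t / (t - s) ^ 2) s := by
  have h := ((hasDerivAt_id s).const_sub t).inv (by simp only [id_eq]; linarith)
  have h2 := h.const_mul (2 * t)
  simp only [id_eq] at h2
  refine h2.congr_deriv ?_
  ring

lemma continuousOn_powerTrace (hτ : IsNormalFaithfulFiniteTrace τ)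
    (hT : IsSymmetricPositiveContractionSemigroup τ T) {x : 𝓜} (hx : 0 ≤ x) (hx1 : ‖x‖ ≤ 1)
    (t : ℝ) : ContinuousOn (powerTrace τ T x t) (Ico 0 t) := by
  intro s hs
  have hp := two_le_exponent hs.1 hs.2
  set p := 2 * t / (t - s) with hpdef
  have h2 : Tendsto (fun r => (τ (cfc (fun u : ℝ => u ^ p) (orbit T x r))).re) (𝓝[Ico 0 t] s)
      (𝓝 (powerTrace τ T x t s)) :=
    ((continuousOn_trace_cfc_orbit hτ hT hx hx1
      (continuous_rpow (by linarith)).continuousOn) s hs.1).mono Ico_subset_Ici_self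
  have h1 : Tendsto (fun r => powerTrace τ T x t r -
      (τ (cfc (fun u : ℝ => u ^ p) (orbit T x r))).re) (𝓝[Ico 0 t] s) (𝓝 0) := by
    have hq : Tendsto (fun r => ‖toL2 τ (1 : 𝓜)‖ ^ 2 * |2 * t / (t - r) - p|) (𝓝[Ico 0 t] s)
        (𝓝 0) := by
      have := (((hasDerivAt_exponent hs.2).continuousAt.tendsto.mono_left
        (nhdsWithin_le_nhds (s := Ico 0 t))).sub_const p).abs.const_mul (‖toL2 τ (1 : 𝓜)‖ ^ 2)
      simpa [← hpdef] using this
    refine squeeze_zero_norm' ?_ hq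
    filter_upwards [self_mem_nhdsWithin] with r hr
    have hr2 := two_le_exponent hr.1 hr.2
    exact abs_trace_rpow_sub_le (orbit_nonneg hT hx r) (norm_orbit_le hT hx1 r) (by linarith)
      (by linarith)
  have := h1.add h2
  simpa [ContinuousWithinAt] using this

/-- The right derivative of `s ↦ τ(x_s ^ p)`. The two bounds for the difference quotient come from
Klein's inequality, applied at either end of the increment. -/
lemma hasDerivWithinAt_trace_rpow (hτ : IsNormalFaithfulFiniteTrace τ)
    (hT : IsSymmetricPositiveContractionSemigroup τ T) {x : 𝓜} (hx : 0 ≤ x) (hx1 : ‖x‖ ≤ 1)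
    {s : ℝ} (hs : 0 < s) {Lz : L2 τ} (hLz : IsGeneratorAt τ T (orbit T x s) Lz) {p : ℝ}
    (hp : 2 ≤ p) :
    HasDerivWithinAt (fun r => (τ (cfc (fun u : ℝ => u ^ p) (orbit T x r))).re)
      (-(p * (⟪toL2 τ (cfc (fun u : ℝ => u ^ (p - 1)) (orbit T x s)), Lz⟫_ℂ).re)) (Ioi s) s := by
  rw [hasDerivWithinAt_iff_tendsto_slope' (by simp)]
  have hG : Tendsto (fun r => (((r - s)⁻¹ : ℝ) : ℂ) • (toL2 τ (orbit T x r) -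
      toL2 τ (orbit T x s))) (𝓝[>] s) (𝓝 (-Lz)) := by
    have hsub : Tendsto (fun r => r - s) (𝓝[>] s) (𝓝[>] 0) := by
      refine tendsto_nhdsWithin_iff.2 ⟨?_, ?_⟩
      · have : Continuous fun r : ℝ => r - s := by fun_prop
        simpa using (this.tendsto s).mono_left nhdsWithin_le_nhds
      · filter_upwards [self_mem_nhdsWithin] with r hr
        exact sub_pos.2 (mem_Ioi.1 hr)
    refine ((hLz.comp hsub).neg).congr' ?_
    filter_upwards [self_mem_nhdsWithin] with r hr
    simp only [Function.comp]
    rw [apply_orbit hT x hs (sub_pos.2 (mem_Ioi.1 hr)), add_sub_cancel, ← smul_neg, neg_sub]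
  have hX : Tendsto (fun r => toL2 τ (cfc (fun u : ℝ => u ^ (p - 1)) (orbit T x r))) (𝓝[>] s)
      (𝓝 (toL2 τ (cfc (fun u : ℝ => u ^ (p - 1)) (orbit T x s)))) :=
    tendsto_toL2_cfc hτ
      (Eventually.of_forall fun r => ⟨orbit_nonneg hT hx r, norm_orbit_le hT hx1 r⟩)
      (orbit_nonneg hT hx s) (norm_orbit_le hT hx1 s)
      (continuous_rpow (by linarith)).continuousOn
      ((continuousOn_toL2_orbit hτ hT x s hs.le).mono fun r hr => (hs.trans hr).le)
  have e : -(p * (⟪toL2 τ (cfc (fun u : ℝ => u ^ (p - 1)) (orbit T x s)), Lz⟫_ℂ).re) =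
      p * (⟪toL2 τ (cfc (fun u : ℝ => u ^ (p - 1)) (orbit T x s)), -Lz⟫_ℂ).re := by
    rw [inner_neg_right, Complex.neg_re]; ring
  have hinner : ∀ (z : 𝓜) (r : ℝ), p * (⟪toL2 τ (cfc (fun u : ℝ => u ^ (p - 1)) z),
      (((r - s)⁻¹ : ℝ) : ℂ) • (toL2 τ (orbit T x r) - toL2 τ (orbit T x s))⟫_ℂ).re =
      (r - s)⁻¹ * (p * (τ (cfc (fun u : ℝ => u ^ (p - 1)) z *
        (orbit T x r - orbit T x s))).re) := by
    intro z r
    have hsa : IsSelfAdjoint (cfc (fun u : ℝ => u ^ (p - 1)) z) := cfc_predicate _ _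
    rw [inner_smul_right, Complex.re_ofReal_mul, ← toL2_sub, inner_toL2, hsa.star_eq]
    ring
  rw [e]
  refine tendsto_of_tendsto_of_tendsto_of_le_of_le'
    (((Complex.continuous_re.tendsto _).comp (tendsto_const_nhds.inner hG)).const_mul p)
    (((Complex.continuous_re.tendsto _).comp (hX.inner hG)).const_mul p) ?_ ?_
  · filter_upwards [self_mem_nhdsWithin] with r hr
    have hr : 0 < r - s := sub_pos.2 hr
    simp only [Function.comp]
    rw [hinner, slope_def_module, smul_eq_mul]
    gcongr
    exact klein_inequality hτ (orbit_nonneg hT hx s) (norm_orbit_le hT hx1 s)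
      (orbit_nonneg hT hx r) (norm_orbit_le hT hx1 r) (by linarith)
  · filter_upwards [self_mem_nhdsWithin] with r hr
    have hr : 0 < r - s := sub_pos.2 hr
    simp only [Function.comp]
    rw [hinner, slope_def_module, smul_eq_mul]
    gcongr
    have := klein_inequality hτ (orbit_nonneg hT hx r) (norm_orbit_le hT hx1 r)
      (orbit_nonneg hT hx s) (norm_orbit_le hT hx1 s) (show 1 ≤ p by linarith)
    rw [← neg_sub (orbit T x r), mul_neg, map_neg, Complex.neg_re] at this
    linarith

/-- The right derivative of `powerTrace`: the derivative in the exponent plus the one along the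
orbit. -/
lemma hasDerivWithinAt_powerTrace (hτ : IsNormalFaithfulFiniteTrace τ)
    (hT : IsSymmetricPositiveContractionSemigroup τ T) {x : 𝓜} (hx : 0 ≤ x) (hx1 : ‖x‖ ≤ 1)
    {t s : ℝ} (hs : 0 < s) (hst : s < t) {Lz : L2 τ} (hLz : IsGeneratorAt τ T (orbit T x s) Lz)
    {p : ℝ} (hp : p = 2 * t / (t - s)) :
    HasDerivWithinAt (powerTrace τ T x t)
      (2 * t / (t - s) ^ 2 * (τ (cfc (fun u : ℝ => u ^ p * Real.log u) (orbit T x s))).re -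
        p * (⟪toL2 τ (cfc (fun u : ℝ => u ^ (p - 1)) (orbit T x s)), Lz⟫_ℂ).re) (Ioi s) s := by
  have hp2 : 2 ≤ p := hp ▸ two_le_exponent hs.le hst
  set W : ℝ → ℝ := fun r => (τ (cfc (fun u : ℝ => u ^ p * Real.log u) (orbit T x r))).re with hW
  set D : ℝ → ℝ := fun r => powerTrace τ T x t r -
    (τ (cfc (fun u : ℝ => u ^ p) (orbit T x r))).re with hD
  set q : ℝ → ℝ := fun r => 2 * t / (t - r) with hq
  have hqs : q s = p := hp.symm
  have hDs : D s = 0 := by simp only [hD, powerTrace, ← hp, sub_self]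
  have hqd := hasDerivAt_exponent hst
  have hqslope : Tendsto (slope q s) (𝓝[>] s) (𝓝 (2 * t / (t - s) ^ 2)) :=
    (hasDerivWithinAt_iff_tendsto_slope' (by simp)).1 hqd.hasDerivWithinAt
  have hqc : Tendsto (fun r => q r - p) (𝓝[>] s) (𝓝 0) := by
    have := (hqd.continuousAt.tendsto.mono_left (nhdsWithin_le_nhds (s := Ioi s))).sub_const p
    simpa [← hp] using this
  have hWc : Tendsto W (𝓝[>] s) (𝓝 (W s)) :=
    ((continuousOn_trace_cfc_orbit hτ hT hx hx1
      ((continuousOn_rpow_mul_log (by linarith)).mono Icc_subset_Ici_self)) s hs.le).mono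
        fun r hr => (hs.trans hr).le
  have hDd : HasDerivWithinAt D (2 * t / (t - s) ^ 2 * W s) (Ioi s) s := by
    rw [hasDerivWithinAt_iff_tendsto_slope' (by simp)]
    have herr : Tendsto (fun r => slope D s r - slope q s r * W r) (𝓝[>] s) (𝓝 0) := by
      have hlim : Tendsto (fun r => ‖toL2 τ (1 : 𝓜)‖ ^ 2 * (slope q s r * (q r - p))) (𝓝[>] s)
          (𝓝 0) := by
        have := (hqslope.mul hqc).const_mul (‖toL2 τ (1 : 𝓜)‖ ^ 2)
        simpa using this
      refine squeeze_zero_norm' ?_ hlim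
      filter_upwards [Ioo_mem_nhdsGT hst] with r hr
      have hrs : 0 < r - s := sub_pos.2 hr.1
      have hqr : p ≤ q r := by
        rw [hp]
        have : 0 < t - r := sub_pos.2 hr.2
        have : 0 < 2 * t := by linarith
        simp only [hq]
        gcongr
        exact hr.1.le
      have h := abs_trace_rpow_sub_sub_le (τ := τ) (orbit_nonneg hT hx r)
        (norm_orbit_le hT hx1 r) hp2 hqr
      have e1 : slope D s r - slope q s r * W r = (r - s)⁻¹ * (D r - (q r - p) * W r) := by
        rw [slope_def_module, slope_def_module, hDs, hqs]; simp only [smul_eq_mul]; ring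
      have e2 : slope q s r * (q r - p) = (r - s)⁻¹ * (q r - p) ^ 2 := by
        rw [slope_def_module, hqs, smul_eq_mul]; ring
      rw [e1, e2, norm_mul, Real.norm_of_nonneg (by positivity), mul_left_comm]
      gcongr
      exact h
    have := herr.add (hqslope.mul hWc)
    simpa using this
  have hφ2 := hasDerivWithinAt_trace_rpow hτ hT hx hx1 hs hLz hp2
  have hsum := hDd.add hφ2
  have efun : (D + fun r => (τ (cfc (fun u : ℝ => u ^ p) (orbit T x r))).re) =
      powerTrace τ T x t := by
    ext r; simp [hD]
  rw [efun] at hsum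
  exact hsum.congr_deriv (by rw [← sub_eq_add_neg])

end Evolution

/-! ### The bound `L_2 → L_∞` on positive elements -/

section Hypercontractivity

variable {𝓜 : Type*} [CStarAlgebra 𝓜] [PartialOrder 𝓜] [StarOrderedRing 𝓜] {τ : 𝓜 →ₚ[ℂ] ℂ}
  {T : ℝ → 𝓜 →ₗ[ℂ] 𝓜} {M : ℝ → ℝ} {C : ℝ}

lemma eq_zero_of_trace_rpow_le_zero (hτ : IsNormalFaithfulFiniteTrace τ) {z : 𝓜} (hz : 0 ≤ z)
    {p : ℝ} (hp : 0 < p) (h : (τ (cfc (fun u : ℝ => u ^ p) z)).re ≤ 0) : z = 0 := by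
  have hc := (continuous_rpow hp.le).continuousOn (s := spectrum ℝ z)
  have h0 := eq_zero_of_trace_re_eq_zero hτ
    (cfc_nonneg fun u hu => Real.rpow_nonneg (spectrum_nonneg_of_nonneg hz hu) p) h
  rw [← cfc_const_zero ℝ z] at h0
  have h1 := eqOn_of_cfc_eq_cfc h0 hc continuousOn_const (IsSelfAdjoint.of_nonneg hz)
  rw [← cfc_id' ℝ z (IsSelfAdjoint.of_nonneg hz), ← cfc_const_zero ℝ z]
  exact cfc_congr fun u hu => (Real.rpow_eq_zero (spectrum_nonneg_of_nonneg hz hu) hp.ne').1 (h1 hu)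

lemma powerTrace_pos (hτ : IsNormalFaithfulFiniteTrace τ)
    (hT : IsSymmetricPositiveContractionSemigroup τ T) {x : 𝓜} (hx : 0 ≤ x) {t s : ℝ}
    (hs : 0 ≤ s) (hst : s < t) (h0 : T t x ≠ 0) : 0 < powerTrace τ T x t s := by
  by_contra! h
  have hp := two_le_exponent hs hst
  have hz := eq_zero_of_trace_rpow_le_zero hτ (orbit_nonneg hT hx s) (by linarith) h
  apply h0
  rcases hs.eq_or_lt with rfl | hs
  · rw [orbit_zero] at hz
    rw [hz, map_zero]
  · have := apply_orbit hT x hs (sub_pos.2 hst)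
    rw [add_sub_cancel, hz, map_zero, orbit_of_pos (hs.trans hst)] at this
    exact this.symm

/-- Gross' argument: the logarithmic Sobolev inequality with `ε = t - s` bounds the right
derivative of `s ↦ log ‖T_s x‖_{p(s)}`, `p(s) = 2t / (t - s)`, by `(C / t) M(t - s)`. -/
theorem log_powerTrace_le (hτ : IsNormalFaithfulFiniteTrace τ)
    (hT : IsSymmetricPositiveContractionSemigroup τ T) (hLS : LogSobolev τ T M C)
    {x : 𝓜} (hx : 0 ≤ x) (hx1 : ‖x‖ ≤ 1) {t : ℝ} (hM : IntervalIntegrable M volume 0 t)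
    (h0 : T t x ≠ 0) {s : ℝ} (hs : 0 ≤ s) (hst : s < t) :
    Real.log (powerTrace τ T x t s) * ((t - s) / (2 * t)) ≤
      Real.log ‖toL2 τ x‖ + C / t * ∫ r in (t - s)..t, M r := by
  have ht : 0 < t := hs.trans_lt hst
  have hpos : ∀ r ∈ Icc 0 s, 0 < powerTrace τ T x t r := fun r hr =>
    powerTrace_pos hτ hT hx hr.1 (hr.2.trans_lt hst) h0
  have hcont : ContinuousOn (fun r => Real.log (powerTrace τ T x t r) * ((t - r) / (2 * t)))
      (Icc 0 s) :=
    (((continuousOn_powerTrace hτ hT hx hx1 t).mono (Icc_subset_Ico_right hst)).log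
      fun r hr => (hpos r hr).ne').mul (by fun_prop)
  set LX : ℝ → L2 τ := fun r => generatorL2 hT r (toL2 τ x) with hLX
  set dφ : ℝ → ℝ := fun r =>
    2 * t / (t - r) ^ 2 *
      (τ (cfc (fun u : ℝ => u ^ (2 * t / (t - r)) * Real.log u) (orbit T x r))).re -
      (2 * t / (t - r)) * (⟪toL2 τ (cfc (fun u : ℝ => u ^ (2 * t / (t - r) - 1)) (orbit T x r)),
        LX r⟫_ℂ).re with hdφ
  have hgen : ∀ r, 0 < r → IsGeneratorAt τ T (orbit T x r) (LX r) := fun r hr => by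
    rw [orbit_of_pos hr]; exact isGeneratorAt_apply hT hτ hr x
  have hderiv : ∀ r ∈ Ioo 0 s, HasDerivWithinAt
      (fun r => Real.log (powerTrace τ T x t r) * ((t - r) / (2 * t)))
      (dφ r / powerTrace τ T x t r * ((t - r) / (2 * t)) +
        Real.log (powerTrace τ T x t r) * (-1 / (2 * t))) (Ioi r) r := by
    intro r hr
    have h1 := hasDerivWithinAt_powerTrace hτ hT hx hx1 hr.1 (hr.2.trans hst) (hgen r hr.1) rfl
    have h2 : HasDerivWithinAt (fun r => (t - r) / (2 * t)) (-1 / (2 * t)) (Ioi r) r :=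
      (((hasDerivAt_id r).const_sub t).div_const (2 * t)).hasDerivWithinAt
    exact (h1.log (hpos r ⟨hr.1.le, hr.2.le⟩).ne').mul h2
  have hint : IntegrableOn (fun r => C / t * M (t - r)) (Icc 0 s) := by
    have h1 : IntervalIntegrable (fun r => M (t - r)) volume t 0 := by
      simpa using hM.comp_sub_left t
    have h2 := (h1.const_mul (C / t)).symm
    rw [intervalIntegrable_iff_integrableOn_Icc_of_le ht.le] at h2
    exact h2.mono_set (Icc_subset_Icc_right hst.le)
  have hle : ∀ r ∈ Ioo 0 s, dφ r / powerTrace τ T x t r * ((t - r) / (2 * t)) +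
        Real.log (powerTrace τ T x t r) * (-1 / (2 * t)) ≤ C / t * M (t - r) := by
    intro r hr
    have htr : 0 < t - r := by linarith [hr.2]
    have hLS' := hLS.rpow hτ hT (orbit_nonneg hT hx r) (norm_orbit_le hT hx1 r) (hgen r hr.1)
      (two_le_exponent hr.1.le (hr.2.trans hst)) htr
    have hφ := hpos r ⟨hr.1.le, hr.2.le⟩
    change _ ≤ _ + C * M (t - r) * powerTrace τ T x t r +
      powerTrace τ T x t r * (Real.log (powerTrace τ T x t r) / 2) at hLS'
    simp only [hdφ]
    generalize (τ (cfc (fun u : ℝ => u ^ (2 * t / (t - r)) * Real.log u) (orbit T x r))).re = W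
      at *
    generalize (⟪toL2 τ (cfc (fun u : ℝ => u ^ (2 * t / (t - r) - 1)) (orbit T x r)),
      LX r⟫_ℂ).re = I at *
    generalize powerTrace τ T x t r = φ at *
    have e1 : 2 * t / (t - r) / 2 = t / (t - r) := by ring
    rw [e1] at hLS'
    have e2 : (t - r) * (t / (t - r) * I) = t * I := by field_simp
    rw [e2] at hLS'
    have e3 : (2 * t / (t - r) ^ 2 * W - 2 * t / (t - r) * I) / φ * ((t - r) / (2 * t)) +
        Real.log φ * (-1 / (2 * t)) =
        (t / (t - r) * W - t * I - φ * (Real.log φ / 2)) / (t * φ) := by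
      field_simp
      ring
    rw [e3, div_le_iff₀ (by positivity)]
    have e4 : C / t * M (t - r) * (t * φ) = C * M (t - r) * φ := by field_simp
    rw [e4]
    linarith
  have key := intervalIntegral.sub_le_integral_of_hasDeriv_right_of_le hs hcont hderiv hint hle
  have e5 : ∫ r in (0 : ℝ)..s, C / t * M (t - r) = C / t * ∫ r in (t - s)..t, M r := by
    rw [intervalIntegral.integral_const_mul, intervalIntegral.integral_comp_sub_left, sub_zero]
  have e6 : Real.log (powerTrace τ T x t 0) * ((t - 0) / (2 * t)) = Real.log ‖toL2 τ x‖ := by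
    have h1 : powerTrace τ T x t 0 = ‖toL2 τ x‖ ^ 2 := by
      rw [powerTrace, orbit_zero, norm_toL2_sq, (IsSelfAdjoint.of_nonneg hx).star_eq, ← sq,
        ← cfc_pow_id (R := ℝ) x 2]
      congr 3
      ext u
      rw [sub_zero, mul_div_cancel_right₀ _ ht.ne']
      norm_cast
    rw [h1, Real.log_pow]
    push_cast
    field_simp
    ring
  rw [e5, e6] at key
  linarith

lemma norm_le_of_cfc_eq_zero {z : 𝓜} (hz : 0 ≤ z) {K : ℝ} (hK : 0 ≤ K)
    (h : cfc (fun u : ℝ => max (u - K) 0) z = 0) : ‖z‖ ≤ K := by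
  have hzs := IsSelfAdjoint.of_nonneg hz
  rw [← cfc_const_zero ℝ z] at h
  have h1 := eqOn_of_cfc_eq_cfc h (by fun_prop) continuousOn_const hzs
  rw [← cfc_id' ℝ z hzs]
  refine norm_cfc_le hK fun u hu => ?_
  have h2 := h1 hu
  simp only at h2
  rw [Real.norm_of_nonneg (spectrum_nonneg_of_nonneg hz hu)]
  have := le_max_left (u - K) 0
  linarith

lemma tendsto_exponent {t : ℝ} (ht : 0 < t) :
    Tendsto (fun s => 2 * t / (t - s)) (𝓝[<] t) atTop := by
  have h1 : Tendsto (fun s => t - s) (𝓝[<] t) (𝓝[>] 0) := by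
    refine tendsto_nhdsWithin_iff.2 ⟨?_, ?_⟩
    · have : Continuous fun s : ℝ => t - s := by fun_prop
      simpa using (this.tendsto t).mono_left nhdsWithin_le_nhds
    · filter_upwards [self_mem_nhdsWithin] with s hs
      exact sub_pos.2 (mem_Iio.1 hs)
  exact (tendsto_inv_nhdsGT_zero.comp h1).const_mul_atTop (show 0 < 2 * t by positivity)

/-- The bound `L_2 → L_∞` on positive elements of norm at most `1`. Since `(u - K')₊ ≤ (u / K') ^ p`
on `[0, 1]`, a bound `K < K'` on `‖T_s x‖_{p(s)}` for `s` near `t` gives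
`τ((T_s x - K')₊) ≤ (K / K') ^ p(s) → 0` as `s → t`, so `(T_t x - K')₊ = 0`. -/
lemma norm_apply_le_of_norm_le_one (hτ : IsNormalFaithfulFiniteTrace τ)
    (hT : IsSymmetricPositiveContractionSemigroup τ T) (hLS : LogSobolev τ T M C)
    {x : 𝓜} (hx : 0 ≤ x) (hx1 : ‖x‖ ≤ 1) {t : ℝ} (ht : 0 < t)
    (hM : IntervalIntegrable M volume 0 t) :
    ‖T t x‖ ≤ Real.exp (C / t * ∫ r in (0 : ℝ)..t, M r) * ‖toL2 τ x‖ := by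
  by_cases h0 : T t x = 0
  · rw [h0, norm_zero]; positivity
  have hx0 : 0 < ‖toL2 τ x‖ := by
    refine norm_pos_iff.2 fun h => h0 ?_
    rw [toL2_eq_zero hτ h, map_zero]
  -- It suffices to bound `‖T_t x‖` by every `K'` above the right-hand side; `K` lies in between.
  refine le_of_forall_gt_imp_ge_of_dense fun K' hK' => ?_
  obtain ⟨K, hK, hKK'⟩ := exists_between hK'
  have hKpos : 0 < K := lt_trans (by positivity) hK
  have hK'pos : 0 < K' := hKpos.trans hKK'
  have hint : Tendsto (fun s => Real.exp (C / t * ∫ r in (t - s)..t, M r) * ‖toL2 τ x‖) (𝓝[<] t)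
      (𝓝 (Real.exp (C / t * ∫ r in (0 : ℝ)..t, M r) * ‖toL2 τ x‖)) := by
    have hI := (intervalIntegrable_iff_integrableOn_Icc_of_le ht.le).1 hM
    have h1 : ContinuousOn (fun a => ∫ r in a..t, M r) (uIcc 0 t) :=
      intervalIntegral.continuousOn_primitive_interval_left (by rw [uIcc_of_le ht.le]; exact hI)
    rw [uIcc_of_le ht.le] at h1
    have h2 : Tendsto (fun s => t - s) (𝓝[<] t) (𝓝[Icc 0 t] 0) := by
      refine tendsto_nhdsWithin_iff.2 ⟨?_, ?_⟩
      · have : Continuous fun s : ℝ => t - s := by fun_prop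
        simpa using (this.tendsto t).mono_left nhdsWithin_le_nhds
      · filter_upwards [Ioo_mem_nhdsLT ht] with s hs
        exact ⟨by linarith [hs.2], by linarith [hs.1]⟩
    have h3 := (h1 0 ⟨le_rfl, ht.le⟩).tendsto.comp h2
    exact ((Real.continuous_exp.tendsto _).comp (h3.const_mul (C / t))).mul_const _
  have hgc : Continuous fun u : ℝ => max (u - K') 0 := by fun_prop
  have hlim : Tendsto (fun s => (τ (cfc (fun u : ℝ => max (u - K') 0) (orbit T x s))).re)
      (𝓝[<] t) (𝓝 (τ (cfc (fun u : ℝ => max (u - K') 0) (orbit T x t))).re) := by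
    have h1 := continuousOn_trace_cfc_orbit hτ hT hx hx1 hgc.continuousOn t ht.le
    refine h1.mono_left (le_inf nhdsWithin_le_nhds ?_)
    rw [le_principal_iff]
    filter_upwards [Ioo_mem_nhdsLT ht] with s hs
    exact hs.1.le
  have hzero : Tendsto (fun s => (K / K') ^ (2 * t / (t - s))) (𝓝[<] t) (𝓝 0) :=
    (tendsto_rpow_atTop_of_base_lt_one _ (by
      have : 0 < K / K' := by positivity
      linarith) ((div_lt_one hK'pos).2 hKK')).comp (tendsto_exponent ht)
  have hle : (τ (cfc (fun u : ℝ => max (u - K') 0) (orbit T x t))).re ≤ 0 := by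
    refine le_of_tendsto_of_tendsto hlim hzero ?_
    filter_upwards [Ioo_mem_nhdsLT ht, hint.eventually (gt_mem_nhds hK)] with s hs hsK
    have hp := two_le_exponent hs.1.le hs.2
    have hlog := log_powerTrace_le hτ hT hLS hx hx1 hM h0 hs.1.le hs.2
    have hφ := powerTrace_pos hτ hT hx hs.1.le hs.2 h0
    set p := 2 * t / (t - s) with hpdef
    have hts : 0 < t - s := by linarith [hs.2]
    have hp' : (t - s) / (2 * t) = p⁻¹ := by rw [hpdef, inv_div]
    rw [hp'] at hlog
    have hφle : powerTrace τ T x t s ≤ K ^ p := by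
      have h1 : Real.log (powerTrace τ T x t s) * p⁻¹ ≤ Real.log K := by
        refine hlog.trans ?_
        rw [← Real.exp_le_exp, Real.exp_add, Real.exp_log hx0, Real.exp_log hKpos, mul_comm]
        exact hsK.le
      rw [← div_eq_mul_inv, div_le_iff₀ (by linarith)] at h1
      rw [← Real.log_le_log_iff hφ (by positivity), Real.log_rpow hKpos, mul_comm]
      exact h1
    have hz := orbit_nonneg hT hx s
    have hsp := spectrum_subset_Icc hz (norm_orbit_le hT hx1 s)
    have hcmp : (τ (K' ^ p • cfc (fun u : ℝ => max (u - K') 0) (orbit T x s))).re ≤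
        powerTrace τ T x t s := by
      rw [← cfc_const_mul _ _ _ hgc.continuousOn]
      refine trace_re_mono (cfc_mono (fun u hu => ?_) (hgc.const_mul _).continuousOn
        (continuous_rpow (by linarith)).continuousOn)
      have hu := hsp hu
      rcases le_total u K' with h | h
      · rw [max_eq_right (by linarith), mul_zero]; exact Real.rpow_nonneg hu.1 _
      · rw [max_eq_left (by linarith)]
        calc K' ^ p * (u - K') ≤ K' ^ p * 1 := by gcongr; linarith [hu.2]
          _ ≤ u ^ p := by rw [mul_one]; gcongr
    rw [trace_real_smul] at hcmp
    rw [Real.div_rpow hKpos.le hK'pos.le, le_div_iff₀ (by positivity), mul_comm]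
    exact hcmp.trans hφle
  have h1 := eq_zero_of_trace_re_eq_zero hτ (cfc_nonneg fun u _ => le_max_right _ _) hle
  have h2 := norm_le_of_cfc_eq_zero (orbit_nonneg hT hx t) hK'pos.le h1
  rwa [orbit_of_pos ht] at h2

/-- The bound `L_2 → L_∞` on positive elements, by homogeneity. -/
lemma norm_apply_le_of_nonneg (hτ : IsNormalFaithfulFiniteTrace τ)
    (hT : IsSymmetricPositiveContractionSemigroup τ T) (hLS : LogSobolev τ T M C)
    {x : 𝓜} (hx : 0 ≤ x) {t : ℝ} (ht : 0 < t) (hM : IntervalIntegrable M volume 0 t) :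
    ‖T t x‖ ≤ Real.exp (C / t * ∫ r in (0 : ℝ)..t, M r) * ‖toL2 τ x‖ := by
  rcases eq_or_ne x 0 with rfl | hx0
  · simp [toL2_zero]
  have hn : 0 < ‖x‖ := norm_pos_iff.2 hx0
  have h := norm_apply_le_of_norm_le_one hτ hT hLS (x := ‖x‖⁻¹ • x)
    (smul_nonneg (by positivity) hx)
    (by rw [norm_smul, norm_inv, norm_norm, inv_mul_cancel₀ hn.ne']) ht hM
  rw [← Complex.coe_smul, map_smul, Complex.coe_smul, Complex.coe_smul, toL2_real_smul, norm_smul,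
    norm_smul, mul_left_comm, norm_inv, norm_norm] at h
  exact le_of_mul_le_mul_left h (by positivity)

end Hypercontractivity

/-! ### The norm of `L_1` and its dual -/

section LOne

variable {𝓜 : Type*} [CStarAlgebra 𝓜] [PartialOrder 𝓜] [StarOrderedRing 𝓜] {τ : 𝓜 →ₚ[ℂ] ℂ}

lemma abs_eq_of_mul_self_eq {x k : 𝓜} (hk : 0 ≤ k) (h : k * k = star x * x) : CFC.abs x = k :=
  CFC.sqrt_unique h hk

lemma trace_abs_nonneg (x : 𝓜) : 0 ≤ (τ (CFC.abs x)).re := trace_re_nonneg (CFC.abs_nonneg x)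

/-- Hölder's inequality for `L_∞` and `L_1`. With `|x| + ε` in place of `|x|`, the factorization
`x = (x (|x| + ε)^{-1/2}) (|x| + ε)^{1/2}` replaces the polar decomposition. -/
theorem norm_trace_mul_le_trace_abs (hτ : IsNormalFaithfulFiniteTrace τ) (a x : 𝓜) :
    ‖τ (a * x)‖ ≤ ‖a‖ * (τ (CFC.abs x)).re := by
  set k := CFC.abs x with hkdef
  have hk : 0 ≤ k := CFC.abs_nonneg x
  have hks := IsSelfAdjoint.of_nonneg hk
  have hkk : k * k = star x * x := CFC.abs_mul_abs x
  set N := (τ k).re with hN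
  have hN0 : 0 ≤ N := trace_re_nonneg hk
  have key : ∀ ε : ℝ, 0 < ε → ‖τ (a * x)‖ ^ 2 ≤ ‖a‖ ^ 2 * (N * (N + ε * (τ (1 : 𝓜)).re)) := by
    intro ε hε
    have hsp : ∀ u ∈ spectrum ℝ k, 0 < u + ε := fun u hu => by
      have := spectrum_nonneg_of_nonneg hk hu; linarith
    have hfc : ContinuousOn (fun u : ℝ => √(u + ε)) (spectrum ℝ k) := by fun_prop
    have hgc : ContinuousOn (fun u : ℝ => (√(u + ε))⁻¹) (spectrum ℝ k) :=
      hfc.inv₀ fun u hu => (Real.sqrt_pos.2 (hsp u hu)).ne'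
    set f := cfc (fun u : ℝ => √(u + ε)) k with hf
    set g := cfc (fun u : ℝ => (√(u + ε))⁻¹) k with hg
    have hfs : star f = f := (IsSelfAdjoint.cfc).star_eq
    have hgs : star g = g := (IsSelfAdjoint.cfc).star_eq
    have hgf : g * f = 1 := by
      rw [hf, hg, ← cfc_mul _ _ _ hgc hfc, ← cfc_const_one ℝ k]
      exact cfc_congr fun u hu => inv_mul_cancel₀ (Real.sqrt_pos.2 (hsp u hu)).ne'
    have hff : (τ (f * f)).re = N + ε * (τ (1 : 𝓜)).re := by
      have : f * f = k + ε • (1 : 𝓜) := by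
        rw [hf, ← cfc_mul _ _ _ hfc hfc]
        have : k + ε • (1 : 𝓜) = cfc (fun u : ℝ => u + ε) k := by
          rw [cfc_add_const ε (fun u : ℝ => u) k (by fun_prop), cfc_id' ℝ k,
            Algebra.algebraMap_eq_smul_one]
        rw [this]
        exact cfc_congr fun u hu => Real.mul_self_sqrt (hsp u hu).le
      rw [this, map_add, Complex.add_re, trace_real_smul]
    have hgg : (τ (g * (k * k) * g)).re ≤ N := by
      have : g * (k * k) * g = cfc (fun u : ℝ => (√(u + ε))⁻¹ * (u * u) * (√(u + ε))⁻¹) k := by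
        rw [cfc_mul (fun u : ℝ => (√(u + ε))⁻¹ * (u * u)) _ k (hgc.mul (by fun_prop)) hgc,
          cfc_mul _ (fun u : ℝ => u * u) k hgc (by fun_prop),
          cfc_mul (fun u : ℝ => u) (fun u : ℝ => u) k (by fun_prop) (by fun_prop), cfc_id' ℝ k]
      rw [this, hN]
      conv_rhs => rw [← cfc_id' ℝ k]
      refine trace_re_mono (cfc_mono (fun u hu => ?_) ((hgc.mul (by fun_prop)).mul hgc)
        (by fun_prop))
      have h1 := hsp u hu
      have h0 := spectrum_nonneg_of_nonneg hk hu
      have h2 := Real.mul_self_sqrt h1.le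
      have : (√(u + ε))⁻¹ * (u * u) * (√(u + ε))⁻¹ = u * u / (u + ε) := by
        rw [div_eq_mul_inv, ← h2, mul_inv, h2]; ring
      rw [this, div_le_iff₀ h1]
      nlinarith
    have e1 : τ (a * x) = τ (f * (a * (x * g))) := by
      rw [hτ.tracial f, mul_assoc, mul_assoc, hgf, mul_one]
    have h1 : ‖τ (a * x)‖ ≤ ‖toL2 τ f‖ * (‖a‖ * ‖toL2 τ (x * g)‖) := by
      rw [e1]
      refine (norm_trace_mul_le _ _).trans ?_
      rw [hfs]
      gcongr
      exact norm_toL2_mul_le _ _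
    have h2 : ‖toL2 τ f‖ ^ 2 = N + ε * (τ (1 : 𝓜)).re := by rw [norm_toL2_sq, hfs, hff]
    have h3 : ‖toL2 τ (x * g)‖ ^ 2 ≤ N := by
      rw [norm_toL2_sq, star_mul, hgs, mul_assoc, ← mul_assoc (star x), ← hkk, ← mul_assoc]
      exact hgg
    calc ‖τ (a * x)‖ ^ 2 ≤ (‖toL2 τ f‖ * (‖a‖ * ‖toL2 τ (x * g)‖)) ^ 2 := by gcongr
      _ = ‖a‖ ^ 2 * (‖toL2 τ (x * g)‖ ^ 2 * ‖toL2 τ f‖ ^ 2) := by ring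
      _ ≤ _ := by rw [← h2]; gcongr
  have hlim : Tendsto (fun ε : ℝ => ‖a‖ ^ 2 * (N * (N + ε * (τ (1 : 𝓜)).re))) (𝓝[>] 0)
      (𝓝 ((‖a‖ * N) ^ 2)) := by
    have : Continuous fun ε : ℝ => ‖a‖ ^ 2 * (N * (N + ε * (τ (1 : 𝓜)).re)) := by fun_prop
    refine (this.tendsto' 0 _ ?_).mono_left nhdsWithin_le_nhds
    ring
  have h := ge_of_tendsto hlim (by filter_upwards [self_mem_nhdsWithin] with ε hε using key ε hε)
  exact (sq_le_sq₀ (norm_nonneg _) (by positivity)).1 h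

lemma trace_mul_im_eq_zero (hτ : IsNormalFaithfulFiniteTrace τ) {a b : 𝓜} (ha : IsSelfAdjoint a)
    (hb : IsSelfAdjoint b) : (τ (a * b)).im = 0 := by
  have := trace_star (τ := τ) (a * b)
  rw [star_mul, ha.star_eq, hb.star_eq, hτ.tracial] at this
  exact Complex.conj_eq_iff_im.1 this.symm

/-- The trace norm of `y + i z` dominates the trace norm of `y` and the trace of `z` jointly: the
self-adjoint contraction `R` with `τ(R y)` close to `‖y‖_1` and the scalars `c`, `s` give an element
`c R - i s` of norm at most `(c² + s²)^{1/2}`. -/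
theorem sq_trace_abs_add_sq_trace_le (hτ : IsNormalFaithfulFiniteTrace τ) {y z : 𝓜}
    (hy : IsSelfAdjoint y) (hz : IsSelfAdjoint z) :
    (τ (CFC.abs y)).re ^ 2 + (τ z).re ^ 2 ≤ (τ (CFC.abs (y + Complex.I • z))).re ^ 2 := by
  set N := (τ (CFC.abs (y + Complex.I • z))).re with hN
  have hN0 : 0 ≤ N := trace_abs_nonneg _
  have hone : ‖(1 : 𝓜)‖ ≤ 1 := (CStarAlgebra.norm_le_one_iff_of_nonneg _ zero_le_one).2 le_rfl
  have h1 : ∀ R : 𝓜, IsSelfAdjoint R → ‖R‖ ≤ 1 → ∀ c s : ℝ,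
      c * (τ (R * y)).re + s * (τ z).re ≤ √(c ^ 2 + s ^ 2) * N := by
    intro R hR hR1 c s
    set a : 𝓜 := c • R - ((s : ℂ) * Complex.I) • 1 with ha
    have hsa : star a * a = (c ^ 2) • (R * R) + (s ^ 2) • 1 := by
      have : star a = c • R + ((s : ℂ) * Complex.I) • 1 := by
        rw [ha, star_sub, star_smul, star_smul, hR.star_eq, star_one]
        simp
      rw [this, ha, add_mul, mul_sub, mul_sub]
      simp only [mul_one, one_mul, smul_mul_assoc, mul_smul_comm]
      have e : ((s : ℂ) * Complex.I) * ((s : ℂ) * Complex.I) = -((s ^ 2 : ℝ) : ℂ) := by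
        push_cast
        linear_combination ((s : ℂ) ^ 2) * Complex.I_mul_I
      rw [smul_comm _ c R, smul_smul c c, ← sq, smul_smul (s * Complex.I), e, neg_smul,
        Complex.coe_smul]
      abel
    have hna : ‖a‖ ≤ √(c ^ 2 + s ^ 2) := by
      refine Real.le_sqrt_of_sq_le ?_
      rw [sq, ← CStarRing.norm_star_mul_self, hsa]
      calc _ ≤ ‖(c ^ 2) • (R * R)‖ + ‖(s ^ 2) • (1 : 𝓜)‖ := norm_add_le _ _
        _ ≤ c ^ 2 * (1 * 1) + s ^ 2 * 1 := by
          rw [norm_smul, norm_smul, Real.norm_of_nonneg (sq_nonneg c),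
            Real.norm_of_nonneg (sq_nonneg s)]
          gcongr
          exact (norm_mul_le _ _).trans (by gcongr)
        _ = _ := by ring
    have h2 := norm_trace_mul_le_trace_abs hτ a (y + Complex.I • z)
    have h3 : (τ (a * (y + Complex.I • z))).re = c * (τ (R * y)).re + s * (τ z).re := by
      have hyi : (τ y).im = 0 := by simpa using trace_mul_im_eq_zero hτ (IsSelfAdjoint.one _) hy
      have hRz := trace_mul_im_eq_zero hτ hR hz
      rw [ha, sub_mul, mul_add, mul_add]
      simp only [smul_mul_assoc, mul_smul_comm, one_mul, map_sub, map_add, map_smul,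
        ← Complex.coe_smul c, smul_eq_mul]
      simp [hyi, hRz]
    rw [← h3]
    calc _ ≤ _ := Complex.re_le_norm _
      _ ≤ _ := h2
      _ ≤ _ := by gcongr
  have h2 : ∀ c s : ℝ, 0 ≤ c → c * (τ (CFC.abs y)).re + s * (τ z).re ≤ √(c ^ 2 + s ^ 2) * N := by
    intro c s hc
    have h3 : ∀ ε : ℝ, 0 < ε →
        c * ((τ (CFC.abs y)).re - ε * (τ (1 : 𝓜)).re) + s * (τ z).re ≤ √(c ^ 2 + s ^ 2) * N := by
      intro ε hε
      have hpos : ∀ u : ℝ, 0 < |u| + ε := fun u => by positivity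
      have hrc : Continuous fun u : ℝ => u / (|u| + ε) :=
        continuous_id.div (by fun_prop) fun u => (hpos u).ne'
      set R := cfc (fun u : ℝ => u / (|u| + ε)) y with hR
      have hR1 : ‖R‖ ≤ 1 := norm_cfc_le zero_le_one fun u _ => by
        rw [Real.norm_eq_abs, abs_div, abs_of_pos (hpos u), div_le_one (hpos u)]
        linarith
      refine le_trans ?_ (h1 R IsSelfAdjoint.cfc hR1 c s)
      gcongr
      have e1 : R * y = cfc (fun u : ℝ => u / (|u| + ε) * u) y := by
        rw [cfc_mul _ _ _ hrc.continuousOn (by fun_prop), cfc_id' ℝ y]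
      have e2 : (τ (CFC.abs y)).re - ε * (τ (1 : 𝓜)).re =
          (τ (cfc (fun u : ℝ => |u| - ε) y)).re := by
        rw [cfc_sub (fun u : ℝ => |u|) (fun _ => ε) y (by fun_prop) (by fun_prop), map_sub,
          Complex.sub_re, cfc_const ε y, Algebra.algebraMap_eq_smul_one, trace_real_smul,
          CFC.abs_eq_cfc_norm y hy]
        rfl
      rw [e1, e2]
      refine trace_re_mono (cfc_mono (fun u _ => ?_) (by fun_prop) (by fun_prop))
      rw [div_mul_eq_mul_div, le_div_iff₀ (hpos u), ← sq, ← sq_abs u]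
      nlinarith [abs_nonneg u]
    have hlim : Tendsto (fun ε : ℝ => c * ((τ (CFC.abs y)).re - ε * (τ (1 : 𝓜)).re) +
        s * (τ z).re) (𝓝[>] 0) (𝓝 (c * (τ (CFC.abs y)).re + s * (τ z).re)) := by
      have : Continuous fun ε : ℝ => c * ((τ (CFC.abs y)).re - ε * (τ (1 : 𝓜)).re) +
        s * (τ z).re := by fun_prop
      refine (this.tendsto' 0 _ ?_).mono_left nhdsWithin_le_nhds
      ring
    exact le_of_tendsto hlim (by filter_upwards [self_mem_nhdsWithin] with ε hε using h3 ε hε)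
  have h3 := h2 _ (τ z).re (trace_abs_nonneg (τ := τ) y)
  set r := √((τ (CFC.abs y)).re ^ 2 + (τ z).re ^ 2) with hr
  have hrr : r ^ 2 = (τ (CFC.abs y)).re ^ 2 + (τ z).re ^ 2 := Real.sq_sqrt (by positivity)
  rw [← hrr]
  have hr0 : 0 ≤ r := Real.sqrt_nonneg _
  have h4 : r * r ≤ r * N := by rw [← sq, hrr]; linarith
  rcases hr0.eq_or_lt with h | h
  · rw [← h]; nlinarith
  · have := le_of_mul_le_mul_left h4 h
    gcongr

/-- The `L_∞` norm is the dual norm of the `L_1` norm. -/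
theorem norm_le_of_norm_trace_mul_le (hτ : IsNormalFaithfulFiniteTrace τ) {z : 𝓜} {B : ℝ}
    (hB : 0 ≤ B) (h : ∀ y : 𝓜, (τ (star y * z)).re ≤ B * (τ (CFC.abs y)).re) : ‖z‖ ≤ B := by
  set k := CFC.abs z with hkdef
  have hk : 0 ≤ k := CFC.abs_nonneg z
  have hks := IsSelfAdjoint.of_nonneg hk
  have hkk : k * k = star z * z := CFC.abs_mul_abs z
  -- the inequality is applied to `z (|z| - B)₊`
  set c := cfc (fun u : ℝ => max (u - B) 0) k with hc
  have hmc : Continuous fun u : ℝ => max (u - B) 0 := by fun_prop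
  have hcs : star c = c := (IsSelfAdjoint.cfc).star_eq
  have e1 : c * k = cfc (fun u : ℝ => max (u - B) 0 * u) k := by
    rw [cfc_mul _ _ _ hmc.continuousOn (by fun_prop), cfc_id' ℝ k]
  have e2 : k * c = cfc (fun u : ℝ => u * max (u - B) 0) k := by
    rw [cfc_mul _ _ _ (by fun_prop) hmc.continuousOn, cfc_id' ℝ k]
  have hck : c * k = k * c := by rw [e1, e2]; simp only [mul_comm]
  have hpos : 0 ≤ k * c := by
    rw [e2]
    exact cfc_nonneg fun u hu => mul_nonneg (spectrum_nonneg_of_nonneg hk hu) (le_max_right _ _)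
  have habs : CFC.abs (z * c) = k * c := by
    refine abs_eq_of_mul_self_eq hpos ?_
    rw [star_mul, hcs, ← hck, mul_assoc, hck, ← mul_assoc k, hkk]
    simp only [mul_assoc]
  have h1 := h (z * c)
  rw [habs, star_mul, hcs, mul_assoc, ← hkk, ← mul_assoc, e1, e2] at h1
  have e3 : cfc (fun u : ℝ => max (u - B) 0 * u) k * k =
      cfc (fun u : ℝ => max (u - B) 0 * u * u) k := by
    rw [cfc_mul (fun u : ℝ => max (u - B) 0 * u) (fun u : ℝ => u) k (by fun_prop) (by fun_prop),
      cfc_id' ℝ k]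
  have h2 : (τ (cfc (fun u : ℝ => max (u - B) 0 * u * u - B * (u * max (u - B) 0)) k)).re ≤ 0 := by
    rw [cfc_sub _ _ _ (by fun_prop) (by fun_prop), cfc_const_mul _ _ _ (by fun_prop), map_sub,
      Complex.sub_re, trace_real_smul, ← e3]
    linarith
  have h3 := eq_zero_of_trace_re_eq_zero hτ (cfc_nonneg fun u hu => ?_) h2
  · rw [← cfc_const_zero ℝ k] at h3
    have h4 := eqOn_of_cfc_eq_cfc h3 (by fun_prop) continuousOn_const hks
    rw [← CFC.norm_abs, ← hkdef, ← cfc_id' ℝ k hks]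
    refine norm_cfc_le hB fun u hu => ?_
    have h0 := spectrum_nonneg_of_nonneg hk hu
    rw [Real.norm_of_nonneg h0]
    by_contra! hlt
    have h5 := h4 hu
    simp only [max_eq_left (sub_pos.2 hlt).le] at h5
    have h6 : 0 < u := hB.trans_lt hlt
    have : 0 < (u - B) * (u - B) * u := by have := sub_pos.2 hlt; positivity
    linarith
  · have h0 := spectrum_nonneg_of_nonneg hk hu
    rcases le_total u B with hu' | hu'
    · rw [max_eq_right (by linarith)]; simp
    · rw [max_eq_left (by linarith)]
      have : 0 ≤ (u - B) * (u - B) * u := mul_nonneg (mul_self_nonneg _) h0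
      linarith

end LOne

/-! ### From `L_2 → L_∞` on positive elements to `L_1 → L_∞` -/

section Duality

variable {𝓜 : Type*} [CStarAlgebra 𝓜] [PartialOrder 𝓜] [StarOrderedRing 𝓜] {τ : 𝓜 →ₚ[ℂ] ℂ}
  {T : ℝ → 𝓜 →ₗ[ℂ] 𝓜} {t K : ℝ}

/-- `‖T_t h‖_2² = τ(h T_t(T_t h)) ≤ ‖h‖_1 ‖T_t(T_t h)‖_∞ ≤ K ‖h‖_1 ‖T_t h‖_2`. -/
lemma norm_toL2_apply_le_of_nonneg (hτ : IsNormalFaithfulFiniteTrace τ)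
    (hT : IsSymmetricPositiveContractionSemigroup τ T) (ht : 0 < t)
    (hK : ∀ x, 0 ≤ x → ‖T t x‖ ≤ K * ‖toL2 τ x‖) {h : 𝓜} (hh : 0 ≤ h) :
    ‖toL2 τ (T t h)‖ ≤ K * (τ h).re := by
  have h1 : ‖toL2 τ (T t h)‖ ^ 2 ≤ (τ h).re * (K * ‖toL2 τ (T t h)‖) := by
    rw [hT.norm_toL2_sq_eq ht, inner_toL2, (IsSelfAdjoint.of_nonneg hh).star_eq,
      hT.semigroup t t ht ht]
    refine (Complex.re_le_norm _).trans ((norm_trace_mul_le_of_nonneg hτ hh _).trans ?_)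
    have := trace_re_nonneg (τ := τ) hh
    gcongr
    exact hK _ (hT.positive t ht h hh)
  rcases (norm_nonneg (toL2 τ (T t h))).eq_or_lt with h0 | h0
  · rw [← h0]
    rcases eq_or_ne h 0 with rfl | hne
    · simp
    · have h2 : 0 < ‖toL2 τ h‖ := norm_pos_iff.2 fun h' => hne (toL2_eq_zero hτ h')
      have h3 := (norm_nonneg _).trans (hK h hh)
      exact mul_nonneg (nonneg_of_mul_nonneg_left h3 h2) (trace_re_nonneg hh)
  · refine le_of_mul_le_mul_right ?_ h0
    rw [← sq]; linarith

/-- The positive and negative parts `y⁺`, `y⁻` are mapped to positive elements, whose inner product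
is nonnegative, and `τ(y⁺)² + τ(y⁻)² = (‖y‖_1² + τ(y)²) / 2`. -/
lemma sq_norm_toL2_apply_le_of_isSelfAdjoint (hτ : IsNormalFaithfulFiniteTrace τ)
    (hT : IsSymmetricPositiveContractionSemigroup τ T) (ht : 0 < t)
    (hK : ∀ x, 0 ≤ x → ‖T t x‖ ≤ K * ‖toL2 τ x‖) {y : 𝓜} (hy : IsSelfAdjoint y) :
    ‖toL2 τ (T t y)‖ ^ 2 ≤ K ^ 2 * (((τ (CFC.abs y)).re ^ 2 + (τ y).re ^ 2) / 2) := by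
  have hp := CFC.posPart_nonneg y
  have hn := CFC.negPart_nonneg y
  have h1 := norm_toL2_apply_le_of_nonneg hτ hT ht hK hp
  have h2 := norm_toL2_apply_le_of_nonneg hτ hT ht hK hn
  have hTp := hT.positive t ht _ hp
  have hTn := hT.positive t ht _ hn
  have e1 : (τ (CFC.abs y)).re = (τ y⁺).re + (τ y⁻).re := by
    rw [← CFC.posPart_add_negPart y hy, map_add, Complex.add_re]
  have e2 : (τ y).re = (τ y⁺).re - (τ y⁻).re := by
    conv_lhs => rw [← CFC.posPart_sub_negPart y hy]
    rw [map_sub, Complex.sub_re]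
  have e3 : toL2 τ (T t y) = toL2 τ (T t y⁺) - toL2 τ (T t y⁻) := by
    conv_lhs => rw [← CFC.posPart_sub_negPart y hy]
    rw [map_sub, toL2_sub]
  have h3 := norm_toL2_sub_sq hτ (IsSelfAdjoint.of_nonneg hTp) (IsSelfAdjoint.of_nonneg hTn)
  have h4 := trace_mul_nonneg hτ hTp hTn
  have h5 := norm_toL2_sq (τ := τ) (T t y⁺)
  have h6 := norm_toL2_sq (τ := τ) (T t y⁻)
  rw [(IsSelfAdjoint.of_nonneg hTp).star_eq] at h5
  rw [(IsSelfAdjoint.of_nonneg hTn).star_eq] at h6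
  have h7 := pow_le_pow_left₀ (norm_nonneg _) h1 2
  have h8 := pow_le_pow_left₀ (norm_nonneg _) h2 2
  rw [e3, h3, e1, e2]
  nlinarith

/-- The bound `L_1 → L_2`, with the constant of the positive elements. For `x = y + i z` the bounds
for `y` and `z` add up to half the sum of `‖y‖_1² + τ(z)²` and `‖z‖_1² + τ(y)²`, each of which is at
most `‖x‖_1²`. -/
theorem norm_toL2_apply_le (hτ : IsNormalFaithfulFiniteTrace τ)
    (hT : IsSymmetricPositiveContractionSemigroup τ T) (ht : 0 < t) (hK0 : 0 ≤ K)
    (hK : ∀ x, 0 ≤ x → ‖T t x‖ ≤ K * ‖toL2 τ x‖) (x : 𝓜) :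
    ‖toL2 τ (T t x)‖ ≤ K * (τ (CFC.abs x)).re := by
  obtain ⟨y, z, hy, hz, rfl⟩ : ∃ y z : 𝓜, IsSelfAdjoint y ∧ IsSelfAdjoint z ∧
      x = y + Complex.I • z :=
    ⟨_, _, (realPart x).2, (imaginaryPart x).2, (realPart_add_I_smul_imaginaryPart x).symm⟩
  have h1 := sq_norm_toL2_apply_le_of_isSelfAdjoint hτ hT ht hK hy
  have h2 := sq_norm_toL2_apply_le_of_isSelfAdjoint hτ hT ht hK hz
  have h3 := sq_trace_abs_add_sq_trace_le hτ hy hz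
  have h4 := sq_trace_abs_add_sq_trace_le hτ hz hy.neg
  -- `-i x = z - i y` exchanges the roles of `y` and `z`
  have e1 : z + Complex.I • -y = (-Complex.I) • (y + Complex.I • z) := by
    rw [smul_add, smul_smul, neg_mul, Complex.I_mul_I, neg_neg, one_smul, smul_neg, neg_smul,
      add_comm]
  rw [e1, CFC.abs_smul, norm_neg, Complex.norm_I, one_smul, map_neg, Complex.neg_re, neg_sq] at h4
  have h5 : ‖toL2 τ (T t (y + Complex.I • z))‖ ^ 2 =
      ‖toL2 τ (T t y)‖ ^ 2 + ‖toL2 τ (T t z)‖ ^ 2 := by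
    have h := trace_mul_im_eq_zero hτ (hT.isSelfAdjoint ht hy) (hT.isSelfAdjoint ht hz)
    rw [map_add, map_smul, toL2_add, toL2_smul, norm_add_sq (𝕜 := ℂ), inner_smul_right, inner_toL2,
      (hT.isSelfAdjoint ht hy).star_eq, norm_smul, Complex.norm_I, one_mul]
    simp [h]
  refine (sq_le_sq₀ (norm_nonneg _) (mul_nonneg hK0 (trace_abs_nonneg _))).1 ?_
  rw [h5, mul_pow]
  nlinarith [sq_nonneg K]

/-- If `T_t` has norm at most `K` from the positive cone of `L_2` to `L_∞`, then `T_{2t}` has norm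
at most `K²` from `L_1` to `L_∞`. -/
theorem opNormOneTop_le (hτ : IsNormalFaithfulFiniteTrace τ)
    (hT : IsSymmetricPositiveContractionSemigroup τ T) (ht : 0 < t) (hK0 : 0 ≤ K)
    (hK : ∀ x, 0 ≤ x → ‖T t x‖ ≤ K * ‖toL2 τ x‖) :
    opNormOneTop τ (T (2 * t)) ≤ ENNReal.ofReal (K ^ 2) := by
  refine iSup₂_le fun x hx => ENNReal.ofReal_le_ofReal ?_
  rw [lpNorm_one] at hx
  refine norm_le_of_norm_trace_mul_le hτ (sq_nonneg K) fun y => ?_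
  have h1 : τ (star y * T (2 * t) x) = ⟪toL2 τ (T t y), toL2 τ (T t x)⟫_ℂ := by
    rw [two_mul, hT.semigroup t t ht ht, ← inner_toL2, hT.inner_comm ht]
  have hx' := norm_toL2_apply_le hτ hT ht hK0 hK x
  have hy' := norm_toL2_apply_le hτ hT ht hK0 hK y
  have hy0 := trace_abs_nonneg (τ := τ) y
  calc (τ (star y * T (2 * t) x)).re ≤ ‖toL2 τ (T t y)‖ * ‖toL2 τ (T t x)‖ := by
        rw [h1]; exact re_inner_le_norm (𝕜 := ℂ) _ _
    _ ≤ (K * (τ (CFC.abs y)).re) * (K * 1) := by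
        gcongr
        exact hx'.trans (by gcongr)
    _ = _ := by ring

/-- The logarithmic Sobolev inequality implies ultracontractivity. -/
theorem LogSobolev.opNormOneTop_le {M : ℝ → ℝ} {C : ℝ} (hτ : IsNormalFaithfulFiniteTrace τ)
    (hT : IsSymmetricPositiveContractionSemigroup τ T) (hLS : LogSobolev τ T M C) (ht : 0 < t)
    (hM : IntervalIntegrable M volume 0 t) :
    opNormOneTop τ (T (2 * t)) ≤ ENNReal.ofReal (Real.exp (averaged C M t)) := by
  refine (UltraLogSobolev.opNormOneTop_le hτ hT ht (Real.exp_pos _).le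
    fun x hx => norm_apply_le_of_nonneg hτ hT hLS hx ht hM).trans_eq ?_
  rw [← Real.exp_nat_mul, averaged]
  congr 2
  push_cast
  ring

end Duality

/-! ### From ultracontractivity to the logarithmic Sobolev inequality -/

section Ultracontractive

variable {𝓜 : Type*} [CStarAlgebra 𝓜] [PartialOrder 𝓜] [StarOrderedRing 𝓜] {τ : 𝓜 →ₚ[ℂ] ℂ}
  {T : ℝ → 𝓜 →ₗ[ℂ] 𝓜}

/-- The Cauchy–Schwarz inequality `‖x y‖_1 ≤ ‖x‖_2 ‖y‖_2`. The contraction `w = v (|v| + ε)⁻¹`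
approximates the polar part of `v = x y`, and `τ(w^* v)` approximates `‖v‖_1`. -/
theorem trace_abs_mul_le (hτ : IsNormalFaithfulFiniteTrace τ) (x y : 𝓜) :
    (τ (CFC.abs (x * y))).re ≤ ‖toL2 τ x‖ * ‖toL2 τ y‖ := by
  set v := x * y with hv
  set k := CFC.abs v with hkdef
  have hk : 0 ≤ k := CFC.abs_nonneg v
  have hks := IsSelfAdjoint.of_nonneg hk
  have hkk : k * k = star v * v := CFC.abs_mul_abs v
  have key : ∀ ε : ℝ, 0 < ε →
      (τ k).re - ε * (τ (1 : 𝓜)).re ≤ ‖toL2 τ x‖ * ‖toL2 τ y‖ := by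
    intro ε hε
    have hsp : ∀ u ∈ spectrum ℝ k, 0 < u + ε := fun u hu => by
      have := spectrum_nonneg_of_nonneg hk hu; linarith
    have hgc : ContinuousOn (fun u : ℝ => (u + ε)⁻¹) (spectrum ℝ k) :=
      ContinuousOn.inv₀ (by fun_prop) fun u hu => (hsp u hu).ne'
    set g := cfc (fun u : ℝ => (u + ε)⁻¹) k with hg
    have hgs : star g = g := (IsSelfAdjoint.cfc).star_eq
    have e1 : g * (k * k) = cfc (fun u : ℝ => (u + ε)⁻¹ * (u * u)) k := by
      rw [cfc_mul _ (fun u : ℝ => u * u) k hgc (by fun_prop),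
        cfc_mul (fun u : ℝ => u) (fun u : ℝ => u) k (by fun_prop) (by fun_prop), cfc_id' ℝ k]
    have e2 : g * (k * k) * g = cfc (fun u : ℝ => (u + ε)⁻¹ * (u * u) * (u + ε)⁻¹) k := by
      rw [cfc_mul (fun u : ℝ => (u + ε)⁻¹ * (u * u)) _ k (hgc.mul (by fun_prop)) hgc, e1]
    have hw : ‖v * g‖ ≤ 1 := by
      rw [← sq_le_one_iff₀ (norm_nonneg _), sq, ← CStarRing.norm_star_mul_self, star_mul, hgs,
        mul_assoc, ← mul_assoc (star v), ← hkk, ← mul_assoc, e2]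
      refine norm_cfc_le zero_le_one fun u hu => ?_
      have h0 := spectrum_nonneg_of_nonneg hk hu
      have h1 := hsp u hu
      rw [Real.norm_of_nonneg (by positivity), mul_right_comm, ← mul_inv, inv_mul_eq_div,
        div_le_one (by positivity)]
      nlinarith
    have h1 : (τ k).re - ε * (τ (1 : 𝓜)).re ≤ (τ (g * (k * k))).re := by
      have : (τ k).re - ε * (τ (1 : 𝓜)).re = (τ (cfc (fun u : ℝ => u - ε) k)).re := by
        rw [cfc_sub (fun u : ℝ => u) (fun _ => ε) k (by fun_prop) (by fun_prop), map_sub,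
          Complex.sub_re, cfc_const ε k, Algebra.algebraMap_eq_smul_one, trace_real_smul,
          cfc_id' ℝ k]
      rw [this, e1]
      refine trace_re_mono (cfc_mono (fun u hu => ?_) (by fun_prop) (hgc.mul (by fun_prop)))
      rw [inv_mul_eq_div, le_div_iff₀ (hsp u hu)]
      nlinarith
    have h2 : τ (g * (k * k)) = τ (g * star v * x * y) := by
      rw [hkk, hv]; simp only [mul_assoc]
    rw [h2] at h1
    have h3 : star (g * star v * x) = star x * (v * g) := by
      rw [star_mul, star_mul, star_star, hgs]
    have h4 : ‖toL2 τ (star x * (v * g))‖ ≤ ‖toL2 τ x‖ := by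
      rw [← norm_toL2_star hτ, star_mul, star_star]
      refine (norm_toL2_mul_le _ _).trans ?_
      rw [norm_star]
      exact mul_le_of_le_one_left (norm_nonneg _) hw
    calc _ ≤ _ := h1
      _ ≤ _ := Complex.re_le_norm _
      _ ≤ _ := norm_trace_mul_le _ _
      _ ≤ _ := by rw [h3]; gcongr
  have hlim : Tendsto (fun ε : ℝ => (τ k).re - ε * (τ (1 : 𝓜)).re) (𝓝[>] 0) (𝓝 (τ k).re) := by
    have : Continuous fun ε : ℝ => (τ k).re - ε * (τ (1 : 𝓜)).re := by fun_prop
    refine (this.tendsto' 0 _ ?_).mono_left nhdsWithin_le_nhds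
    ring
  exact le_of_tendsto hlim (by filter_upwards [self_mem_nhdsWithin] with ε hε using key ε hε)

lemma norm_apply_le_of_opNormOneTop_le (hτ : IsNormalFaithfulFiniteTrace τ) {S : 𝓜 →ₗ[ℂ] 𝓜} {B : ℝ}
    (hB : 0 ≤ B) (hS : opNormOneTop τ S ≤ ENNReal.ofReal B) (x : 𝓜) :
    ‖S x‖ ≤ B * (τ (CFC.abs x)).re := by
  rcases (trace_abs_nonneg (τ := τ) x).eq_or_lt with h | h
  · have h1 := eq_zero_of_trace_re_eq_zero hτ (CFC.abs_nonneg x) h.ge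
    rw [CFC.abs_eq_zero_iff] at h1
    simp [h1, CFC.abs_zero]
  · set N := (τ (CFC.abs x)).re with hN
    have h1 : lpNorm τ 1 (N⁻¹ • x) ≤ 1 := by
      rw [lpNorm_one, CFC.abs_smul, Real.norm_of_nonneg (inv_nonneg.2 h.le), trace_real_smul,
        inv_mul_cancel₀ h.ne']
    have h2 := (le_iSup₂ (f := fun (x : 𝓜) (_ : lpNorm τ 1 x ≤ 1) => ENNReal.ofReal ‖S x‖) _
      h1).trans hS
    rw [ENNReal.ofReal_le_ofReal_iff hB, ← Complex.coe_smul, map_smul, norm_smul,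
      Complex.norm_real, Real.norm_of_nonneg (inv_nonneg.2 h.le), inv_mul_le_iff₀ h] at h2
    rwa [mul_comm]

/-- A bound `b²` of `T_{2t}` from `L_1` to `L_∞` gives the bound `b` of `T_t` from `L_1` to
`L_2`. -/
lemma norm_toL2_apply_le_of_opNormOneTop_le (hτ : IsNormalFaithfulFiniteTrace τ)
    (hT : IsSymmetricPositiveContractionSemigroup τ T) {t b : ℝ} (ht : 0 < t) (hb : 0 ≤ b)
    (hS : opNormOneTop τ (T (t + t)) ≤ ENNReal.ofReal (b ^ 2)) (v : 𝓜) :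
    ‖toL2 τ (T t v)‖ ≤ b * (τ (CFC.abs v)).re := by
  have h1 := norm_apply_le_of_opNormOneTop_le hτ (sq_nonneg b) hS v
  have h2 := norm_trace_mul_le_trace_abs hτ (star (T (t + t) v)) v
  have h0 := trace_abs_nonneg (τ := τ) v
  refine (sq_le_sq₀ (norm_nonneg _) (by positivity)).1 ?_
  calc ‖toL2 τ (T t v)‖ ^ 2 = (⟪toL2 τ v, toL2 τ (T (t + t) v)⟫_ℂ).re := hT.norm_toL2_sq_eq ht v
    _ ≤ ‖⟪toL2 τ v, toL2 τ (T (t + t) v)⟫_ℂ‖ := Complex.re_le_norm _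
    _ = ‖τ (star (T (t + t) v) * v)‖ := by rw [norm_inner_symm, inner_toL2]
    _ ≤ ‖T (t + t) v‖ * (τ (CFC.abs v)).re := by rwa [norm_star] at h2
    _ ≤ b ^ 2 * (τ (CFC.abs v)).re * (τ (CFC.abs v)).re := by gcongr
    _ = _ := by ring

lemma gnsStarAlgHom_toL2 (a x : 𝓜) : τ.gnsStarAlgHom a (toL2 τ x) = toL2 τ (a * x) :=
  τ.gnsNonUnitalStarAlgHom_apply_coe

lemma gnsStarAlgHom_nonneg {a : 𝓜} (ha : 0 ≤ a) : 0 ≤ τ.gnsStarAlgHom a := map_nonneg _ ha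

/-- If `T_t π(x)` has norm at most `b` on `L_2`, where `π(x)` is the left multiplication by `x`,
then `T_{2t} ≤ π((b + δ)² (x + δ)⁻²)`: conjugate `(T_t π(x + δ))^* T_t π(x + δ) ≤ (b + δ)²` by
`π((x + δ)⁻¹)`. -/
lemma semigroupL2_two_mul_le (hT : IsSymmetricPositiveContractionSemigroup τ T) {x : 𝓜}
    (hx : 0 ≤ x) {t b δ : ℝ} (ht : 0 < t) (hb0 : 0 ≤ b) (hδ : 0 < δ)
    (hb : ∀ y, ‖toL2 τ (T t (x * y))‖ ≤ b * ‖toL2 τ y‖) :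
    semigroupL2 hT (t + t) ≤
      τ.gnsStarAlgHom (cfc (fun u : ℝ => ((b + δ) / (u + δ)) ^ 2) x) := by
  have hsp : ∀ u ∈ spectrum ℝ x, 0 < u + δ := fun u hu => by
    have := spectrum_nonneg_of_nonneg hx hu; linarith
  have hgc : ContinuousOn (fun u : ℝ => (u + δ)⁻¹) (spectrum ℝ x) :=
    ContinuousOn.inv₀ (by fun_prop) fun u hu => (hsp u hu).ne'
  set B := semigroupL2 hT t with hB
  set k := x + δ • (1 : 𝓜) with hk
  set g := cfc (fun u : ℝ => (u + δ)⁻¹) x with hg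
  have hkc : k = cfc (fun u : ℝ => u + δ) x := by
    rw [cfc_add_const δ (fun u : ℝ => u) x (by fun_prop), cfc_id' ℝ x,
      Algebra.algebraMap_eq_smul_one]
  have hgs : star g = g := (IsSelfAdjoint.cfc).star_eq
  have hkg : k * g = 1 := by
    rw [hkc, hg, ← cfc_mul _ _ _ (by fun_prop) hgc, ← cfc_const_one ℝ x]
    exact cfc_congr fun u hu => mul_inv_cancel₀ (hsp u hu).ne'
  have hnorm : ‖B * τ.gnsStarAlgHom k‖ ≤ b + δ := by
    refine ContinuousLinearMap.opNorm_le_bound _ (by positivity) fun ξ => ?_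
    induction ξ using denseRange_toL2.induction_on with
    | hp => exact isClosed_le (by fun_prop) (by fun_prop)
    | ih y =>
      have h1 := norm_semigroupL2_apply_le hT t (δ • toL2 τ y)
      rw [mul_apply_eq_comp, gnsStarAlgHom_toL2, hk, add_mul, smul_mul_assoc, one_mul, toL2_add,
        toL2_real_smul, map_add, add_mul, hB, semigroupL2_toL2 hT ht]
      refine (norm_add_le _ _).trans (add_le_add (hb y) (h1.trans_eq ?_))
      rw [norm_smul, Real.norm_of_nonneg hδ.le]
  have hBs : star B = B := (isSelfAdjoint_semigroupL2 hT t).star_eq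
  have hπg : star (τ.gnsStarAlgHom g) = τ.gnsStarAlgHom g := by rw [← map_star, hgs]
  have hBB : semigroupL2 hT (t + t) = star (τ.gnsStarAlgHom g) *
      (star (B * τ.gnsStarAlgHom k) * (B * τ.gnsStarAlgHom k)) * τ.gnsStarAlgHom g := by
    have h1 : B * τ.gnsStarAlgHom k * τ.gnsStarAlgHom g = B := by
      rw [mul_assoc, ← map_mul, hkg, map_one, mul_one]
    have h2 : star (τ.gnsStarAlgHom g) * star (B * τ.gnsStarAlgHom k) = B := by
      rw [← star_mul, h1, hBs]
    rw [← mul_assoc, h2, mul_assoc, h1, semigroupL2_add hT ht.le ht.le]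
  have h1 : star (B * τ.gnsStarAlgHom k) * (B * τ.gnsStarAlgHom k) ≤
      ((b + δ) ^ 2) • (1 : L2 τ →L[ℂ] L2 τ) := by
    rw [← Algebra.algebraMap_eq_smul_one]
    refine (IsSelfAdjoint.star_mul_self _).le_algebraMap_norm_self.trans ?_
    rw [CStarRing.norm_star_mul_self, ← sq]
    exact algebraMap_mono _ (by gcongr)
  have h2 : τ.gnsStarAlgHom (cfc (fun u : ℝ => ((b + δ) / (u + δ)) ^ 2) x) =
      star (τ.gnsStarAlgHom g) * (((b + δ) ^ 2) • (1 : L2 τ →L[ℂ] L2 τ)) *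
        τ.gnsStarAlgHom g := by
    have : cfc (fun u : ℝ => ((b + δ) / (u + δ)) ^ 2) x = ((b + δ) ^ 2) • (g * g) := by
      rw [hg, ← cfc_mul _ _ _ hgc hgc,
        ← cfc_const_mul _ (fun u : ℝ => (u + δ)⁻¹ * (u + δ)⁻¹) _ (hgc.mul hgc)]
      refine cfc_congr fun u _ => ?_
      simp only [div_eq_mul_inv]
      ring
    rw [this, hπg, mul_smul_comm, mul_one, smul_mul_assoc, ← map_mul, ← Complex.coe_smul, map_smul,
      Complex.coe_smul]
  rw [hBB, h2]
  exact star_left_conjugate_le_conjugate h1 _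

/-- The Löwner–Heinz inequality turns the bound on `T_{2t}` into one on every `T_{th}`,
`0 < h ≤ 2`. -/
lemma semigroupL2_mul_le (hτ : IsNormalFaithfulFiniteTrace τ)
    (hT : IsSymmetricPositiveContractionSemigroup τ T) {x : 𝓜}
    (hx : 0 ≤ x) {t b δ : ℝ} (ht : 0 < t) (hb0 : 0 ≤ b) (hδ : 0 < δ)
    (hb : ∀ y, ‖toL2 τ (T t (x * y))‖ ≤ b * ‖toL2 τ y‖) {h : ℝ} (hh : 0 < h) (hh2 : h ≤ 2) :
    semigroupL2 hT (t * h) ≤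
      τ.gnsStarAlgHom (cfc (fun u : ℝ => ((b + δ) / (u + δ)) ^ h) x) := by
  have hsp : ∀ u ∈ spectrum ℝ x, 0 < u + δ := fun u hu => by
    have := spectrum_nonneg_of_nonneg hx hu; linarith
  have hqc : ContinuousOn (fun u : ℝ => ((b + δ) / (u + δ)) ^ 2) (spectrum ℝ x) :=
    (ContinuousOn.div (by fun_prop) (by fun_prop) fun u hu => (hsp u hu).ne').pow 2
  have hpc : Continuous fun u : ℝ => u ^ (h / 2) := continuous_rpow (by linarith)
  have h1 := CFC.rpow_le_rpow (p := h / 2) ⟨by linarith, by linarith⟩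
    (semigroupL2_two_mul_le hT hx ht hb0 hδ hb)
  have hq : 0 ≤ cfc (fun u : ℝ => ((b + δ) / (u + δ)) ^ 2) x :=
    cfc_nonneg fun u _ => sq_nonneg _
  rw [CFC.rpow_eq_cfc_real (semigroupL2_nonneg hT _),
    CFC.rpow_eq_cfc_real (gnsStarAlgHom_nonneg hq)] at h1
  have e1 : cfc (fun u : ℝ => u ^ (h / 2)) (semigroupL2 hT (t + t)) = semigroupL2 hT (t * h) := by
    rw [semigroupL2_eq_cfc hT hτ (add_pos ht ht), semigroupL2_eq_cfc hT hτ (mul_pos ht hh),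
      ← cfc_comp' _ _ _ hpc.continuousOn (continuous_rpow (by positivity)).continuousOn
        (IsSelfAdjoint.of_nonneg (semigroupL2_nonneg hT 1))]
    refine cfc_congr fun u hu => ?_
    have := (spectrum_semigroupL2 hT 1 hu).1
    rw [← Real.rpow_mul this]
    congr 1; ring
  have e2 : cfc (fun u : ℝ => u ^ (h / 2))
      (τ.gnsStarAlgHom (cfc (fun u : ℝ => ((b + δ) / (u + δ)) ^ 2) x)) =
      τ.gnsStarAlgHom (cfc (fun u : ℝ => ((b + δ) / (u + δ)) ^ h) x) := by
    rw [← StarAlgHomClass.map_cfc (S := ℂ) τ.gnsStarAlgHom _ _ hpc.continuousOn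
      (map_continuous τ.gnsStarAlgHom) (IsSelfAdjoint.of_nonneg hq)
      (IsSelfAdjoint.of_nonneg (gnsStarAlgHom_nonneg hq)),
      ← cfc_comp' _ _ _ hpc.continuousOn hqc (IsSelfAdjoint.of_nonneg hx)]
    congr 1
    refine cfc_congr fun u hu => ?_
    have : 0 ≤ (b + δ) / (u + δ) := div_nonneg (by linarith) (hsp u hu).le
    rw [← Real.rpow_natCast, ← Real.rpow_mul this]
    congr 1; push_cast; ring
  rwa [e1, e2] at h1

/-- The derivative at `h = 0` of the bound on `⟨x, T_{th} x⟩`. -/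
lemma trace_sq_mul_log_add_le (hτ : IsNormalFaithfulFiniteTrace τ)
    (hT : IsSymmetricPositiveContractionSemigroup τ T) {x : 𝓜} (hx : 0 ≤ x) {Lx : L2 τ}
    (hLx : IsGeneratorAt τ T x Lx) {t b δ : ℝ} (ht : 0 < t) (hb0 : 0 ≤ b) (hδ : 0 < δ)
    (hb : ∀ y, ‖toL2 τ (T t (x * y))‖ ≤ b * ‖toL2 τ y‖) :
    (τ (cfc (fun u : ℝ => u ^ 2 * Real.log (u + δ)) x)).re ≤
      t * (⟪toL2 τ x, Lx⟫_ℂ).re + Real.log (b + δ) * ‖toL2 τ x‖ ^ 2 := by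
  have hxs := IsSelfAdjoint.of_nonneg hx
  have hsp : ∀ u ∈ spectrum ℝ x, 0 < u + δ := fun u hu => by
    have := spectrum_nonneg_of_nonneg hx hu; linarith
  have hbδ : 0 < b + δ := by linarith
  have hqpos : ∀ u ∈ spectrum ℝ x, 0 < (b + δ) / (u + δ) := fun u hu => div_pos hbδ (hsp u hu)
  have hqc : ContinuousOn (fun u : ℝ => (b + δ) / (u + δ)) (spectrum ℝ x) :=
    ContinuousOn.div (by fun_prop) (by fun_prop) fun u hu => (hsp u hu).ne'
  have hlc : ContinuousOn (fun u : ℝ => Real.log ((b + δ) / (u + δ))) (spectrum ℝ x) :=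
    hqc.log fun u hu => (hqpos u hu).ne'
  have hsq : ContinuousOn (fun u : ℝ => u ^ 2) (spectrum ℝ x) := by fun_prop
  have hsl : ContinuousOn (fun u : ℝ => u ^ 2 * Real.log ((b + δ) / (u + δ))) (spectrum ℝ x) :=
    hsq.mul hlc
  have hsl' : ContinuousOn (fun u : ℝ => u ^ 2 * Real.log (u + δ)) (spectrum ℝ x) :=
    hsq.mul (ContinuousOn.log (by fun_prop) fun u hu => (hsp u hu).ne')
  obtain ⟨K₀, hK₀⟩ := (spectrum.isCompact x).exists_bound_of_continuousOn hlc
  set K := max K₀ 1 with hKdef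
  have hK1 : 1 ≤ K := le_max_right _ _
  have hK : ∀ u ∈ spectrum ℝ x, |Real.log ((b + δ) / (u + δ))| ≤ K := fun u hu =>
    (hK₀ u hu).trans (le_max_left _ _)
  have hn : ‖toL2 τ x‖ ^ 2 = (τ (cfc (fun u : ℝ => u ^ 2) x)).re := by
    rw [norm_toL2_sq, hxs.star_eq, ← sq, cfc_pow_id (R := ℝ) x 2]
  set W := (τ (cfc (fun u : ℝ => u ^ 2 * Real.log ((b + δ) / (u + δ))) x)).re with hW
  have hWeq : W = Real.log (b + δ) * ‖toL2 τ x‖ ^ 2 -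
      (τ (cfc (fun u : ℝ => u ^ 2 * Real.log (u + δ)) x)).re := by
    rw [hn, ← trace_real_smul, ← Complex.sub_re, ← map_sub, ← cfc_const_mul _ _ _ hsq,
      ← cfc_sub (fun u : ℝ => Real.log (b + δ) * u ^ 2) (fun u : ℝ => u ^ 2 * Real.log (u + δ)) x
        (hsq.const_mul _) hsl', hW]
    congr 2
    refine cfc_congr fun u hu => ?_
    simp only [Real.log_div hbδ.ne' (hsp u hu).ne']
    ring
  have hmain : ∀ h : ℝ, 0 < h → h ≤ K⁻¹ →
      (⟪toL2 τ x, toL2 τ (T (t * h) x)⟫_ℂ).re ≤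
        ‖toL2 τ x‖ ^ 2 + h * W + (h * K) ^ 2 * ‖toL2 τ x‖ ^ 2 := by
    intro h hh hhK
    have hh1 : h ≤ 2 := hhK.trans ((inv_le_one_of_one_le₀ hK1).trans one_le_two)
    have hhK1 : h * K ≤ 1 := by
      calc h * K ≤ K⁻¹ * K := by gcongr
        _ = 1 := inv_mul_cancel₀ (by linarith)
    have h1 := ((ContinuousLinearMap.le_def _ _).1
      (semigroupL2_mul_le hτ hT hx ht hb0 hδ hb hh hh1)).re_inner_nonneg_right (toL2 τ x)
    rw [sub_apply, inner_sub_right, semigroupL2_toL2 hT (by positivity), gnsStarAlgHom_toL2,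
      map_sub, sub_nonneg] at h1
    refine h1.trans ?_
    have hrc : ContinuousOn (fun u : ℝ => ((b + δ) / (u + δ)) ^ h) (spectrum ℝ x) :=
      hqc.rpow_const fun u hu => Or.inl (hqpos u hu).ne'
    have e1 : x * (cfc (fun u : ℝ => ((b + δ) / (u + δ)) ^ h) x * x) =
        cfc (fun u : ℝ => u * (((b + δ) / (u + δ)) ^ h * u)) x := by
      rw [cfc_mul (fun u : ℝ => u) (fun u : ℝ => ((b + δ) / (u + δ)) ^ h * u) x (by fun_prop)
          (hrc.mul (by fun_prop)),
        cfc_mul _ (fun u : ℝ => u) x hrc (by fun_prop), cfc_id' ℝ x]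
    have e2 : ‖toL2 τ x‖ ^ 2 + h * W + (h * K) ^ 2 * ‖toL2 τ x‖ ^ 2 =
        (τ (cfc (fun u : ℝ => u ^ 2 + h * (u ^ 2 * Real.log ((b + δ) / (u + δ))) +
          (h * K) ^ 2 * u ^ 2) x)).re := by
      rw [cfc_add x (fun u : ℝ => u ^ 2 + h * (u ^ 2 * Real.log ((b + δ) / (u + δ))))
          (fun u : ℝ => (h * K) ^ 2 * u ^ 2) (hsq.add (hsl.const_mul h)) (hsq.const_mul _),
        cfc_add x (fun u : ℝ => u ^ 2) _ hsq (hsl.const_mul h),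
        cfc_const_mul _ _ _ hsl, cfc_const_mul _ _ _ hsq, map_add, map_add,
        Complex.add_re, Complex.add_re, trace_real_smul, trace_real_smul, hn]
    rw [inner_toL2, hxs.star_eq, e1, e2]
    refine trace_re_mono (cfc_mono (fun u hu => ?_)
      ((by fun_prop : ContinuousOn (fun u : ℝ => u) _).mul (hrc.mul (by fun_prop))) ?_)
    · have h2 : ((b + δ) / (u + δ)) ^ h ≤
          1 + h * Real.log ((b + δ) / (u + δ)) + (h * K) ^ 2 := by
        rw [Real.rpow_def_of_pos (hqpos u hu), mul_comm]
        have h3 : |h * Real.log ((b + δ) / (u + δ))| ≤ h * K := by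
          rw [abs_mul, abs_of_pos hh]; gcongr; exact hK u hu
        have h4 := le_of_abs_le (Real.abs_exp_sub_one_sub_id_le (h3.trans hhK1))
        have h5 := sq_le_sq' (neg_le_of_abs_le h3) (le_of_abs_le h3)
        linarith
      nlinarith [sq_nonneg u]
    · exact (hsq.add (hsl.const_mul h)).add (hsq.const_mul _)
  -- the difference quotient at `s = t h`
  have hlim1 : Tendsto (fun s : ℝ =>
      (⟪toL2 τ x, ((s⁻¹ : ℝ) : ℂ) • (toL2 τ x - toL2 τ (T s x))⟫_ℂ).re) (𝓝[>] 0)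
      (𝓝 (⟪toL2 τ x, Lx⟫_ℂ).re) :=
    (Complex.continuous_re.tendsto _).comp (tendsto_const_nhds.inner hLx)
  have hlim2 : Tendsto (fun s : ℝ => -(W / t) - s / t ^ 2 * K ^ 2 * ‖toL2 τ x‖ ^ 2) (𝓝[>] 0)
      (𝓝 (-(W / t))) := by
    have : Continuous fun s : ℝ => -(W / t) - s / t ^ 2 * K ^ 2 * ‖toL2 τ x‖ ^ 2 := by fun_prop
    refine (this.tendsto' 0 _ ?_).mono_left nhdsWithin_le_nhds
    ring
  have hle : -(W / t) ≤ (⟪toL2 τ x, Lx⟫_ℂ).re := by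
    refine le_of_tendsto_of_tendsto hlim2 hlim1 ?_
    have hpos : 0 < t * K⁻¹ := by positivity
    filter_upwards [Ioo_mem_nhdsGT hpos] with s hs
    have h1 := hmain (s / t) (div_pos hs.1 ht) (by
      rw [div_le_iff₀ ht, mul_comm]; exact hs.2.le)
    rw [mul_div_cancel₀ _ ht.ne'] at h1
    have h2 : (⟪toL2 τ x, toL2 τ x⟫_ℂ).re = ‖toL2 τ x‖ ^ 2 := by rw [inner_toL2, norm_toL2_sq]
    rw [inner_smul_right, Complex.re_ofReal_mul, inner_sub_right, Complex.sub_re, h2,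
      inv_mul_eq_div, le_div_iff₀ hs.1]
    have h3 : (-(W / t) - s / t ^ 2 * K ^ 2 * ‖toL2 τ x‖ ^ 2) * s =
        -(s / t * W + (s / t * K) ^ 2 * ‖toL2 τ x‖ ^ 2) := by ring
    rw [h3]
    linarith
  have h1 : -W ≤ t * (⟪toL2 τ x, Lx⟫_ℂ).re := by
    have := mul_le_mul_of_nonneg_left hle ht.le
    rwa [mul_neg, mul_div_cancel₀ _ ht.ne'] at this
  rw [hWeq] at h1
  linarith

/-- Ultracontractivity implies the logarithmic Sobolev inequality, by `trace_sq_mul_log_add_le` with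
`b = e^{M(2ε) / 2} ‖x‖_2` and `δ → 0`. -/
theorem IsUltracontractive.logSobolev {M : ℝ → ℝ} (hτ : IsNormalFaithfulFiniteTrace τ)
    (hT : IsSymmetricPositiveContractionSemigroup τ T) (hM : AntitoneOn M (Ioi 0))
    (hU : IsUltracontractive τ T M) : LogSobolev τ T M (1 / 2) := by
  intro x hx Lx hLx ε hε
  rw [lpNorm_two]
  rcases eq_or_ne x 0 with rfl | hx0
  · simp [toL2_zero, cfc_apply_zero]
  have hn : 0 < ‖toL2 τ x‖ := norm_pos_iff.2 fun h => hx0 (toL2_eq_zero hτ h)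
  set n := ‖toL2 τ x‖ with hndef
  set b := Real.exp (M (ε + ε) / 2) * n with hb
  have hbpos : 0 < b := by positivity
  have hS : opNormOneTop τ (T (ε + ε)) ≤ ENNReal.ofReal (Real.exp (M (ε + ε) / 2) ^ 2) := by
    refine (hU (ε + ε) (by positivity)).trans_eq ?_
    rw [← Real.exp_nat_mul]
    congr 2
    push_cast
    ring
  have hbd : ∀ y, ‖toL2 τ (T ε (x * y))‖ ≤ b * ‖toL2 τ y‖ := fun y => by
    refine (norm_toL2_apply_le_of_opNormOneTop_le hτ hT hε (Real.exp_pos _).le hS _).trans ?_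
    rw [hb, mul_assoc]
    gcongr
    exact trace_abs_mul_le hτ x y
  have hδ : ∀ δ : ℝ, 0 < δ → (τ (cfc (fun u : ℝ => u ^ 2 * Real.log u) x)).re ≤
      ε * (⟪toL2 τ x, Lx⟫_ℂ).re + Real.log (b + δ) * n ^ 2 := by
    intro δ hδ
    refine le_trans ?_ (trace_sq_mul_log_add_le hτ hT hx hLx hε hbpos.le hδ hbd)
    have hsp : ∀ u ∈ spectrum ℝ x, 0 < u + δ := fun u hu => by
      have := spectrum_nonneg_of_nonneg hx hu; linarith
    have c1 : Continuous fun u : ℝ => u ^ 2 * Real.log u := by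
      have : (fun u : ℝ => u ^ 2 * Real.log u) = fun u => u * (u * Real.log u) := by
        ext u; ring
      rw [this]
      exact continuous_id.mul Real.continuous_mul_log
    refine trace_re_mono (cfc_mono (fun u hu => ?_) c1.continuousOn
      ((by fun_prop : ContinuousOn (fun u : ℝ => u ^ 2) _).mul
        (ContinuousOn.log (by fun_prop) fun u hu => (hsp u hu).ne')))
    rcases (spectrum_nonneg_of_nonneg hx hu).eq_or_lt with h | h
    · simp [← h]
    · gcongr; linarith
  have hlim : Tendsto (fun δ : ℝ => ε * (⟪toL2 τ x, Lx⟫_ℂ).re + Real.log (b + δ) * n ^ 2) (𝓝[>] 0)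
      (𝓝 (ε * (⟪toL2 τ x, Lx⟫_ℂ).re + Real.log b * n ^ 2)) := by
    have h1 : Tendsto (fun δ : ℝ => b + δ) (𝓝[>] 0) (𝓝 b) := by
      have : Continuous fun δ : ℝ => b + δ := by fun_prop
      exact (this.tendsto' 0 _ (add_zero b)).mono_left nhdsWithin_le_nhds
    exact ((h1.log hbpos.ne').mul_const _).const_add _
  have h1 := ge_of_tendsto hlim (by filter_upwards [self_mem_nhdsWithin] with δ h using hδ δ h)
  have h2 : Real.log b = M (ε + ε) / 2 + Real.log n := by
    rw [hb, Real.log_mul (Real.exp_pos _).ne' hn.ne', Real.log_exp]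
  have h3 : M (ε + ε) ≤ M ε := hM (mem_Ioi.2 hε) (mem_Ioi.2 (by positivity)) (by linarith)
  rw [h2] at h1
  nlinarith [sq_nonneg n]

end Ultracontractive

end UltraLogSobolev

end

theorem theorem4p1 {𝓜 : Type*} [CStarAlgebra 𝓜] [WStarAlgebra 𝓜] [PartialOrder 𝓜]
    [StarOrderedRing 𝓜]
    (τ : 𝓜 →ₚ[ℂ] ℂ) (hτ : UltraLogSobolev.IsNormalFaithfulFiniteTrace τ)
    (T : ℝ → 𝓜 →ₗ[ℂ] 𝓜) (hT : UltraLogSobolev.IsSymmetricPositiveContractionSemigroup τ T)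
    (M : ℝ → ℝ) (hM : AntitoneOn M (Set.Ioi 0)) :
    (UltraLogSobolev.IsUltracontractive τ T M →
      ∃ C : ℝ, 0 < C ∧ UltraLogSobolev.LogSobolev τ T M C) ∧
    (∀ C : ℝ, 0 < C → UltraLogSobolev.LogSobolev τ T M C →
      ∀ t : ℝ, 0 < t → IntervalIntegrable M MeasureTheory.volume 0 t →
        UltraLogSobolev.opNormOneTop τ (T (2 * t)) ≤
          ENNReal.ofReal (Real.exp (UltraLogSobolev.averaged C M t))) :=
  ⟨fun hU => ⟨1 / 2, one_half_pos, hU.logSobolev hτ hT hM⟩,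
    fun _ _ hLS _ ht hMt => hLS.opNormOneTop_le hτ hT ht hMt⟩
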